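/- A closed trivalent graph $\Gamma\subset S^2$ is a finite graph embedded in the sphere, possibly disconnected, with loops and multiple edges allowed, whose edges are directed; each edge is either a circle without vertices or an arc between two (not necessarily distinct) vertices, and every vertex has exactly three half-edges, leaving it either in the directions up-left, up-right, down (a "$Y$") or in the directions up, down-left, down-right (an upside-down "$Y$"). Graphs are considered up to isotopy of the sphere, and are encoded by listing, for each half-edge, its counterclockwise successor at its vertex, its direction at the vertex, and the complementary region (connected component of $S^2\setminus\Gamma$) to its left. Consider the following local operations. - Edge reversal: reverse the orientation of one edge. - Vertex spiral: turn one vertex by one notch in either direction, bending the ends of its edges along, so that a $Y$ becomes an upside-down $Y$ whose upper leg is one of the two former upper legs, or the inverse of this. - $F$-move, along an edge $e$ with two distinct end points, all edges flowing downwards: if $a$ and $b$ merge into $e$, and $e$ and $c$ merge into $d$, then replace this by $b$ and $c$ merging into $e$, and $a$ and $e$ merging into $d$ (with $a,b,c$ arriving in this order from left to right); or the inverse; or the upside-down version of either. - Circle removal: delete a vertex-free circle that bounds, on its left, a disk containing no other part of the graph. - Tadpole trim: if a loop bounds a disk containing no other part of the graph, runs clockwise from the upper left to the upper right leg of a $Y$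 whose stem flows down to the upper leg of an upside-down $Y$, whose lower left leg $a$ arrives and whose lower right leg $b$ departs, then delete the loop and the stem and let $a$ continue into $b$. - Bubble pop: if, all edges flowing downwards, $t$ splits at an upside-down $Y$ into $l$ and $r$, which bound a disk containing no other part of the graph and merge at a $Y$ into $b$, then delete $l$ and $r$ and let $t$ continue into $b$. (In the last two operations the two joined edges may coincide, in which case the result is a circle.) **Lemma.** There is an algorithm, running in time polynomial in the length of the encoding of $\Gamma$, which, given a closed trivalent graph $\Gamma\subset S^2$, constructs a sequence of closed trivalent graphs $\Gamma_0,\Gamma_1,\dots,\Gamma_l$ embedded in $S^2$ with $\Gamma_0=\Gamma$ and $\Gamma_l=\emptyset$, such that each $\Gamma_{i+1}$ is obtained from $\Gamma_i$ by one of the operations above. Moreover, each edge reversal, vertex spiral and $F$-move in the sequence keeps the number of complementary regions, and each circle removal, tadpole trim and bubble pop lowers it by exactly one; so the sequence falls into stages, each of which ends with such a removal and lowers the number of complementary regions by one. -/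

import Mathlib

/-! ## Trivalent graphs embedded in the sphere

A closed trivalent graph in `S²` is encoded, up to isotopy of the sphere, by a combinatorial map:
its half-edges, the counterclockwise rotation at the vertices, the direction in which each
half-edge leaves its vertex, the orientations of the edges, and the complementary region to the
left of each half-edge. The graph may be disconnected, have loops and multiple edges, and have
vertex-free circle components. -/

/-- The half-edges ("darts") of a graph with directed edges `0, …, n - 1`: `(e, false)` is the
initial half of `e`, and `(e, true)` is its terminal half. A dart is thought of as pointing away
from its vertex, towards the middle of its edge. -/
abbrev Dart (n : ℕ) : Type := Fin n × Bool

/-- The other half of the same edge. -/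
def Dart.flip {n : ℕ} (d : Dart n) : Dart n := (d.1, !d.2)

theorem Dart.flip_flip {n : ℕ} (d : Dart n) : d.flip.flip = d := by
  simp [Dart.flip]

/-- The involution exchanging the two halves of every edge. -/
def flipPerm (n : ℕ) : Equiv.Perm (Dart n) where
  toFun := Dart.flip
  invFun := Dart.flip
  left_inv := Dart.flip_flip
  right_inv := Dart.flip_flip

/-- The six directions in which a half-edge can leave a vertex, in counterclockwise order. At each
vertex one arc is vertical and the other two are diagonal and opposite to it: the three darts are
either (up-left, up-right, down), "a `Y`", or (up, down-left, down-right), "an upside-down `Y`". -/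
abbrev Direction : Type := ZMod 6

namespace Direction
abbrev upRight : Direction := 0
abbrev up : Direction := 1
abbrev upLeft : Direction := 2
abbrev downLeft : Direction := 3
abbrev down : Direction := 4
abbrev downRight : Direction := 5
end Direction

/-- The number of orbits (cycles, including fixed points) of a permutation. -/
noncomputable def orbitCount {α : Type} (p : Equiv.Perm α) : ℕ :=
  Nat.card (Quotient (Equiv.Perm.SameCycle.setoid p))

/-- A closed trivalent graph with `n` directed edges, embedded in the sphere with `m`
complementary regions.

A circle component (a closed edge without vertices) is an edge whose two darts have no direction;
it is treated as though it carried one two-valent marker, i.e. its two darts are each other's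
successors in `rot`. -/
structure SphereGraph (n m : ℕ) where
  /-- the counterclockwise successor of a dart around its vertex -/
  rot : Equiv.Perm (Dart n)
  /-- the direction in which a dart leaves its vertex; `none` on circle components -/
  dir : Dart n → Option Direction
  /-- the complementary region to the left of a dart -/
  region : Dart n → Fin m
  dir_flip : ∀ d, dir d = none → dir d.flip = none
  rot_circle : ∀ d, dir d = none → rot d = d.flip
  dir_rot : ∀ d x, dir d = some x → dir (rot d) = some (x + 2)
  rot_rot_rot : ∀ d, dir d ≠ none → rot (rot (rot d)) = d
  /-- Walking along `d` and then turning left as sharply as possible, one stays on the boundary of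
  the region on the left. -/
  region_face : ∀ d, region (rot.symm d.flip) = region d
  /-- Every region has an edge on its boundary, unless the graph is empty. -/
  region_surjective : 0 < n → Function.Surjective region
  /-- The surface made of the graph and its regions is connected. -/
  connected : ∀ d d' : Dart n, Relation.ReflTransGen
    (fun x y => y = rot x ∨ y = x.flip ∨ region y = region x) d d'
  /-- The surface obtained by gluing, for each region, a sphere with holes to the boundary walks
  of that region has Euler characteristic `V - E + ∑ (2 - #holes) = V - E + 2 m - F = 2`, where
  `F` is the number of boundary walks; being connected and closed, it is `S²`. -/
  euler : orbitCount rot + 2 * m = n + orbitCount ((flipPerm n).trans rot.symm) + 2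

namespace SphereGraph

variable {n m n' m' : ℕ}

/-- The three darts are the darts of one vertex of shape `Y`. -/
def IsY (Γ : SphereGraph n m) (upLeft upRight down : Dart n) : Prop :=
  Γ.dir upLeft = some Direction.upLeft ∧ Γ.dir upRight = some Direction.upRight ∧
  Γ.dir down = some Direction.down ∧
  Γ.rot upRight = upLeft ∧ Γ.rot upLeft = down ∧ Γ.rot down = upRight

/-- The three darts are the darts of one vertex of shape upside-down `Y`. -/
def IsInvY (Γ : SphereGraph n m) (up downLeft downRight : Dart n) : Prop :=
  Γ.dir up = some Direction.up ∧ Γ.dir downLeft = some Direction.downLeft ∧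
  Γ.dir downRight = some Direction.downRight ∧
  Γ.rot up = downLeft ∧ Γ.rot downLeft = downRight ∧ Γ.rot downRight = up

/-! ### Moves that keep the numbers of edges and of regions -/

/-- `Γ'` is `Γ` with the orientation of the edge `e` reversed. -/
def EdgeReversal (e : Fin n) (Γ Γ' : SphereGraph n m) : Prop :=
  ∀ d, Γ'.rot (Equiv.swap (e, false) (e, true) d) = Equiv.swap (e, false) (e, true) (Γ.rot d) ∧
    Γ'.dir (Equiv.swap (e, false) (e, true) d) = Γ.dir d ∧
    Γ'.region (Equiv.swap (e, false) (e, true) d) = Γ.region d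

/-- `Γ'` is `Γ` with the vertex of the dart `v` turned by one notch, counterclockwise (`s = 1`) or
clockwise (`s = -1`): a `Y` becomes an upside-down `Y` one of whose lower legs is the former stem,
and vice versa. The ends of the three edges are bent along; their orientations are arbitrary. -/
def VertexSpiral (v : Dart n) (s : Direction) (Γ Γ' : SphereGraph n m) : Prop :=
  Γ.dir v ≠ none ∧ (s = 1 ∨ s = -1) ∧ Γ'.rot = Γ.rot ∧ Γ'.region = Γ.region ∧
  ∀ d, Γ'.dir d = if Γ.rot.SameCycle v d then (Γ.dir d).map (· + s) else Γ.dir d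

/-- All edges flow downwards: `a` and `b` merge into `e`, then `e` and `c` merge into `d`. -/
def MergeLeft (Γ : SphereGraph n m) (e a b c d : Fin n) : Prop :=
  Γ.IsY (a, true) (b, true) (e, false) ∧ Γ.IsY (e, true) (c, true) (d, false)

/-- All edges flow downwards: `b` and `c` merge into `e`, then `a` and `e` merge into `d`. -/
def MergeRight (Γ : SphereGraph n m) (e a b c d : Fin n) : Prop :=
  Γ.IsY (b, true) (c, true) (e, false) ∧ Γ.IsY (a, true) (e, true) (d, false)

/-- All edges flow downwards: `d` splits into `e` and `c`, then `e` splits into `a` and `b`. -/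
def SplitLeft (Γ : SphereGraph n m) (e a b c d : Fin n) : Prop :=
  Γ.IsInvY (d, true) (e, false) (c, false) ∧ Γ.IsInvY (e, true) (a, false) (b, false)

/-- All edges flow downwards: `d` splits into `a` and `e`, then `e` splits into `b` and `c`. -/
def SplitRight (Γ : SphereGraph n m) (e a b c d : Fin n) : Prop :=
  Γ.IsInvY (d, true) (a, false) (e, false) ∧ Γ.IsInvY (e, true) (b, false) (c, false)

/-- An `F`-move along the edge `e`, which has two distinct end points (this is what `d ≠ e` says),
between the vertices that carry the ends of the edges `a`, `b`, `c`, `d` (not necessarily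
distinct). Nothing changes away from the two end points of `e`, and the regions keep their names;
those to the left and to the right of `e` itself are determined by `region_face`. -/
def FMove (e : Fin n) (Γ Γ' : SphereGraph n m) : Prop :=
  ∃ a b c d : Fin n, d ≠ e ∧
    ((Γ.MergeLeft e a b c d ∧ Γ'.MergeRight e a b c d) ∨
     (Γ.MergeRight e a b c d ∧ Γ'.MergeLeft e a b c d) ∨
     (Γ.SplitLeft e a b c d ∧ Γ'.SplitRight e a b c d) ∨
     (Γ.SplitRight e a b c d ∧ Γ'.SplitLeft e a b c d)) ∧
    (∀ x, ¬ Γ.rot.SameCycle (e, false) x → ¬ Γ.rot.SameCycle (e, true) x →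
      Γ'.rot x = Γ.rot x ∧ Γ'.dir x = Γ.dir x) ∧
    (∀ x : Dart n, x.1 ≠ e → Γ'.region x = Γ.region x)

/-! ### Moves that remove a region -/

/-- `κ` identifies the regions of `Γ'` with the regions of `Γ` other than `R`. -/
def DropsRegion (R : Fin m) (κ : Fin m' → Fin m) : Prop :=
  Function.Injective κ ∧ Set.range κ = {R}ᶜ

/-- `Γ` contains a counterclockwise circle `c` which bounds a disk without further edges, and `Γ'`
is `Γ` without this circle. -/
def CircleRemoval (Γ : SphereGraph n m) (Γ' : SphereGraph n' m') : Prop :=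
  ∃ c : Fin n, Γ.dir (c, false) = none ∧
    (∀ x, Γ.region x = Γ.region (c, false) ↔ x = (c, false)) ∧
    ∃ (ι : Fin n' → Fin n) (κ : Fin m' → Fin m),
      Function.Injective ι ∧ Set.range ι = {c}ᶜ ∧ DropsRegion (Γ.region (c, false)) κ ∧
      ∀ x : Dart n',
        Γ.rot (ι x.1, x.2) = (ι (Γ'.rot x).1, (Γ'.rot x).2) ∧
        Γ.dir (ι x.1, x.2) = Γ'.dir x ∧
        Γ.region (ι x.1, x.2) = κ (Γ'.region x)

/-- `Γ'` is obtained from `Γ` by deleting the edges in `L`, together with the region `R`, and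
joining the end of the edge `a` to the beginning of the edge `b`: `a` and `b` become one edge, and
if `a = b` they become a circle. `ι` identifies the darts of `Γ'` with darts of `Γ`. -/
def Splice (L : Set (Fin n)) (R : Fin m) (a b : Fin n)
    (Γ : SphereGraph n m) (Γ' : SphereGraph n' m') : Prop :=
  ∃ (ι : Dart n' → Dart n) (κ : Fin m' → Fin m),
    Function.Injective ι ∧
    (∀ x, x ∈ Set.range ι ↔ x.1 ∉ L ∧ (a ≠ b → x ≠ (a, true) ∧ x ≠ (b, false))) ∧
    (∀ e, (ι (e, false)).2 = false ∧
      ι (e, true) = if ι (e, false) = (a, false) then (b, true) else (ι (e, false)).flip) ∧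
    DropsRegion R κ ∧
    (∀ x, Γ.region (ι x) = κ (Γ'.region x)) ∧
    ∀ x, if a = b ∧ (ι x).1 = a then Γ'.dir x = none
      else Γ.rot (ι x) = ι (Γ'.rot x) ∧ Γ.dir (ι x) = Γ'.dir x

/-- A loop `p`, running clockwise from the upper left to the upper right end of a `Y` around a disk
without further edges, with the stem `s` flowing down to an upside-down `Y` between `a` and `b`:
the loop and the stem are removed, and `a` continues into `b`. -/
def TadpoleTrim (Γ : SphereGraph n m) (Γ' : SphereGraph n' m') : Prop :=
  ∃ p s a b : Fin n,
    Γ.IsY (p, false) (p, true) (s, false) ∧ Γ.IsInvY (s, true) (a, true) (b, false) ∧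
    (∀ x, Γ.region x = Γ.region (p, true) ↔ x = (p, true)) ∧
    Splice {p, s} (Γ.region (p, true)) a b Γ Γ'

/-- All edges flow downwards: `t` splits into `l` and `r`, which bound a disk without further
edges and merge again into `b`. The bubble is removed, and `t` continues into `b`. -/
def BubblePop (Γ : SphereGraph n m) (Γ' : SphereGraph n' m') : Prop :=
  ∃ t l r b : Fin n,
    Γ.IsInvY (t, true) (l, false) (r, false) ∧ Γ.IsY (l, true) (r, true) (b, false) ∧
    (∀ x, Γ.region x = Γ.region (l, false) ↔ x = (l, false) ∨ x = (r, true)) ∧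
    Splice {l, r} (Γ.region (l, false)) t b Γ Γ'

end SphereGraph

/-- A closed trivalent graph embedded in the sphere. -/
structure TrivalentGraph where
  /-- the number of edges, circles included -/
  edges : ℕ
  /-- the number of complementary regions -/
  regions : ℕ
  graph : SphereGraph edges regions

namespace TrivalentGraph

/-- A graph without edges is empty, since every vertex is the end point of an edge. -/
def IsEmpty (Γ : TrivalentGraph) : Prop := Γ.edges = 0

/-- `F`-moves, vertex spirals, and edge orientation reversals. -/
inductive Rearrangement : TrivalentGraph → TrivalentGraph → Prop
  | edgeReversal {n m : ℕ} {Γ Γ' : SphereGraph n m} (e : Fin n) :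
      SphereGraph.EdgeReversal e Γ Γ' → Rearrangement ⟨n, m, Γ⟩ ⟨n, m, Γ'⟩
  | vertexSpiral {n m : ℕ} {Γ Γ' : SphereGraph n m} (v : Dart n) (s : Direction) :
      SphereGraph.VertexSpiral v s Γ Γ' → Rearrangement ⟨n, m, Γ⟩ ⟨n, m, Γ'⟩
  | fMove {n m : ℕ} {Γ Γ' : SphereGraph n m} (e : Fin n) :
      SphereGraph.FMove e Γ Γ' → Rearrangement ⟨n, m, Γ⟩ ⟨n, m, Γ'⟩

/-- Circle removals, tadpole trims, and bubble pops. -/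
inductive Removal : TrivalentGraph → TrivalentGraph → Prop
  | circleRemoval {Γ Γ' : TrivalentGraph} :
      SphereGraph.CircleRemoval Γ.graph Γ'.graph → Removal Γ Γ'
  | tadpoleTrim {Γ Γ' : TrivalentGraph} :
      SphereGraph.TadpoleTrim Γ.graph Γ'.graph → Removal Γ Γ'
  | bubblePop {Γ Γ' : TrivalentGraph} :
      SphereGraph.BubblePop Γ.graph Γ'.graph → Removal Γ Γ'

/-! ### Encoding of graphs as strings -/

/-- The alphabet in which graphs and sequences of graphs are written. -/
inductive Letter
  | tick
  | comma
  | semicolon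
  deriving DecidableEq

instance : Fintype Letter where
  elems := {Letter.tick, Letter.comma, Letter.semicolon}
  complete := by intro x; cases x <;> decide

/-- A number in unary, with an end marker. (All numbers in the code of a graph are at most linear
in its number of edges, and each edge is listed, so writing them in binary would change lengths
only polynomially.) -/
def encodeNat (k : ℕ) : List Letter := List.replicate k Letter.tick ++ [Letter.comma]

/-- The number of a dart. -/
def dartNumber {n : ℕ} (d : Dart n) : ℕ := 2 * d.1.val + d.2.toNat

/-- The number of a direction, or `0` if there is none. -/
def directionNumber (x : Option Direction) : ℕ := x.elim 0 (fun y => y.val + 1)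

/-- The record of a dart: its successor in the rotation, its direction, and its region. -/
def encodeDart {n m : ℕ} (Γ : SphereGraph n m) (d : Dart n) : List Letter :=
  encodeNat (dartNumber (Γ.rot d)) ++ encodeNat (directionNumber (Γ.dir d)) ++
    encodeNat (Γ.region d).val

/-- A graph is written as the list of the records of its darts. -/
def encode (Γ : TrivalentGraph) : List Letter :=
  (List.finRange Γ.edges).flatMap
    fun e => encodeDart Γ.graph (e, false) ++ encodeDart Γ.graph (e, true)

/-- A sequence of graphs is written by listing the graphs, each followed by a semicolon. -/
def encodeSequence (L : List TrivalentGraph) : List Letter :=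
  L.flatMap fun Γ => encode Γ ++ [Letter.semicolon]

/-! ### The encodings are injective -/

theorem encodeNat_append_inj {k k' : ℕ} {s s' : List Letter}
    (h : encodeNat k ++ s = encodeNat k' ++ s') : k = k' ∧ s = s' := by
  induction k generalizing k' with
  | zero => cases k' <;> simp_all [encodeNat, List.replicate_succ]
  | succ k ih =>
    cases k' with
    | zero => simp [encodeNat, List.replicate_succ] at h
    | succ k' =>
      have := @ih k' (by simpa [encodeNat, List.replicate_succ] using h)
      simpa using this

theorem dartNumber_injective {n : ℕ} : Function.Injective (dartNumber (n := n)) := by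
  rintro ⟨⟨e, he⟩, b⟩ ⟨⟨e', he'⟩, b'⟩ h
  cases b <;> cases b' <;> simp [dartNumber] at h ⊢ <;> omega

theorem directionNumber_injective : Function.Injective directionNumber := by
  intro x y h
  cases x <;> cases y <;> simp [directionNumber] at h ⊢
  exact ZMod.val_injective 6 h

/-- The records of the darts of the listed edges. -/
def encodeEdges {n m : ℕ} (Γ : SphereGraph n m) (L : List (Fin n)) : List Letter :=
  L.flatMap fun e => encodeDart Γ (e, false) ++ encodeDart Γ (e, true)

theorem count_comma_encodeEdges {n m : ℕ} (Γ : SphereGraph n m) (L : List (Fin n)) :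
    (encodeEdges Γ L).count Letter.comma = 6 * L.length := by
  induction L with
  | nil => rfl
  | cons e L ih =>
    rw [encodeEdges, List.flatMap_cons, List.count_append]
    change _ + (encodeEdges Γ L).count Letter.comma = _
    rw [ih]
    simp [encodeDart, encodeNat, List.count_replicate]
    omega

theorem encodeEdges_inj {n m m' : ℕ} {Γ : SphereGraph n m} {Γ' : SphereGraph n m'}
    {L : List (Fin n)} (h : encodeEdges Γ L = encodeEdges Γ' L) :
    ∀ e ∈ L, ∀ b, Γ.rot (e, b) = Γ'.rot (e, b) ∧ Γ.dir (e, b) = Γ'.dir (e, b) ∧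
      (Γ.region (e, b)).val = (Γ'.region (e, b)).val := by
  induction L with
  | nil => simp
  | cons a L ih =>
    simp only [encodeEdges, List.flatMap_cons, encodeDart, List.append_assoc] at h
    obtain ⟨h1, h⟩ := encodeNat_append_inj h
    obtain ⟨h2, h⟩ := encodeNat_append_inj h
    obtain ⟨h3, h⟩ := encodeNat_append_inj h
    obtain ⟨h4, h⟩ := encodeNat_append_inj h
    obtain ⟨h5, h⟩ := encodeNat_append_inj h
    obtain ⟨h6, h⟩ := encodeNat_append_inj h
    intro e he b
    rcases List.mem_cons.1 he with rfl | he
    · cases b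
      · exact ⟨dartNumber_injective h1, directionNumber_injective h2, h3⟩
      · exact ⟨dartNumber_injective h4, directionNumber_injective h5, h6⟩
    · exact ih (by simpa only [encodeEdges, encodeDart, List.append_assoc] using h) e he b

theorem encode_injective : Function.Injective encode := by
  rintro ⟨n, m, Γ⟩ ⟨n', m', Γ'⟩ h
  change encodeEdges Γ (List.finRange n) = encodeEdges Γ' (List.finRange n') at h
  have hn : n = n' := by
    have := congrArg (List.count Letter.comma) h
    rw [count_comma_encodeEdges, count_comma_encodeEdges, List.length_finRange,
      List.length_finRange] at this
    omega
  subst hn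
  have hd := encodeEdges_inj h
  have hrot : Γ.rot = Γ'.rot := Equiv.ext fun d => (hd d.1 (List.mem_finRange _) d.2).1
  have hdir : Γ.dir = Γ'.dir := funext fun d => (hd d.1 (List.mem_finRange _) d.2).2.1
  have hreg : ∀ d, (Γ.region d).val = (Γ'.region d).val :=
    fun d => (hd d.1 (List.mem_finRange _) d.2).2.2
  have hm : m = m' := by
    have h1 := Γ.euler
    have h2 := Γ'.euler
    rw [hrot] at h1
    omega
  subst hm
  have hreg' : Γ.region = Γ'.region := funext fun d => Fin.ext (hreg d)
  cases Γ
  cases Γ'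
  simp_all

theorem semicolon_not_mem_encode (Γ : TrivalentGraph) : Letter.semicolon ∉ encode Γ := by
  simp [encode, encodeDart, encodeNat]

theorem append_semicolon_inj {u u' s s' : List Letter} (hu : Letter.semicolon ∉ u)
    (hu' : Letter.semicolon ∉ u') (h : u ++ Letter.semicolon :: s = u' ++ Letter.semicolon :: s') :
    u = u' ∧ s = s' := by
  induction u generalizing u' with
  | nil =>
    cases u' with
    | nil => exact ⟨rfl, (List.cons.inj h).2⟩
    | cons y u' => exact absurd ((List.cons.inj h).1 ▸ List.mem_cons_self) hu'
  | cons x u ih =>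
    cases u' with
    | nil => exact absurd ((List.cons.inj h).1 ▸ List.mem_cons_self) hu
    | cons y u' =>
      obtain ⟨h1, h2⟩ := List.cons.inj h
      obtain ⟨h3, h4⟩ := ih (fun m => hu (List.mem_cons_of_mem _ m))
        (fun m => hu' (List.mem_cons_of_mem _ m)) h2
      exact ⟨by rw [h1, h3], h4⟩

theorem encodeSequence_injective : Function.Injective encodeSequence := by
  intro L L' h
  induction L generalizing L' with
  | nil => cases L' <;> simp_all [encodeSequence]
  | cons Γ L ih =>
    cases L' with
    | nil => simp [encodeSequence] at h
    | cons Γ' L' =>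
      simp only [encodeSequence, List.flatMap_cons, List.append_assoc, List.cons_append,
        List.nil_append] at h
      obtain ⟨h1, h2⟩ :=
        append_semicolon_inj (semicolon_not_mem_encode Γ) (semicolon_not_mem_encode Γ') h
      rw [encode_injective h1, ih h2]

end TrivalentGraph

/-! A small region always exists, by Euler's formula. Eliminating the number of vertices with the
help of trivalence turns the formula into `12 m = A + 6 F + 12`, where `A` counts the darts of edges
that have vertices and `F` the boundary walks (`SphereGraph.euler'`). So, averaged over the regions,
six times the number of walks plus the number of darts is less than 12, and a nonempty graph has a
region with a single boundary walk, a disk, of weight below six. To rule out edges with this disk on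
both sides, every empty loop first hands the weight of its inner dart to the outer one; a walk
through both sides of an edge then weighs at least 1 + 1 + 2 + 2. Hence there is always a disk with
at most five sides, each of which separates it from a different region (`SphereGraph.exists_good`).

If such a disk has one side, it is bounded by a circle or by the head of a tadpole; if it has two,
it is a bubble. Edge reversals and vertex spirals bring it into standard position, and the removal
applies. If it has more sides, an `F`-move along one of them takes this edge off its boundary and
leaves a disk of the same kind with one side fewer (`SphereGraph.Good.fMove`). The potential `6 m +
k`, with `k` the number of sides of a smallest such disk, drops in every round: an `F`-move lowers
`k`, and a removal lowers `m` by one while `k` becomes at most 5. Since `m` is at most twice the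
number `n` of edges, `12 n + 5` rounds suffice (`Journal.exists_next`,
`Journal.exists_records_empty`).

That each move yields a graph on the sphere again is a matter of counting boundary walks. An
`F`-move keeps their number. Popping a bubble or trimming a tadpole destroys one walk and six darts
with a direction, removing a circle destroys two walks; either way the right side of `12 m = A + 6 F
+ 12` loses 12 (`SphereGraph.exists_fMove`, `exists_splice`, `exists_circleRemoval`).

For the running time, a graph is stored as three lists of numbers (`Tables`), and the tables of all
graphs so far are kept in a `Journal`. One round is a fixed composition of list operations. The
class `PolyTime` is closed under composition, pairing, branching and loops whose length and states
are polynomially bounded; its members are computed by structured programs on four stacks, which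
`Cmd.machine` compiles to a Turing machine with the same number of steps but one. The journal stays
polynomial because a round adds at most 16 tables and the number of edges never grows. -/

/-! ## Structured programs on four stacks and their compilation to Turing machines -/

/-- The names of the four stacks: the value, the save stack, a buffer and a counter. -/
inductive Stack
  | value
  | saved
  | buffer
  | counter
  deriving DecidableEq

instance : Fintype Stack where
  elems := {Stack.value, Stack.saved, Stack.buffer, Stack.counter}
  complete := by intro x; cases x <;> decide

abbrev Letter := TrivalentGraph.Letter

/-- The contents of the four stacks. -/
abbrev Stacks := Stack → List Letter

/-- The stacks with given contents. -/
def Stacks.mk (v s t c : List Letter) : Stacks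
  | .value => v
  | .saved => s
  | .buffer => t
  | .counter => c

namespace Stacks

variable (v s t c x : List Letter)

@[simp] theorem mk_value : mk v s t c .value = v := rfl
@[simp] theorem mk_saved : mk v s t c .saved = s := rfl
@[simp] theorem mk_buffer : mk v s t c .buffer = t := rfl
@[simp] theorem mk_counter : mk v s t c .counter = c := rfl

@[simp] theorem update_value : Function.update (mk v s t c) .value x = mk x s t c := by
  funext k; cases k <;> simp
@[simp] theorem update_saved : Function.update (mk v s t c) .saved x = mk v x t c := by
  funext k; cases k <;> simp
@[simp] theorem update_buffer : Function.update (mk v s t c) .buffer x = mk v s x c := by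
  funext k; cases k <;> simp
@[simp] theorem update_counter : Function.update (mk v s t c) .counter x = mk v s t x := by
  funext k; cases k <;> simp

/-- The total number of letters on the stacks. -/
def size (S : Stacks) : ℕ :=
  (S .value).length + (S .saved).length + (S .buffer).length + (S .counter).length

end Stacks

/-- Structured programs. `loop k go body` pops a letter (or nothing) from the stack `k`, runs the
body for it, and repeats as long as `go` holds for the popped letter. -/
inductive Cmd
  | skip
  | push (k : Stack) (a : Letter)
  | seq (c d : Cmd)
  | loop (k : Stack) (go : Option Letter → Bool) (body : Option Letter → Cmd)

namespace Cmd

/-- `Exec c S t S'`: the program `c` takes the stacks `S` to `S'` in `t` steps. -/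
inductive Exec : Cmd → Stacks → ℕ → Stacks → Prop
  | skip (S) : Exec skip S 0 S
  | push (k a S) : Exec (push k a) S 1 (Function.update S k (a :: S k))
  | seq {c d S t S' t' S''} : Exec c S t S' → Exec d S' t' S'' → Exec (seq c d) S (t + t') S''
  | halt {k go body} {S : Stacks} {t S'} : go (S k).head? = false →
      Exec (body (S k).head?) (Function.update S k (S k).tail) t S' →
      Exec (loop k go body) S (1 + t) S'
  | again {k go body} {S : Stacks} {t S' t' S''} : go (S k).head? = true →
      Exec (body (S k).head?) (Function.update S k (S k).tail) t S' →
      Exec (loop k go body) S' t' S'' → Exec (loop k go body) S (1 + t + t') S''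

/-- The labels of a program. -/
def Label : Cmd → Type
  | skip => Empty
  | push _ _ => Unit
  | seq c d => Label c ⊕ Label d
  | loop _ _ body => Option (Σ o, Label (body o))

instance fintypeLabel : (c : Cmd) → Fintype (Label c)
  | skip => inferInstanceAs (Fintype Empty)
  | push _ _ => inferInstanceAs (Fintype Unit)
  | seq c d =>
    letI := fintypeLabel c
    letI := fintypeLabel d
    inferInstanceAs (Fintype (Label c ⊕ Label d))
  | loop _ _ body =>
    letI := fun o => fintypeLabel (body o)
    inferInstanceAs (Fintype (Option (Σ o, Label (body o))))

/-- The label at which a program starts, given the label at which to go on afterwards. -/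
def entry {L : Type} : (c : Cmd) → (Label c → L) → L → L
  | skip, _, exit => exit
  | push _ _, emb, _ => emb ()
  | seq c d, emb, exit => entry c (fun l => emb (.inl l)) (entry d (fun l => emb (.inr l)) exit)
  | loop _ _ _, emb, _ => emb none

/-- The statements of the Turing machine for a program. The internal state holds the letter popped
last. -/
def code {L : Type} : (c : Cmd) → (Label c → L) → L → Label c →
    Turing.TM2.Stmt (fun _ : Stack => Letter) L (Option Letter)
  | push k a, _, exit, _ => .push k (fun _ => a) (.goto fun _ => exit)
  | seq c d, emb, exit, .inl l =>
    code c (fun l => emb (.inl l)) (entry d (fun l => emb (.inr l)) exit) l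
  | seq _ d, emb, exit, .inr l => code d (fun l => emb (.inr l)) exit l
  | loop k go body, emb, exit, none =>
    .pop k (fun _ o => o) (.goto fun o =>
      entry (body o) (fun l => emb (some ⟨o, l⟩)) (if go o then emb none else exit))
  | loop _ go body, emb, exit, some ⟨o, l⟩ =>
    code (body o) (fun l => emb (some ⟨o, l⟩)) (if go o then emb none else exit) l

/-- The embedding of labels and the exit label are arbitrary, so that the induction hypothesis
applies to a program sitting inside a larger one. The step counts agree exactly because `entry`
resolves `skip` and `seq` when the program is compiled. The internal state on exit is whatever
letter was popped last. -/
theorem Exec.simulate {L : Type}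
    (m : L → Turing.TM2.Stmt (fun _ : Stack => Letter) L (Option Letter)) {c : Cmd} {S S' : Stacks}
    {t : ℕ} (h : Exec c S t S') (emb : Label c → L) (exit : L)
    (hm : ∀ l, m (emb l) = code c emb exit l) (x : Option Letter) :
    ∃ x', (flip bind (Turing.TM2.step m))^[t] (some ⟨some (entry c emb exit), x, S⟩) =
      some ⟨some exit, x', S'⟩ := by
  induction h generalizing exit x with
  | skip S => exact ⟨x, rfl⟩
  | push k a S =>
    have h0 : m (emb ()) = .push k (fun _ => a) (.goto fun _ => exit) := hm ()
    refine ⟨x, ?_⟩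
    simp [flip, entry, h0]
  | @seq c d S t S' t' S'' _ _ ih ih' =>
    obtain ⟨y, hy⟩ := ih (fun l => emb (.inl l)) (entry d (fun l => emb (.inr l)) exit)
      (fun l => hm (.inl l)) x
    obtain ⟨z, hz⟩ := ih' (fun l => emb (.inr l)) exit (fun l => hm (.inr l)) y
    refine ⟨z, ?_⟩
    rw [Nat.add_comm, Function.iterate_add_apply]
    exact (congrArg _ hy).trans hz
  | @halt k go body S t S' hgo _ ih =>
    have h0 : m (emb none) = .pop k (fun _ o => o) (.goto fun o =>
      entry (body o) (fun l => emb (some ⟨o, l⟩)) (if go o then emb none else exit)) := hm none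
    obtain ⟨y, hy⟩ := ih (fun l => emb (some ⟨_, l⟩)) exit
      (fun l => (hm (some ⟨_, l⟩)).trans (by
        change code _ _ (if go _ then _ else _) l = _; rw [hgo]; rfl)) (S k).head?
    refine ⟨y, ?_⟩
    rw [Nat.add_comm, Function.iterate_add_apply, ← hy]
    simp [flip, entry, h0, hgo]
  | @again k go body S t S' t' S'' hgo _ _ ih ih' =>
    have h0 : m (emb none) = .pop k (fun _ o => o) (.goto fun o =>
      entry (body o) (fun l => emb (some ⟨o, l⟩)) (if go o then emb none else exit)) := hm none
    obtain ⟨y, hy⟩ := ih (fun l => emb (some ⟨_, l⟩)) (emb none)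
      (fun l => (hm (some ⟨_, l⟩)).trans (by
        change code _ _ (if go _ then _ else _) l = _; rw [hgo]; rfl)) (S k).head?
    obtain ⟨z, hz⟩ := ih' emb exit hm y
    refine ⟨z, ?_⟩
    rw [Nat.add_comm, Function.iterate_add_apply, Nat.add_comm, Function.iterate_add_apply,
      ← hz]
    congr 1
    rw [show entry (loop k go body) emb exit = emb none from rfl, ← hy]
    congr 1
    simp [flip, h0, hgo]

/-- A step adds at most one letter. Hence running times bound the sizes of results, which is what
closure of `PolyTime` under composition rests on. -/
theorem Exec.size_le {c : Cmd} {S S' : Stacks} {t : ℕ} (h : Exec c S t S') :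
    S'.size ≤ S.size + t := by
  have tail_le : ∀ (S : Stacks) k, Stacks.size (Function.update S k (S k).tail) ≤ S.size := by
    intro S k
    cases k <;> simp [Stacks.size]
  induction h with
  | skip S => simp
  | push k a S => cases k <;> simp [Stacks.size] <;> omega
  | seq => omega
  | @halt k go body S t S' _ _ ih => have := tail_le S k; omega
  | @again k go body S t S' t' S'' _ _ _ ih ih' => have := tail_le S k; omega

/-- The Turing machine of a program. -/
def machine (c : Cmd) : Turing.FinTM2 where
  K := Stack
  k₀ := .value
  k₁ := .value
  Γ := fun _ => Letter
  Λ := Option (Label c)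
  main := entry c some none
  σ := Option Letter
  initialState := none
  m
    -- An output configuration must carry the initial internal state, so the state is reset before
    -- halting.
    | none => .load (fun _ => none) .halt
    | some l => code c some none l

/-- A program that computes `f` on strings in polynomial time yields a Turing machine. -/
theorem computableInPolyTime {α β : Type} {ea : α → List Letter} {eb : β → List Letter}
    {f : α → β} (c : Cmd) (p : Polynomial ℕ)
    (h : ∀ a, ∃ t ≤ p.eval (ea a).length,
      Exec c (Stacks.mk (ea a) [] [] []) t (Stacks.mk (eb (f a)) [] [] [])) :
    Nonempty (Turing.TM2ComputableInPolyTime ea eb f) := by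
  choose t ht hexec using h
  -- The time bound `p + 1` includes the final step at the label `none`.
  refine ⟨{ tm := machine c, inputAlphabet := Equiv.refl _, outputAlphabet := Equiv.refl _,
            time := p + 1, outputsFun := fun a => ⟨⟨t a + 1, ?_⟩, ?_⟩ }⟩
  · obtain ⟨x, hx⟩ := (hexec a).simulate (machine c).m some none (fun l => rfl) none
    rw [Nat.add_comm, Function.iterate_add_apply]
    have h1 : Turing.initList (machine c) (List.map (Equiv.refl Letter).invFun (ea a)) =
        ⟨some (entry c some none), none, Stacks.mk (ea a) [] [] []⟩ := by
      unfold Turing.initList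
      congr 1
      funext k
      cases k <;> simp [machine] <;> rfl
    have h2 : Turing.haltList (machine c) (List.map (Equiv.refl Letter).invFun (eb (f a))) =
        ⟨none, none, Stacks.mk (eb (f a)) [] [] []⟩ := by
      unfold Turing.haltList
      congr 1
      funext k
      cases k <;> simp [machine] <;> rfl
    simp only [Option.map_some]
    erw [h1, h2]
    refine (congrArg _ hx).trans ?_
    rfl
  · simpa using ht a

end Cmd

/-! ## Functions computable in polynomial time -/

/-- Binary trees, the data on which programs operate. -/
inductive Bin
  | nil
  | cons (a b : Bin)

namespace Bin

/-- A binary tree in prefix notation. -/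
def code : Bin → List Letter
  | nil => [.comma]
  | cons a b => .tick :: (code a ++ code b)

/-- This leaves the semicolon free to separate the strings on the save stack. -/
theorem semicolon_not_mem_code (a : Bin) : .semicolon ∉ a.code := by
  induction a <;> simp_all [code]

end Bin

/-- A representation of the elements of a type by binary trees. -/
class Enc (α : Type) where
  enc : α → Bin

section Enc

variable {α β : Type} [Enc α] [Enc β]

/-- The string that represents an element. -/
def str (a : α) : List Letter := (Enc.enc a).code

/-- The length of the representation of an element. -/
def size (a : α) : ℕ := (str a).length

instance : Enc Unit := ⟨fun _ => .nil⟩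

instance : Enc Bool := ⟨fun b => if b then .cons .nil .nil else .nil⟩

/-- Natural numbers in unary. -/
def Bin.ofNat : ℕ → Bin
  | 0 => .nil
  | n + 1 => .cons .nil (ofNat n)

instance : Enc ℕ := ⟨Bin.ofNat⟩

def Bin.ofList : List α → Bin
  | [] => .nil
  | a :: l => .cons (Enc.enc a) (ofList l)

instance : Enc (List α) := ⟨Bin.ofList⟩

instance : Enc (α × β) := ⟨fun x => .cons (Enc.enc x.1) (Enc.enc x.2)⟩

instance {p : α → Prop} : Enc {a // p a} := ⟨fun x => Enc.enc x.1⟩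

instance : Enc Letter := ⟨fun
  | .tick => .nil
  | .comma => .cons .nil .nil
  | .semicolon => .cons .nil (.cons .nil .nil)⟩

theorem semicolon_not_mem_str (a : α) : .semicolon ∉ str a := Bin.semicolon_not_mem_code _

@[simp] theorem str_true : str true = [.tick, .comma, .comma] := rfl
@[simp] theorem str_false : str false = [.comma] := rfl
@[simp] theorem str_zero : str 0 = [.comma] := rfl
@[simp] theorem str_succ (n : ℕ) : str (n + 1) = .tick :: .comma :: str n := rfl
@[simp] theorem str_nil : str ([] : List α) = [.comma] := rfl
@[simp] theorem str_cons (a : α) (l : List α) : str (a :: l) = .tick :: (str a ++ str l) := rfl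
@[simp] theorem str_pair (a : α) (b : β) : str (a, b) = .tick :: (str a ++ str b) := rfl
@[simp] theorem str_val {p : α → Prop} (a : {a // p a}) : str a.1 = str a := rfl

theorem size_pos (a : α) : 0 < size a := by
  unfold size str
  cases Enc.enc a <;> simp [Bin.code]

@[simp] theorem size_unit (x : Unit) : size x = 1 := rfl
@[simp] theorem size_nat (n : ℕ) : size n = 2 * n + 1 := by
  induction n with
  | zero => rfl
  | succ n ih => simp [size] at ih ⊢; omega
@[simp] theorem size_nil : size ([] : List α) = 1 := rfl
@[simp] theorem size_cons (a : α) (l : List α) : size (a :: l) = size a + size l + 1 := by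
  simp [size]
@[simp] theorem size_pair (a : α) (b : β) : size (a, b) = size a + size b + 1 := by
  simp [size]
theorem size_prod (x : α × β) : size x = size x.1 + size x.2 + 1 := size_pair _ _
@[simp] theorem size_val {p : α → Prop} (a : {a // p a}) : size a.1 = size a := rfl

end Enc

/-- Functions bounded by a polynomial in the length of the representation of the argument. -/
def PolyBounded {α : Type} [Enc α] (f : α → ℕ) : Prop :=
  ∃ k, ∀ a, f a ≤ (size a + 2) ^ k

namespace PolyBounded

variable {α β : Type} [Enc α] [Enc β] {f g : α → ℕ}

theorem mono (hg : PolyBounded g) (h : ∀ a, f a ≤ g a) : PolyBounded f :=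
  hg.imp fun _ hk a => (h a).trans (hk a)

theorem size : PolyBounded (size : α → ℕ) := ⟨1, fun a => by simp⟩

/-- The base `size a + 2` is at least 2, so a power of it exceeds any given constant. For the same
reason a sum of two powers costs only one more factor. -/
theorem const (n : ℕ) : PolyBounded (fun _ : α => n) :=
  ⟨n, fun a => (Nat.lt_two_pow_self).le.trans (Nat.pow_le_pow_left (by omega) _)⟩

theorem add (hf : PolyBounded f) (hg : PolyBounded g) : PolyBounded (fun a => f a + g a) := by
  obtain ⟨j, hj⟩ := hf
  obtain ⟨k, hk⟩ := hg
  refine ⟨j + k + 1, fun a => ?_⟩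
  have h1 : (_root_.size a + 2) ^ j ≤ (_root_.size a + 2) ^ (j + k) :=
    Nat.pow_le_pow_right (by omega) (by omega)
  have h2 : (_root_.size a + 2) ^ k ≤ (_root_.size a + 2) ^ (j + k) :=
    Nat.pow_le_pow_right (by omega) (by omega)
  have h3 : (_root_.size a + 2) ^ (j + k) * 2 ≤ (_root_.size a + 2) ^ (j + k + 1) := by
    rw [pow_succ]; exact Nat.mul_le_mul_left _ (by omega)
  have := hj a
  have := hk a
  dsimp only
  omega

theorem mul (hf : PolyBounded f) (hg : PolyBounded g) : PolyBounded (fun a => f a * g a) := by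
  obtain ⟨j, hj⟩ := hf
  obtain ⟨k, hk⟩ := hg
  exact ⟨j + k, fun a => (Nat.mul_le_mul (hj a) (hk a)).trans (pow_add _ _ _).ge⟩

theorem pow (hf : PolyBounded f) (n : ℕ) : PolyBounded (fun a => f a ^ n) := by
  induction n with
  | zero => exact (const 1).mono fun a => by simp
  | succ n ih => exact ih.mul hf

theorem comp {h : β → ℕ} {f : α → β} (hh : PolyBounded h)
    (hf : PolyBounded fun a => _root_.size (f a)) : PolyBounded (fun a => h (f a)) := by
  obtain ⟨j, hj⟩ := hf
  obtain ⟨k, hk⟩ := hh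
  -- With `N = size a + 2 ≥ 2`, the new base is at most `N ^ j + 2 ≤ N ^ j * 4 ≤ N ^ (j + 2)`.
  refine ⟨(j + 2) * k, fun a => (hk _).trans ?_⟩
  rw [pow_mul]
  refine Nat.pow_le_pow_left ?_ _
  have h1 := hj a
  have h2 : 1 ≤ (_root_.size a + 2) ^ j := Nat.one_le_pow _ _ (by omega)
  have h3 : (_root_.size a + 2) ^ j * 4 ≤ (_root_.size a + 2) ^ (j + 2) := by
    rw [pow_add]
    exact Nat.mul_le_mul_left _ ((by norm_num : 4 = 2 ^ 2).le.trans
      (Nat.pow_le_pow_left (by omega) _))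
  dsimp only at h1
  omega

end PolyBounded

/-! ### Copying, exchanging, clearing and splitting strings on the stacks. -/

namespace Cmd

open Stacks

theorem Exec.push_mk {k a} {S S' : Stacks} (h : Function.update S k (a :: S k) = S') :
    Exec (Cmd.push k a) S 1 S' := h ▸ .push k a S

theorem Exec.halt_of {k go body} {S S₁ S' : Stacks} {t : ℕ} (o : Option Letter)
    (ho : (S k).head? = o) (hS : Function.update S k (S k).tail = S₁) (hgo : go o = false)
    (h : Exec (body o) S₁ t S') : Exec (loop k go body) S (1 + t) S' := by
  subst ho hS
  exact .halt hgo h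

theorem Exec.again_of {k go body} {S S₁ S' S'' : Stacks} {t t' : ℕ} (o : Option Letter)
    (ho : (S k).head? = o) (hS : Function.update S k (S k).tail = S₁) (hgo : go o = true)
    (h : Exec (body o) S₁ t S') (h' : Exec (loop k go body) S' t' S'') :
    Exec (loop k go body) S (1 + t + t') S'' := by
  subst ho hS
  exact .again hgo h h'

theorem Exec.congr {c : Cmd} {S S' S'' : Stacks} {t t' : ℕ} (h : Exec c S t S') (ht : t = t')
    (hS : S' = S'') : Exec c S t' S'' := ht ▸ hS ▸ h

/-- Pop letters from a stack, up to and including the first semicolon, and run a program for each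
of them but the semicolon. -/
def drain (k : Stack) (body : Letter → Cmd) : Cmd :=
  loop k (fun o => o.isSome && o != some .semicolon)
    (fun | none => skip | some .semicolon => skip | some a => body a)

/-- Draining a stack that holds a string without semicolons, followed by nothing or by a
semicolon. Here `F p l` are the stacks when the string `l` remains and the letters of `p` have been
popped, in reverse order. -/
theorem exec_drain {k : Stack} {body : Letter → Cmd} (n : ℕ) (F : List Letter → List Letter → Stacks)
    (hF : ∀ p a l, (F p (a :: l) k).head? = some a)
    (hbody : ∀ p a l, Exec (body a) (Function.update (F p (a :: l)) k (F p (a :: l) k).tail) n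
      (F (a :: p) l)) (S : Stacks) {l : List Letter}
    (hend : F l.reverse [] = S ∧ S k = [] ∨ (F l.reverse [] k).head? = some .semicolon ∧
      Function.update (F l.reverse []) k (F l.reverse [] k).tail = S) (hl : .semicolon ∉ l) :
    Exec (drain k body) (F [] l) ((n + 1) * l.length + 1) S := by
  suffices h : ∀ l p, .semicolon ∉ l → (F (l.reverse ++ p) [] = S ∧ S k = [] ∨
      (F (l.reverse ++ p) [] k).head? = some .semicolon ∧
      Function.update (F (l.reverse ++ p) []) k (F (l.reverse ++ p) [] k).tail = S) →
      Exec (drain k body) (F p l) ((n + 1) * l.length + 1) S from h l [] hl (by simpa using hend)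
  clear hend hl l
  intro l
  induction l with
  | nil =>
    intro p _ hend
    rcases hend with ⟨h1, h2⟩ | ⟨h1, h2⟩
    · change F p [] = S at h1
      refine Exec.halt_of (t := 0) none (by rw [h1, h2]; rfl) ?_ rfl (.skip _)
      rw [h1, h2, List.tail_nil, ← h2, Function.update_eq_self]
    · exact Exec.halt_of (t := 0) _ h1 h2 rfl (.skip _)
  | cons a l ih =>
    intro p hl hend
    simp only [List.mem_cons, not_or] at hl
    have hb := hbody p a l
    have h := ih (a :: p) hl.2 (by simpa using hend)
    have : Exec (drain k body) (F p (a :: l)) (1 + n + ((n + 1) * l.length + 1)) S := by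
      cases a with
      | semicolon => exact absurd rfl hl.1
      | tick => exact .again_of _ (hF _ _ _) rfl rfl hb h
      | comma => exact .again_of _ (hF _ _ _) rfl rfl hb h
    convert this using 1
    simp only [List.length_cons]
    ring

/-- Save a copy of the value. -/
def dup : Cmd :=
  .seq (drain .value (.push .buffer)) (.seq (.push .saved .semicolon)
    (drain .buffer fun a => .seq (.push .value a) (.push .saved a)))

/-- Put the string saved last before the value. -/
def prepend : Cmd :=
  .seq (drain .saved (.push .buffer)) (drain .buffer (.push .value))

/-- Exchange the value with the string saved last. -/
def exchange : Cmd :=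
  .seq (drain .value (.push .buffer)) (.seq (drain .saved (.push .counter))
    (.seq (.push .saved .semicolon) (.seq (drain .buffer (.push .saved))
      (drain .counter (.push .value)))))

/-- Clear the value. -/
def clear : Cmd := drain .value fun _ => skip

variable {v u σ t c : List Letter}

theorem exec_value_buffer (hv : .semicolon ∉ v) :
    Exec (drain .value (.push .buffer)) (mk v σ t c) (2 * v.length + 1)
      (mk [] σ (v.reverse ++ t) c) :=
  exec_drain 1 (fun p l => mk l σ (p ++ t) c) (fun _ _ _ => rfl)
    (fun _ _ _ => .push_mk (by simp)) _ (.inl ⟨rfl, rfl⟩) hv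

theorem exec_buffer_value (hv : .semicolon ∉ v) :
    Exec (drain .buffer (.push .value)) (mk u σ v c) (2 * v.length + 1)
      (mk (v.reverse ++ u) σ [] c) :=
  exec_drain 1 (fun p l => mk (p ++ u) σ l c) (fun _ _ _ => rfl)
    (fun _ _ _ => .push_mk (by simp)) _ (.inl ⟨rfl, rfl⟩) hv

theorem exec_buffer_saved (hv : .semicolon ∉ v) :
    Exec (drain .buffer (.push .saved)) (mk u σ v c) (2 * v.length + 1)
      (mk u (v.reverse ++ σ) [] c) :=
  exec_drain 1 (fun p l => mk u (p ++ σ) l c) (fun _ _ _ => rfl)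
    (fun _ _ _ => .push_mk (by simp)) _ (.inl ⟨rfl, rfl⟩) hv

theorem exec_counter_value (hv : .semicolon ∉ v) :
    Exec (drain .counter (.push .value)) (mk u σ t v) (2 * v.length + 1)
      (mk (v.reverse ++ u) σ t []) :=
  exec_drain 1 (fun p l => mk (p ++ u) σ t l) (fun _ _ _ => rfl)
    (fun _ _ _ => .push_mk (by simp)) _ (.inl ⟨rfl, rfl⟩) hv

theorem exec_saved_buffer (hv : .semicolon ∉ v) :
    Exec (drain .saved (.push .buffer)) (mk u (v ++ .semicolon :: σ) t c) (2 * v.length + 1)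
      (mk u σ (v.reverse ++ t) c) :=
  exec_drain 1 (fun p l => mk u (l ++ .semicolon :: σ) (p ++ t) c) (fun _ _ _ => rfl)
    (fun _ _ _ => .push_mk (by simp)) _ (.inr ⟨rfl, by simp⟩) hv

theorem exec_saved_counter (hv : .semicolon ∉ v) :
    Exec (drain .saved (.push .counter)) (mk u (v ++ .semicolon :: σ) t c) (2 * v.length + 1)
      (mk u σ t (v.reverse ++ c)) :=
  exec_drain 1 (fun p l => mk u (l ++ .semicolon :: σ) t (p ++ c)) (fun _ _ _ => rfl)
    (fun _ _ _ => .push_mk (by simp)) _ (.inr ⟨rfl, by simp⟩) hv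

theorem exec_clear (hv : .semicolon ∉ v) :
    Exec clear (mk v σ t c) (v.length + 1) (mk [] σ t c) := by
  have := exec_drain (k := .value) (body := fun _ => skip) 0 (fun p l => mk l σ t c)
    (fun _ _ _ => rfl) (fun _ _ _ => by simpa using Exec.skip _) _ (.inl ⟨rfl, rfl⟩) hv
  simpa [clear] using this

theorem exec_dup (hv : .semicolon ∉ v) :
    Exec dup (mk v σ [] []) (5 * v.length + 3) (mk v (v ++ .semicolon :: σ) [] []) := by
  have h : Exec _ (mk [] (.semicolon :: σ) (v.reverse ++ []) [])
      ((2 + 1) * (v.reverse ++ []).length + 1)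
      (mk ((v.reverse ++ []).reverse ++ []) ((v.reverse ++ []).reverse ++ .semicolon :: σ) [] []) :=
    exec_drain (k := .buffer) (body := fun a => .seq (.push .value a) (.push .saved a)) 2
      (fun p l => mk (p ++ []) (p ++ .semicolon :: σ) l []) (fun _ _ _ => rfl)
      (fun p a l => .seq (t := 1) (t' := 1) (S' := mk (a :: p ++ []) (p ++ .semicolon :: σ) l [])
        (.push_mk (by simp)) (.push_mk (by simp))) _ (.inl ⟨rfl, rfl⟩) (by simpa using hv)
  have := (exec_value_buffer (σ := σ) (t := []) (c := []) hv).seq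
    (.seq (Exec.push_mk (k := .saved) (a := .semicolon)
      (S' := mk [] (.semicolon :: σ) (v.reverse ++ []) []) (by simp)) h)
  exact this.congr (by simp; ring) (by simp)

theorem exec_prepend (hu : .semicolon ∉ u) :
    Exec prepend (mk v (u ++ .semicolon :: σ) [] []) (4 * u.length + 2) (mk (u ++ v) σ [] []) := by
  have := (exec_saved_buffer (u := v) (σ := σ) (t := []) (c := []) hu).seq
    (exec_buffer_value (by simpa using hu))
  exact this.congr (by simp; ring) (by simp)

theorem exec_exchange (hv : .semicolon ∉ v) (hu : .semicolon ∉ u) :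
    Exec exchange (mk v (u ++ .semicolon :: σ) [] []) (4 * v.length + 4 * u.length + 5)
      (mk u (v ++ .semicolon :: σ) [] []) := by
  have := (exec_value_buffer (σ := u ++ .semicolon :: σ) (t := []) (c := []) hv).seq
    ((exec_saved_counter hu).seq ((Exec.push_mk (k := .saved) (a := .semicolon) (update_saved ..)).seq
      ((exec_buffer_saved (by simpa using hv)).seq (exec_counter_value (by simpa using hu)))))
  exact this.congr (by simp; ring) (by simp)

/-- Move one tree, in prefix notation, from the value to the buffer. The counter holds one letter
for each tree still to be moved. -/
def walk : Cmd :=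
  loop .counter (fun o => o.isSome) fun
    | none => skip
    | some _ => loop .value (fun _ => false) fun
      | some .tick => .seq (.push .buffer .tick)
          (.seq (.push .counter .tick) (.push .counter .tick))
      | some a => .push .buffer a
      | none => skip

/-- Prefix notation is read with a counter of the trees still due: a tick replaces one tree by two,
a comma settles one. The statement extends a given run backwards by the reading of `a`, which lets
the induction chain the two subtrees. Each letter costs at most five steps. -/
theorem exec_walk_append (a : Bin) {r : List Letter} {S : Stacks} {n : ℕ}
    (h : Exec walk (mk r σ (a.code.reverse ++ t) c) n S) :
    ∃ m ≤ n + 5 * a.code.length, Exec walk (mk (a.code ++ r) σ t (.tick :: c)) m S := by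
  induction a generalizing r t c n with
  | nil =>
    refine ⟨_, ?_, .again_of (some .tick) rfl (update_counter ..) rfl
      (.halt_of (some .comma) rfl (update_value ..) rfl (.push_mk (update_buffer ..))) h⟩
    simp [Bin.code]; omega
  | cons a b iha ihb =>
    obtain ⟨m, hm, h⟩ := ihb (t := a.code.reverse ++ .tick :: t) (by simpa [Bin.code] using h)
    obtain ⟨m', hm', h⟩ := iha h
    have h' : Exec walk (mk ((Bin.cons a b).code ++ r).tail σ (.tick :: t) (.tick :: .tick :: c))
        m' S := by simpa [Bin.code] using h
    refine ⟨_, ?_, .again_of (some .tick) rfl (update_counter ..) rfl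
      (.halt_of (some .tick) rfl (update_value ..) rfl
        (.seq (.push_mk (update_buffer ..)) (.seq (.push_mk (update_counter ..))
          (.push_mk (update_counter ..))))) h'⟩
    simp [Bin.code]; omega

theorem exec_walk (a : Bin) (r : List Letter) :
    ∃ m ≤ 5 * a.code.length + 1,
      Exec walk (mk (a.code ++ r) σ [] [.tick]) m (mk r σ a.code.reverse []) := by
  obtain ⟨m, hm, h⟩ := exec_walk_append a (r := r) (σ := σ) (t := []) (c := [])
    (S := mk r σ a.code.reverse []) (n := 1)
    (.halt_of (t := 0) (S₁ := mk r σ a.code.reverse []) none rfl (by simp) rfl (.skip _))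
  exact ⟨m, by omega, h⟩

/-- Replace a pair by its first entry. -/
def first : Cmd :=
  loop .value (fun _ => false) fun
    | some .tick => .seq (.push .counter .tick) (.seq walk (.seq clear
        (drain .buffer (.push .value))))
    -- The empty tree is sent to itself. This fixes the default values: the head of an empty list of
    -- numbers is `0`, and likewise for `second` the tail of an empty list is empty and the
    -- predecessor of `0` is `0`.
    | _ => .push .value .comma

/-- Replace a pair by its second entry. -/
def second : Cmd :=
  loop .value (fun _ => false) fun
    | some .tick => .seq (.push .counter .tick) (.seq walk (drain .buffer fun _ => skip))
    | _ => .push .value .comma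

theorem exec_first (a b : Bin) :
    ∃ m ≤ 10 * (Bin.cons a b).code.length + 10,
      Exec first (mk (Bin.cons a b).code σ [] []) m (mk a.code σ [] []) := by
  obtain ⟨m, hm, h⟩ := exec_walk (σ := σ) a b.code
  refine ⟨_, ?_, .halt_of (some .tick) rfl (update_value ..) rfl
    (.seq (.push_mk (update_counter ..)) (.seq h (.seq (exec_clear b.semicolon_not_mem_code)
      (by simpa using exec_buffer_value (u := []) (c := []) (v := a.code.reverse)
            (by simpa using a.semicolon_not_mem_code)))))⟩
  simp [Bin.code]; omega

theorem exec_second (a b : Bin) :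
    ∃ m ≤ 10 * (Bin.cons a b).code.length + 10,
      Exec second (mk (Bin.cons a b).code σ [] []) m (mk b.code σ [] []) := by
  obtain ⟨m, hm, h⟩ := exec_walk (σ := σ) a b.code
  have := exec_drain (k := .buffer) (body := fun _ => skip) 0 (fun p l => mk b.code σ l [])
    (fun _ _ _ => rfl) (fun _ _ _ => by simpa using Exec.skip _) _ (.inl ⟨rfl, rfl⟩)
    (l := a.code.reverse) (by simpa using a.semicolon_not_mem_code)
  refine ⟨_, ?_, .halt_of (some .tick) rfl (update_value ..) rfl
    (.seq (.push_mk (update_counter ..)) (.seq h this))⟩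
  simp [Bin.code]; omega

theorem exec_first_nil : Exec first (mk Bin.nil.code σ [] []) 2 (mk Bin.nil.code σ [] []) :=
  .halt_of (t := 1) (some .comma) rfl (update_value ..) rfl (.push_mk (update_value ..))

theorem exec_second_nil : Exec second (mk Bin.nil.code σ [] []) 2 (mk Bin.nil.code σ [] []) :=
  .halt_of (t := 1) (some .comma) rfl (update_value ..) rfl (.push_mk (update_value ..))

/-- Replace the value by a string, given in reverse order. -/
def write : List Letter → Cmd
  | [] => clear
  | a :: l => .seq (write l) (.push .value a)

theorem exec_write (l : List Letter) (hv : .semicolon ∉ v) :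
    Exec (write l) (mk v σ [] []) (v.length + 1 + l.length) (mk l σ [] []) := by
  induction l with
  | nil => exact exec_clear hv
  | cons a l ih => exact (ih.seq (.push_mk (update_value ..))).congr (by simp; ring) rfl

end Cmd

open Cmd Stacks in
/-- Functions on represented types that a program computes in polynomial time. -/
@[fun_prop]
def PolyTime {α β : Type} [Enc α] [Enc β] (f : α → β) : Prop :=
  ∃ (c : Cmd) (b : α → ℕ), PolyBounded b ∧ ∀ a σ, ∃ t ≤ b a,
    Exec c (mk (str a) σ [] []) t (mk (str (f a)) σ [] [])

namespace PolyTime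

open Cmd Stacks

variable {α β γ δ ε : Type} [Enc α] [Enc β] [Enc γ] [Enc δ] [Enc ε]

theorem size_le {f : α → β} (hf : PolyTime f) : PolyBounded fun a => size (f a) := by
  obtain ⟨c, b, hb, h⟩ := hf
  refine (PolyBounded.size.add hb).mono fun a => ?_
  obtain ⟨t, ht, h⟩ := h a []
  have := h.size_le
  simp [Stacks.size] at this
  change _ ≤ (str a).length + _
  unfold _root_.size
  omega

/-- Changing the type without changing the representation. -/
theorem of_str_eq {f : α → β} (h : ∀ a, str (f a) = str a) : PolyTime f :=
  ⟨.skip, fun _ => 0, .const 0, fun a _ => ⟨0, le_rfl, (h a).symm ▸ .skip _⟩⟩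

/-- Only the representing strings matter, so the values may even change their type. Most closure
properties below rewrite a function into one already treated that prints the same string. -/
theorem congr_str {f : α → β} {g : α → γ} (hf : PolyTime f) (h : ∀ a, str (f a) = str (g a)) :
    PolyTime g := by
  obtain ⟨c, b, hb, hc⟩ := hf
  exact ⟨c, b, hb, fun a σ => h a ▸ hc a σ⟩

@[fun_prop]
protected theorem id : PolyTime fun a : α => a := of_str_eq fun _ => rfl

@[fun_prop]
theorem comp {g : β → γ} {f : α → β} (hg : PolyTime g) (hf : PolyTime f) :
    PolyTime fun a => g (f a) := by
  have hs := hf.size_le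
  obtain ⟨c, b, hb, hc⟩ := hf
  obtain ⟨c', b', hb', hc'⟩ := hg
  refine ⟨.seq c c', _, hb.add (hb'.comp hs), fun a σ => ?_⟩
  obtain ⟨t, ht, h⟩ := hc a σ
  obtain ⟨t', ht', h'⟩ := hc' (f a) σ
  exact ⟨_, Nat.add_le_add ht ht', h.seq h'⟩

@[fun_prop]
theorem const (b : β) : PolyTime fun _ : α => b := by
  refine ⟨write (str b), _, PolyBounded.size.add (.const (1 + (str b).length)), fun a σ => ?_⟩
  exact ⟨_, by simp only [_root_.size]; omega, exec_write _ (semicolon_not_mem_str a)⟩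

-- A copy of the argument waits on the save stack while `f` is computed, then it is exchanged with
-- the value of `f` while `g` is computed. This uses that programs run correctly above arbitrary
-- saved strings `σ`.
@[fun_prop]
theorem pair {f : α → β} {g : α → γ} (hf : PolyTime f) (hg : PolyTime g) :
    PolyTime fun a => (f a, g a) := by
  have hfs := hf.size_le
  have hgs := hg.size_le
  obtain ⟨c, b, hb, hc⟩ := hf
  obtain ⟨c', b', hb', hc'⟩ := hg
  refine ⟨.seq dup (.seq c (.seq exchange (.seq c' (.seq prepend (.push .value .tick))))), _,
    ((((PolyBounded.const 5).mul .size).add hb).add ((PolyBounded.const 4).mul .size)).add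
      (((PolyBounded.const 8).mul hfs).add (hb'.add (.const 20))), fun a σ => ?_⟩
  obtain ⟨t, ht, h⟩ := hc a (str a ++ .semicolon :: σ)
  obtain ⟨t', ht', h'⟩ := hc' a (str (f a) ++ .semicolon :: σ)
  refine ⟨_, ?_, .seq (exec_dup (semicolon_not_mem_str a)) (.seq h
    (.seq (exec_exchange (semicolon_not_mem_str _) (semicolon_not_mem_str a))
      (.seq h' (.seq (exec_prepend (semicolon_not_mem_str _)) (.push_mk (update_value ..))))))⟩
  simp only [_root_.size]
  omega

@[fun_prop]
theorem fst {f : α → β × γ} (hf : PolyTime f) : PolyTime fun a => (f a).1 := by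
  refine comp (g := Prod.fst) ?_ hf
  refine ⟨first, _, ((PolyBounded.const 10).mul .size).add (.const 10), fun a σ => ?_⟩
  exact exec_first _ _

@[fun_prop]
theorem snd {f : α → β × γ} (hf : PolyTime f) : PolyTime fun a => (f a).2 := by
  refine comp (g := Prod.snd) ?_ hf
  refine ⟨second, _, ((PolyBounded.const 10).mul .size).add (.const 10), fun a σ => ?_⟩
  exact exec_second _ _

/-- Evaluate a condition, saving the value. -/
theorem exists_test {c : α → Bool} (hc : PolyTime c) :
    ∃ (d : Cmd) (b : α → ℕ), PolyBounded b ∧ ∀ a σ, ∃ t ≤ b a,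
      Exec d (mk (str a) σ [] []) t (mk (str (c a)) (str a ++ .semicolon :: σ) [] []) := by
  obtain ⟨d, b, hb, h⟩ := hc
  refine ⟨.seq dup d, _, (((PolyBounded.const 5).mul .size).add (.const 3)).add hb, fun a σ => ?_⟩
  obtain ⟨t, ht, h⟩ := h a (str a ++ .semicolon :: σ)
  exact ⟨_, Nat.add_le_add le_rfl ht, .seq (exec_dup (semicolon_not_mem_str a)) h⟩

theorem exec_restore (a : α) (σ : List Letter) :
    Exec prepend (mk [] (str a ++ .semicolon :: σ) [] []) (4 * size a + 2) (mk (str a) σ [] []) :=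
  (exec_prepend (v := []) (semicolon_not_mem_str a)).congr rfl (by simp)

theorem exec_clear_restore (a : α) (σ : List Letter) :
    Exec (.seq clear prepend) (mk [.comma, .comma] (str a ++ .semicolon :: σ) [] [])
      (3 + (4 * size a + 2)) (mk (str a) σ [] []) :=
  .seq (exec_clear (v := [.comma, .comma]) (by simp)) (exec_restore a σ)

@[fun_prop]
theorem ite' {c : α → Bool} {f g : α → β} (hc : PolyTime c) (hf : PolyTime f) (hg : PolyTime g) :
    PolyTime fun a => bif c a then f a else g a := by
  obtain ⟨d, b, hb, hd⟩ := exists_test hc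
  obtain ⟨c₁, b₁, hb₁, hc₁⟩ := hf
  obtain ⟨c₂, b₂, hb₂, hc₂⟩ := hg
  refine ⟨.seq d (.loop .value (fun _ => false) fun
      | some .tick => .seq (.seq clear prepend) c₁
      | _ => .seq prepend c₂), _,
    (hb.add (hb₁.add hb₂)).add (((PolyBounded.const 4).mul .size).add (.const 20)), fun a σ => ?_⟩
  obtain ⟨t, ht, h⟩ := hd a σ
  obtain ⟨t₁, ht₁, h₁⟩ := hc₁ a σ
  obtain ⟨t₂, ht₂, h₂⟩ := hc₂ a σ
  cases hca : c a with
  | true =>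
    rw [hca] at h
    refine ⟨_, ?_, .seq h (.halt_of (some .tick) rfl (update_value ..) rfl
      (.seq (exec_clear_restore a σ) (by simpa [hca] using h₁)))⟩
    omega
  | false =>
    rw [hca] at h
    refine ⟨_, ?_, .seq h (.halt_of (some .comma) rfl (update_value ..) rfl
      (.seq (exec_restore a σ) (by simpa [hca] using h₂)))⟩
    omega

/-- A loop of polynomially many rounds, during which the sizes stay polynomial. The value in the
`i`-th round is `x i`. -/
theorem whileLoop {c : α → Bool} {body : {a // c a = true} → α} {g : α → α} (hc : PolyTime c)
    (hbody : PolyTime body) {B : α → ℕ} (hB : PolyBounded B)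
      (h : ∀ a, ∃ N ≤ B a, ∃ x : ℕ → α, x 0 = a ∧ x N = g a ∧ c (x N) = false ∧
      (∀ i ≤ N, size (x i) ≤ B a) ∧
      ∀ i < N, ∃ h : c (x i) = true, x (i + 1) = body ⟨x i, h⟩) :
    PolyTime g := by
  obtain ⟨d, b, ⟨k, hb⟩, hd⟩ := exists_test hc
  obtain ⟨e, b', ⟨k', hb'⟩, he⟩ := hbody
  have hT := (hB.add (.const 2)).pow k
  have hT' := (hB.add (.const 2)).pow k'
  -- The condition is evaluated before the loop and again at the end of each round, with the state
  -- saved beneath its truth value. The loop pops the first letter of that value: a tick means true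
  -- and leaves two commas to be cleared, a comma means false and leaves nothing.
  refine ⟨.seq d (.loop .value (· = some .tick) fun
      | some .tick => .seq (.seq clear prepend) (.seq e d)
      | _ => prepend), _,
    hT.add (((PolyBounded.const 4).mul hB |>.add (.const 3)).add
      (hB.mul ((((PolyBounded.const 4).mul hB).add (.const 6)).add (hT'.add hT)))), fun a σ => ?_⟩
  obtain ⟨N, hN, x, hx0, hxN, hcN, hsize, hstep⟩ := h a
  have hpow : ∀ i ≤ N, ∀ j, (size (x i) + 2) ^ j ≤ (B a + 2) ^ j := fun i hi j =>
    Nat.pow_le_pow_left (Nat.add_le_add_right (hsize i hi) 2) j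
  -- Induction on the number `j` of rounds still to come. One round restores the state, runs the
  -- body and repeats the test, all within bounds that depend on `B a` alone.
  have key : ∀ j ≤ N, ∃ t ≤ 4 * B a + 3 + j * (4 * B a + 6 + ((B a + 2) ^ k' + (B a + 2) ^ k)),
      Exec (.loop .value (· = some .tick) fun
        | some .tick => .seq (.seq clear prepend) (.seq e d)
        | _ => prepend)
      (mk (str (c (x (N - j)))) (str (x (N - j)) ++ .semicolon :: σ) [] []) t
      (mk (str (g a)) σ [] []) := by
    intro j
    induction j with
    | zero =>
      intro _
      rw [Nat.sub_zero, hcN, ← hxN]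
      refine ⟨_, ?_, .halt_of (some .comma) rfl (update_value ..) (by simp) (exec_restore _ σ)⟩
      have := hsize N le_rfl
      omega
    | succ j ih =>
      intro hj
      obtain ⟨t, ht, h⟩ := ih (by omega)
      obtain ⟨htrue, hnext⟩ := hstep (N - (j + 1)) (by omega)
      rw [show N - (j + 1) + 1 = N - j by omega] at hnext
      rw [htrue]
      obtain ⟨t₁, ht₁, h₁⟩ := he ⟨x (N - (j + 1)), htrue⟩ σ
      rw [← hnext] at h₁
      obtain ⟨t₂, ht₂, h₂⟩ := hd (x (N - j)) σ
      refine ⟨_, ?_, .again_of (some .tick) rfl (update_value ..) (by simp)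
        (.seq (exec_clear_restore _ σ) (.seq h₁ h₂)) h⟩
      have h1 := hsize (N - (j + 1)) (by omega)
      have h2 := (hb' ⟨x (N - (j + 1)), htrue⟩).trans (hpow (N - (j + 1)) (by omega) k')
      have h3 := (hb (x (N - j))).trans (hpow (N - j) (by omega) k)
      rw [add_mul]
      omega
  obtain ⟨t, ht, h⟩ := key N le_rfl
  rw [Nat.sub_self, hx0] at h
  obtain ⟨t', ht', h'⟩ := hd a σ
  refine ⟨_, ?_, .seq h' h⟩
  have h1 := (hb a).trans (by simpa [hx0] using hpow 0 (Nat.zero_le _) k)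
  have h2 := Nat.mul_le_mul_right (4 * B a + 6 + ((B a + 2) ^ k' + (B a + 2) ^ k)) hN
  omega

@[fun_prop]
theorem ite {p : α → Prop} [DecidablePred p] {f g : α → β} (hp : PolyTime fun a => decide (p a))
    (hf : PolyTime f) (hg : PolyTime g) : PolyTime fun a => if p a then f a else g a :=
  (hp.ite' hf hg).congr_str fun a => by by_cases h : p a <;> simp [h]

/-! ### Booleans and emptiness tests -/

@[fun_prop]
theorem not {f : α → Bool} (hf : PolyTime f) : PolyTime fun a => !f a :=
  (hf.ite' (const false) (const true)).congr_str fun a => by cases f a <;> rfl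

@[fun_prop]
theorem and {f g : α → Bool} (hf : PolyTime f) (hg : PolyTime g) : PolyTime fun a => f a && g a :=
  (hf.ite' hg (const false)).congr_str fun a => by cases f a <;> rfl

@[fun_prop]
theorem or {f g : α → Bool} (hf : PolyTime f) (hg : PolyTime g) : PolyTime fun a => f a || g a :=
  (hf.ite' (const true) hg).congr_str fun a => by cases f a <;> rfl

/-- The first letter decides: it is a comma for the empty tree and a tick for any other. -/
theorem isNil_of {c : α → Bool} (h : ∀ a, c a = true ↔ Enc.enc a = .nil) : PolyTime c := by
  refine ⟨.loop .value (fun _ => false) fun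
    | some .comma => write (str true)
    | _ => write (str false), _, PolyBounded.size.add (.const 20), fun a σ => ?_⟩
  have ha := h a
  unfold _root_.size str at *
  cases he : Enc.enc a with
  | nil =>
    rw [ha.2 he]
    refine ⟨_, ?_, .halt_of (some .comma) rfl (update_value ..) rfl (exec_write _ (v := []) ?_)⟩
    · simp [Enc.enc, Bin.code]
    · simp
  | cons b d =>
    have hf : c a = false := by
      rw [← Bool.not_eq_true, ha, he]; simp
    rw [hf]
    refine ⟨_, ?_, .halt_of (some .tick) rfl (update_value ..) rfl
      (exec_write _ (v := b.code ++ d.code) ?_)⟩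
    · simp [Enc.enc, Bin.code]; omega
    · simpa using ⟨b.semicolon_not_mem_code, d.semicolon_not_mem_code⟩

@[fun_prop]
theorem decide_true {f : α → Bool} (hf : PolyTime f) : PolyTime fun a => decide (f a = true) :=
  hf.congr_str fun a => by simp

@[fun_prop]
theorem decide_not {p : α → Prop} [DecidablePred p] (hp : PolyTime fun a => decide (p a)) :
    PolyTime fun a => decide (¬p a) :=
  hp.not.congr_str fun a => by simp

@[fun_prop]
theorem decide_and {p q : α → Prop} [DecidablePred p] [DecidablePred q]
    (hp : PolyTime fun a => decide (p a)) (hq : PolyTime fun a => decide (q a)) :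
    PolyTime fun a => decide (p a ∧ q a) :=
  (hp.and hq).congr_str fun a => by simp

@[fun_prop]
theorem decide_or {p q : α → Prop} [DecidablePred p] [DecidablePred q]
    (hp : PolyTime fun a => decide (p a)) (hq : PolyTime fun a => decide (q a)) :
    PolyTime fun a => decide (p a ∨ q a) :=
  (hp.or hq).congr_str fun a => by simp

theorem decide_congr {p q : α → Prop} [DecidablePred p] [DecidablePred q]
    (hp : PolyTime fun a => decide (p a)) (h : ∀ a, p a ↔ q a) :
    PolyTime fun a => decide (q a) :=
  hp.congr_str fun a => by simp [h]

@[fun_prop]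
theorem isEmpty {f : α → List β} (hf : PolyTime f) : PolyTime fun a => (f a).isEmpty :=
  comp (g := List.isEmpty) (isNil_of fun l => by cases l <;> simp [Enc.enc, Bin.ofList]) hf

@[fun_prop]
theorem isZero {f : α → ℕ} (hf : PolyTime f) : PolyTime fun a => decide (f a = 0) :=
  comp (g := fun n : ℕ => decide (n = 0))
    (isNil_of fun n => by cases n <;> simp [Enc.enc, Bin.ofNat]) hf

/-! ### Lists and numbers, one step at a time -/

@[fun_prop]
theorem cons {f : α → β} {g : α → List β} (hf : PolyTime f) (hg : PolyTime g) :
    PolyTime fun a => f a :: g a :=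
  (hf.pair hg).congr_str fun _ => rfl

@[fun_prop]
theorem succ {f : α → ℕ} (hf : PolyTime f) : PolyTime fun a => f a + 1 :=
  ((const ()).pair hf).congr_str fun _ => rfl

@[fun_prop]
theorem tail {f : α → List β} (hf : PolyTime f) : PolyTime fun a => (f a).tail := by
  refine comp (g := List.tail) ?_ hf
  refine ⟨second, _, ((PolyBounded.const 10).mul .size).add (.const 10), fun l σ => ?_⟩
  cases l with
  | nil => exact ⟨2, by omega, exec_second_nil⟩
  | cons a l => exact exec_second _ _

@[fun_prop]
theorem pred {f : α → ℕ} (hf : PolyTime f) : PolyTime fun a => f a - 1 := by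
  refine comp (g := fun n : ℕ => n - 1) ?_ hf
  refine ⟨second, _, ((PolyBounded.const 10).mul .size).add (.const 10), fun n σ => ?_⟩
  cases n with
  | zero => exact ⟨2, by omega, exec_second_nil⟩
  | succ n => exact exec_second .nil _

@[fun_prop]
theorem headD {f : α → List ℕ} (hf : PolyTime f) : PolyTime fun a => (f a).headD 0 := by
  refine comp (g := fun l : List ℕ => l.headD 0) ?_ hf
  refine ⟨first, _, ((PolyBounded.const 10).mul .size).add (.const 10), fun l σ => ?_⟩
  cases l with
  | nil => exact ⟨2, by omega, exec_first_nil⟩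
  | cons a l => exact exec_first _ _

theorem head : PolyTime fun l : {l : List α // l ≠ []} => l.1.head l.2 := by
  refine ⟨first, _, ((PolyBounded.const 10).mul .size).add (.const 10), fun l σ => ?_⟩
  obtain ⟨l, hl⟩ := l
  cases l with
  | nil => exact absurd rfl hl
  | cons a l => exact exec_first _ _

@[fun_prop]
theorem val {p : β → Prop} {f : α → {b // p b}} (hf : PolyTime f) : PolyTime fun a => (f a).1 :=
  comp (g := Subtype.val) (of_str_eq fun _ => rfl) hf

theorem subtype_mk {p : β → Prop} {f : α → β} (hf : PolyTime f) (h : ∀ a, p (f a)) :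
    PolyTime fun a => (⟨f a, h a⟩ : {b // p b}) :=
  hf.congr_str fun _ => rfl

end PolyTime

/-! ### Sizes of represented lists. -/

section size

variable {α : Type} [Enc α]

theorem length_le_size (l : List α) : l.length ≤ size l := by
  induction l with
  | nil => simp
  | cons a l ih => simp; omega

theorem size_le_of_mem {l : List α} {a : α} (h : a ∈ l) : size a ≤ size l := by
  induction l with
  | nil => simp at h
  | cons b l ih =>
    rcases List.mem_cons.1 h with rfl | h
    · simp; omega
    · have := ih h; simp; omega

/-- Each of the two lists on the right carries an end marker, while the joined list has only one. -/
theorem size_append (l l' : List α) : size (l ++ l') + 1 = size l + size l' := by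
  induction l with
  | nil => simp; omega
  | cons a l ih => simp; omega

theorem size_reverse (l : List α) : size l.reverse = size l := by
  induction l with
  | nil => rfl
  | cons a l ih =>
    have := size_append l.reverse [a]
    simp at this ⊢
    omega

theorem size_list_le {l : List α} {M : ℕ} (h : ∀ a ∈ l, size a ≤ M) :
    size l ≤ l.length * (M + 1) + 1 := by
  induction l with
  | nil => simp
  | cons a l ih =>
    have h1 := ih fun b hb => h b (List.mem_cons_of_mem _ hb)
    have h2 := h a List.mem_cons_self
    simp only [size_cons, List.length_cons, add_mul]
    omega

end size

/-! ### Folds over lists, and the list operations and arithmetic obtained from them. -/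

namespace PolyTime

variable {α β γ δ ε : Type} [Enc α] [Enc β] [Enc γ] [Enc δ] [Enc ε]

/-- A loop whose state holds the parameter, the unread part of the list and the accumulator. The
states are restricted to those that occur in a fold from the given start, because only there does
the hypothesis `h` bound the accumulator. -/
theorem foldl {f : δ → γ → α → γ} {l : δ → List α} {c : δ → γ}
    (hf : PolyTime fun x : δ × γ × α => f x.1 x.2.1 x.2.2) (hl : PolyTime l) (hc : PolyTime c)
    {B : δ → ℕ} (hB : PolyBounded B)
    (h : ∀ d l₁ l₂, l d = l₁ ++ l₂ → size (l₁.foldl (f d) (c d)) ≤ B d) :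
    PolyTime fun d => (l d).foldl (f d) (c d) := by
  let Reached (s : δ × List α × γ) : Prop :=
    ∃ l₁, l s.1 = l₁ ++ s.2.1 ∧ s.2.2 = l₁.foldl (f s.1) (c s.1)
  let next (s : {s // Reached s}) (hs : s.1.2.1 ≠ []) : {s // Reached s} :=
    ⟨(s.1.1, s.1.2.1.tail, f s.1.1 s.1.2.2 (s.1.2.1.head hs)), by
      obtain ⟨l₁, h1, h2⟩ := s.2
      refine ⟨l₁ ++ [s.1.2.1.head hs], by simp [h1], by simp [h2]⟩⟩
  have hstart : PolyTime fun d => (⟨(d, l d, c d), [], rfl, rfl⟩ : {s // Reached s}) :=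
    subtype_mk (by fun_prop) _
  let halt (s : {s // Reached s}) : {s // Reached s} :=
    ⟨(s.1.1, [], (l s.1.1).foldl (f s.1.1) (c s.1.1)), l s.1.1, by simp, rfl⟩
  have hne : ∀ s : {s // Reached s}, (!s.1.2.1.isEmpty) = true → s.1.2.1 ≠ [] := fun s hs => by
    simpa using hs
  have hloop : PolyTime halt := by
    refine whileLoop (c := fun s : {s // Reached s} => !s.1.2.1.isEmpty)
      (body := fun s => next s.1 (hne _ s.2)) (B := fun s : {s // Reached s} => size s.1.1 + size (l s.1.1) +
        B s.1.1 + 2) (by fun_prop) ?_ ?_ ?_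
    · refine subtype_mk (pair (by fun_prop) (pair (by fun_prop) ?_)) _
      refine comp (g := fun x : δ × γ × α => f x.1 x.2.1 x.2.2)
        (f := fun s : {s : {s // Reached s} // (!s.1.2.1.isEmpty) = true} =>
          (s.1.1.1, s.1.1.2.2, s.1.1.2.1.head (hne _ s.2))) hf ?_
      refine pair (by fun_prop) (pair (by fun_prop) ?_)
      exact comp (g := fun l : {l : List α // l ≠ []} => l.1.head l.2) head
        (f := fun s : {s : {s // Reached s} // (!s.1.2.1.isEmpty) = true} => ⟨s.1.1.2.1, hne _ s.2⟩)
        (subtype_mk (by fun_prop) _)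
    · have h1 : PolyTime fun s : {s // Reached s} => s.1.1 := by fun_prop
      exact (((h1.size_le).add ((hl.comp h1).size_le)).add (hB.comp h1.size_le)).add (.const 2)
    · rintro ⟨⟨d, l', c'⟩, l₁, h1, h2⟩
      dsimp only at h1 h2
      have hsz : size l' ≤ size (l d) := by
        have := size_append l₁ l'
        have := size_pos l₁
        rw [h1]; omega
      refine ⟨l'.length, ?_, fun i => ⟨(d, l'.drop i, (l₁ ++ l'.take i).foldl (f d) (c d)),
        l₁ ++ l'.take i, by simp [h1], rfl⟩, ?_, ?_, ?_, ?_, ?_⟩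
      · have := length_le_size l'
        dsimp only
        omega
      · apply Subtype.ext; simp [h2]
      · apply Subtype.ext; simp [halt, h1]
      · simp
      · intro i hi
        have := h d (l₁ ++ l'.take i) (l'.drop i) (by simp [h1])
        have h3 := size_append (l'.take i) (l'.drop i)
        rw [List.take_append_drop] at h3
        have := size_pos (l'.take i)
        rw [← size_val]
        simp only [size_pair]
        omega
      · intro i hi
        refine ⟨by simpa using hi, ?_⟩
        apply Subtype.ext
        simp only [next, List.take_succ_eq_append_getElem hi, ← List.append_assoc,
          List.foldl_append, List.foldl_cons, List.foldl_nil, List.tail_drop, List.head_drop]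
  exact ((hloop.comp hstart).val.snd.snd).congr_str fun d => rfl

end PolyTime

namespace PolyTime

variable {α β γ δ ε : Type} [Enc α] [Enc β] [Enc γ] [Enc δ] [Enc ε]

@[fun_prop]
theorem reverse {l : α → List β} (hl : PolyTime l) : PolyTime fun a => (l a).reverse := by
  have : PolyTime fun a => (l a).foldl (fun acc b => b :: acc) [] := by
    refine foldl (by fun_prop) hl (const []) hl.size_le fun d l₁ l₂ h => ?_
    have h1 := size_append l₁ l₂
    have := size_pos l₂
    have h2 : l₁.foldl (fun acc b => b :: acc) [] = l₁.reverse := by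
      simp
    rw [h2, size_reverse, h]
    omega
  exact this.congr_str fun a => by
    rw [show (l a).foldl (fun acc b => b :: acc) [] = (l a).reverse by
      simp]

@[fun_prop]
theorem append {l l' : α → List β} (hl : PolyTime l) (hl' : PolyTime l') :
    PolyTime fun a => l a ++ l' a := by
  have : PolyTime fun a => (l a).reverse.foldl (fun acc b => b :: acc) (l' a) := by
    refine foldl (by fun_prop) hl.reverse hl' (hl.size_le.add hl'.size_le) fun d l₁ l₂ h => ?_
    have h1 := size_append l₁ l₂
    have := size_pos l₂
    have h2 : l₁.foldl (fun acc b => b :: acc) (l' d) = l₁.reverse ++ l' d := by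
      simp
    have h3 := size_append l₁.reverse (l' d)
    rw [size_reverse] at h3
    rw [← h, size_reverse] at h1
    rw [h2]
    omega
  exact this.congr_str fun a => by
    rw [show (l a).reverse.foldl (fun acc b => b :: acc) (l' a) = l a ++ l' a by
      simp]

/-- An element of the list is no larger than the list, so all its images obey one polynomial bound,
and the accumulator is at most this bound times the length, up to the end marker. -/
theorem flatMap {f : α → β → List γ} {l : α → List β}
    (hf : PolyTime fun x : α × β => f x.1 x.2) (hl : PolyTime l) :
    PolyTime fun a => (l a).flatMap (f a) := by
  obtain ⟨k, hk⟩ := hf.size_le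
  have key : ∀ (g : β → List γ) (l : List β) (acc : List γ),
      l.foldl (fun acc b => acc ++ g b) acc = acc ++ l.flatMap g := by
    intro g l
    induction l with
    | nil => simp
    | cons b l ih => intro acc; simp [ih]
  have : PolyTime fun a => (l a).foldl (fun acc b => acc ++ f a b) [] := by
    refine foldl (f := fun a acc b => acc ++ f a b) (B := fun a => size (l a) *
      ((size a + size (l a) + 1 + 2) ^ k) + 1) ?_ hl (const []) ?_ fun a l₁ l₂ h => ?_
    · exact append (by fun_prop) (comp (g := fun x : α × β => f x.1 x.2)
        (f := fun x : α × List γ × β => (x.1, x.2.2)) hf (by fun_prop))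
    · exact (hl.size_le.mul ((((PolyBounded.size.add hl.size_le).add (.const 1)).add
        (.const 2)).pow k)).add (.const 1)
    · rw [key, List.nil_append]
      have h1 : ∀ b ∈ l₁, size (f a b) ≤ (size a + size (l a) + 1 + 2) ^ k := fun b hb => by
        refine (hk (a, b)).trans (Nat.pow_le_pow_left ?_ k)
        have := size_le_of_mem (l := l a) (a := b) (by simp [h, hb])
        simp only [size_pair]
        omega
      have h2 : ∀ l₁ : List β, (∀ b ∈ l₁, size (f a b) ≤ (size a + size (l a) + 1 + 2) ^ k) →
          size (l₁.flatMap (f a)) ≤ l₁.length * ((size a + size (l a) + 1 + 2) ^ k) + 1 := by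
        intro l₁ h1
        induction l₁ with
        | nil => simp
        | cons b l₁ ih =>
          have h3 := ih fun b hb => h1 b (List.mem_cons_of_mem _ hb)
          have h4 := h1 b List.mem_cons_self
          have h5 := size_append (f a b) (l₁.flatMap (f a))
          rw [List.flatMap_cons, List.length_cons, add_mul]
          omega
      refine (h2 l₁ h1).trans ?_
      have h3 : l₁.length ≤ size (l a) := by
        have := length_le_size (l a)
        simp [h] at this ⊢
        omega
      exact Nat.add_le_add_right (Nat.mul_le_mul_right _ h3) 1
  exact this.congr_str fun a => by rw [key, List.nil_append]

theorem map {f : α → β → γ} {l : α → List β}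
    (hf : PolyTime fun x : α × β => f x.1 x.2) (hl : PolyTime l) :
    PolyTime fun a => (l a).map (f a) :=
  (flatMap (f := fun a b => [f a b]) (hf.cons (const [])) hl).congr_str fun a => by
    rw [← List.map_eq_flatMap]

theorem filter {p : α → β → Prop} [∀ a b, Decidable (p a b)] {l : α → List β}
    (hp : PolyTime fun x : α × β => decide (p x.1 x.2)) (hl : PolyTime l) :
    PolyTime fun a => (l a).filter (fun b => decide (p a b)) :=
  (flatMap (f := fun a b => if p a b then [b] else []) (by fun_prop) hl).congr_str fun a => by
    congr 1
    induction l a with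
    | nil => rfl
    | cons b l ih => by_cases h : p a b <;> simp [h, ih]

@[fun_prop]
theorem length {l : α → List β} (hl : PolyTime l) : PolyTime fun a => (l a).length :=
  (map (f := fun _ _ => ()) (by fun_prop) hl).congr_str fun a => by
    induction l a with
    | nil => rfl
    | cons b l ih => rw [List.map_cons, List.length_cons, str_succ, str_cons, ih]; rfl

/-- The list of `n` units. -/
def units (n : ℕ) : List Unit := List.replicate n ()

omit [Enc γ] in
theorem foldl_units (g : γ → γ) (n : ℕ) (c : γ) :
    (units n).foldl (fun acc _ => g acc) c = g^[n] c := by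
  induction n generalizing c with
  | zero => rfl
  | succ n ih => exact ih (g c)

@[fun_prop]
theorem polyTime_units {f : α → ℕ} (hf : PolyTime f) : PolyTime fun a => units (f a) :=
  hf.congr_str fun a => by
    induction f a with
    | zero => rfl
    | succ n ih => rw [units, List.replicate_succ, str_succ, str_cons, ih]; rfl

/-- A fold over a list of `n` units. The bound is needed for every intermediate value, since
polynomially many rounds of a polynomial-time function could otherwise produce values of exponential
size. -/
theorem iterate {f : α → γ → γ} {n : α → ℕ} {c : α → γ}
    (hf : PolyTime fun x : α × γ => f x.1 x.2) (hn : PolyTime n) (hc : PolyTime c)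
    {B : α → ℕ} (hB : PolyBounded B) (h : ∀ a, ∀ i ≤ n a, size ((f a)^[i] (c a)) ≤ B a) :
    PolyTime fun a => (f a)^[n a] (c a) := by
  have : PolyTime fun a => (units (n a)).foldl (fun acc _ => f a acc) (c a) := by
    refine foldl (f := fun a acc _ => f a acc) (comp (g := fun x : α × γ => f x.1 x.2)
      (f := fun x : α × γ × Unit => (x.1, x.2.1)) hf (by fun_prop)) (by fun_prop) hc hB
      fun a l₁ l₂ hl => ?_
    have hl₁ : l₁ = units l₁.length := List.eq_replicate_iff.2 ⟨rfl, fun _ _ => rfl⟩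
    rw [hl₁, foldl_units]
    refine h a _ ?_
    have := congrArg List.length hl
    simp [units] at this
    omega
  exact this.congr_str fun a => by rw [foldl_units]

@[fun_prop]
theorem natAdd {f g : α → ℕ} (hf : PolyTime f) (hg : PolyTime g) : PolyTime fun a => f a + g a :=
  (iterate (f := fun _ n => n + 1) (c := f) (n := g) (by fun_prop) hg hf
    (hf.size_le.add ((PolyBounded.const 2).mul hg.size_le)) fun a i hi => by
      rw [Nat.succ_iterate]; simp; omega).congr_str fun a => by rw [Nat.succ_iterate]

@[fun_prop]
theorem natSub {f g : α → ℕ} (hf : PolyTime f) (hg : PolyTime g) : PolyTime fun a => f a - g a :=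
  (iterate (f := fun _ => Nat.pred) (c := f) (n := g) (pred (by fun_prop)) hg hf
    hf.size_le fun a i hi => by
      rw [Nat.pred_iterate]; simp).congr_str fun a => by rw [Nat.pred_iterate]

@[fun_prop]
theorem decide_le {f g : α → ℕ} (hf : PolyTime f) (hg : PolyTime g) :
    PolyTime fun a => decide (f a ≤ g a) :=
  decide_congr (p := fun a => f a - g a = 0) (by fun_prop) fun a => by omega

@[fun_prop]
theorem decide_lt {f g : α → ℕ} (hf : PolyTime f) (hg : PolyTime g) :
    PolyTime fun a => decide (f a < g a) :=
  decide_congr (p := fun a => f a + 1 ≤ g a) (by fun_prop) fun a => by omega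

@[fun_prop]
theorem decide_eq {f g : α → ℕ} (hf : PolyTime f) (hg : PolyTime g) :
    PolyTime fun a => decide (f a = g a) :=
  decide_congr (p := fun a => f a ≤ g a ∧ g a ≤ f a) (by fun_prop) fun a => by omega

@[fun_prop]
theorem range {f : α → ℕ} (hf : PolyTime f) : PolyTime fun a => List.range (f a) := by
  -- Prepending the current length over and over lists the numbers in descending order.
  have key : ∀ n, (fun l : List ℕ => l.length :: l)^[n] [] = (List.range n).reverse := by
    intro n
    induction n with
    | zero => rfl
    | succ n ih => rw [Function.iterate_succ_apply', ih, List.range_succ]; simp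
  have : PolyTime fun a => (fun l : List ℕ => l.length :: l)^[f a] [] := by
    refine iterate (f := fun _ l => l.length :: l) (by fun_prop) hf (const [])
      ((hf.size_le.mul (hf.size_le.add (.const 1))).add (.const 1)) fun a i hi => ?_
    rw [key, size_reverse]
    refine (size_list_le (M := size (f a)) fun j hj => ?_).trans ?_
    · have := List.mem_range.1 hj
      simp only [size_nat]; omega
    · refine Nat.add_le_add_right (Nat.mul_le_mul_right _ ?_) 1
      simp only [size_nat, List.length_range]; omega
  exact this.reverse.congr_str fun a => by rw [key, List.reverse_reverse]

@[fun_prop]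
theorem getD {l : α → List ℕ} {i : α → ℕ} (hl : PolyTime l) (hi : PolyTime i) :
    PolyTime fun a => (l a).getD (i a) 0 := by
  have key : ∀ (l : List ℕ) n, List.tail^[n] l = l.drop n := by
    intro l n
    induction n generalizing l with
    | zero => rfl
    | succ n ih => rw [Function.iterate_succ_apply, ih, List.drop_tail]
  have : PolyTime fun a => List.tail^[i a] (l a) := by
    refine iterate (f := fun _ => List.tail) (by fun_prop) hi hl hl.size_le fun a n _ => ?_
    rw [key]
    have := size_append ((l a).take n) ((l a).drop n)
    have := size_pos ((l a).take n)
    rw [List.take_append_drop] at *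
    omega
  exact this.headD.congr_str fun a => by
    rw [key, List.headD_eq_head?_getD, List.head?_drop, List.getD_eq_getElem?_getD]

@[fun_prop]
theorem mod_two {f : α → ℕ} (hf : PolyTime f) : PolyTime fun a => f a % 2 := by
  have key : ∀ n, (fun x => 1 - x)^[n] 0 = n % 2 := by
    intro n
    induction n with
    | zero => rfl
    | succ n ih => rw [Function.iterate_succ_apply', ih]; omega
  exact (iterate (f := fun _ x => 1 - x) (c := fun _ => 0) (by fun_prop) hf (const 0) (.const 3)
    fun a i hi => by rw [key]; simp; omega).congr_str fun a => by rw [key]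

end PolyTime

/-! ### Converting between raw strings and represented lists of letters. -/

namespace Cmd

open Stacks

/-- The string that represents a letter, in reverse order. -/
def letterCode : Letter → List Letter
  | .tick => [.comma]
  | .comma => [.comma, .comma, .tick]
  | .semicolon => [.comma, .comma, .tick, .comma, .tick]

theorem reverse_letterCode (a : Letter) : (letterCode a).reverse = str a := by
  cases a <;> rfl

/-- Push letters, the first one first. -/
def pushAll (k : Stack) : List Letter → Cmd
  | [] => skip
  | a :: l => .seq (.push k a) (pushAll k l)

theorem exec_pushAll_value (l v : List Letter) {s t c : List Letter} :
    Exec (pushAll .value l) (mk v s t c) l.length (mk (l.reverse ++ v) s t c) := by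
  induction l generalizing v with
  | nil => exact .skip _
  | cons a l ih =>
    exact ((Exec.push_mk (update_value ..)).seq (ih _)).congr (by simp; omega) (by simp)

/-- Empty the stack `k`, running a program for each letter. -/
def forEach (k : Stack) (body : Letter → Cmd) : Cmd :=
  loop k (fun o => o.isSome) (fun | none => skip | some a => body a)

theorem exec_forEach {k : Stack} {body : Letter → Cmd} (n : ℕ) (F : List Letter → List Letter → Stacks)
    (hF : ∀ p l, F p l k = l)
    (hbody : ∀ p a l, ∃ m ≤ n, Exec (body a) (Function.update (F p (a :: l)) k l) m (F (a :: p) l)) :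
    ∀ l p, ∃ m ≤ (n + 1) * l.length + 1, Exec (forEach k body) (F p l) m (F (l.reverse ++ p) []) := by
  intro l
  induction l with
  | nil =>
    intro p
    refine ⟨1 + 0, by omega, .halt_of none (by rw [hF]; rfl) ?_ rfl (.skip _)⟩
    rw [hF]
    exact Function.update_eq_self_iff.2 (hF _ _).symm
  | cons a l ih =>
    intro p
    obtain ⟨m, hm, h⟩ := hbody p a l
    obtain ⟨m', hm', h'⟩ := ih (a :: p)
    refine ⟨1 + m + m', ?_, .again_of (some a) (by rw [hF]; rfl) (by rw [hF]; rfl) rfl h ?_⟩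
    swap
    · rw [List.reverse_cons, List.append_assoc]
      exact h'
    rw [List.length_cons, mul_add]
    omega

/-- Turn a string into the string that represents it as a list of letters. -/
def parse : Cmd :=
  .seq (forEach .value (.push .buffer)) (.seq (.push .value .comma)
    (forEach .buffer fun a => .seq (pushAll .value (letterCode a)) (.push .value .tick)))

theorem exec_parse (l : List Letter) :
    ∃ m ≤ 10 * l.length + 10, Exec parse (mk l [] [] []) m (mk (str l) [] [] []) := by
  obtain ⟨m, hm, h⟩ := exec_forEach (k := .value) (body := .push .buffer) 1
    (fun p l => mk l [] p []) (fun _ _ => rfl)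
    (fun p a l => ⟨1, le_rfl, .push_mk (by simp)⟩) l []
  obtain ⟨m', hm', h'⟩ := exec_forEach (k := .buffer)
    (body := fun a => .seq (pushAll .value (letterCode a)) (.push .value .tick)) 6
    (fun p l => mk (str p) [] l []) (fun _ _ => rfl)
    (fun p a l => by
      refine ⟨_, ?_, .seq (by simpa using exec_pushAll_value (letterCode a) (str p))
        (.push_mk (by simp [reverse_letterCode]))⟩
      cases a <;> simp [letterCode]) l.reverse []
  refine ⟨_, ?_, .seq h (.seq (.push_mk (update_value ..)) (by simpa using h'))⟩
  simp only [List.length_reverse] at hm'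
  omega

/-- Read the representation of a letter from the value, and push the letter. -/
def readLetter : Cmd :=
  loop .value (fun _ => false) fun
    | some .tick => loop .value (fun _ => false) fun _ => loop .value (fun _ => false) fun
      | some .tick => loop .value (fun _ => false) fun _ => loop .value (fun _ => false) fun _ =>
        .push .buffer .semicolon
      | _ => .push .buffer .comma
    | _ => .push .buffer .tick

theorem exec_readLetter (a : Letter) (v t : List Letter) :
    ∃ m ≤ 6, Exec readLetter (mk (str a ++ v) [] t []) m (mk v [] (a :: t) []) := by
  cases a with
  | tick =>
    exact ⟨_, by omega, .halt_of (some .comma) rfl (update_value ..) rfl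
      (.push_mk (update_buffer ..))⟩
  | comma =>
    exact ⟨_, by omega, .halt_of (some .tick) rfl (update_value ..) rfl
      (.halt_of (some .comma) rfl (update_value ..) rfl
      (.halt_of (some .comma) rfl (update_value ..) rfl (.push_mk (update_buffer ..))))⟩
  | semicolon =>
    exact ⟨_, by omega, .halt_of (some .tick) rfl (update_value ..) rfl
      (.halt_of (some .comma) rfl (update_value ..) rfl
      (.halt_of (some .tick) rfl (update_value ..) rfl
      (.halt_of (some .comma) rfl (update_value ..) rfl
      (.halt_of (some .comma) rfl (update_value ..) rfl (.push_mk (update_buffer ..))))))⟩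

/-- Turn the string that represents a list of letters into this list. -/
def unparse : Cmd :=
  .seq (loop .value (· = some .tick) fun
    | some .tick => readLetter
    | _ => skip) (forEach .buffer (.push .value))

theorem exec_unparse (l : List Letter) :
    ∃ m ≤ 10 * l.length + 10, Exec unparse (mk (str l) [] [] []) m (mk l [] [] []) := by
  have key : ∀ l t : List Letter, ∃ m ≤ 7 * l.length + 1, Exec (loop .value (· = some .tick) fun
      | some .tick => readLetter
      | _ => skip) (mk (str l) [] t []) m (mk [] [] (l.reverse ++ t) []) := by
    intro l
    induction l with
    | nil =>
      intro t
      exact ⟨1 + 0, by omega, .halt_of (some .comma) rfl (update_value ..) (by simp) (.skip _)⟩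
    | cons a l ih =>
      intro t
      obtain ⟨m, hm, h⟩ := exec_readLetter a (str l) t
      obtain ⟨m', hm', h'⟩ := ih (a :: t)
      refine ⟨1 + m + m', ?_, .again_of (some .tick) rfl (update_value ..) (by simp) h
        (by simpa using h')⟩
      rw [List.length_cons]
      omega
  obtain ⟨m, hm, h⟩ := key l []
  obtain ⟨m', hm', h'⟩ := exec_forEach (k := .buffer) (body := .push .value) 1
    (fun p l => mk p [] l []) (fun _ _ => rfl)
    (fun p a l => ⟨1, le_rfl, .push_mk (by simp)⟩) (l.reverse ++ []) []
  refine ⟨_, ?_, .seq h (by simpa using h')⟩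
  simp only [List.append_nil, List.length_reverse] at hm'
  omega

end Cmd

theorem size_letters_le (l : List Letter) : size l ≤ 6 * l.length + 1 := by
  have := size_list_le (l := l) (M := 5) fun a _ => by cases a <;> decide
  omega

open Cmd in
/-- A function on strings that is computable in polynomial time in the sense of `PolyTime` is
computable in polynomial time by a Turing machine. -/
theorem PolyTime.turing {α β : Type} {ea : α → List Letter} {eb : β → List Letter} {f : α → β}
    {p : List Letter → Prop} (hp : ∀ a, p (ea a)) {g : {l // p l} → List Letter} (hg : PolyTime g)
    (h : ∀ a, g ⟨ea a, hp a⟩ = eb (f a)) :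
    Nonempty (Turing.TM2ComputableInPolyTime ea eb f) := by
  obtain ⟨k', hs⟩ := hg.size_le
  obtain ⟨c, b, ⟨k, hb⟩, hc⟩ := hg
  -- Parsing takes `10 * X + 10` steps. A string of length `X` is represented with size at most `6 *
  -- X + 1`, whence the base `6 * X + 3` in the bounds for the time and for the length of the
  -- result; the last summand pays for turning the result back into a raw string.
  refine computableInPolyTime (.seq parse (.seq c unparse))
    ((10 * .X + 10) + ((6 * .X + 3) ^ k + (10 * (6 * .X + 3) ^ k' + 10))) fun a => ?_
  obtain ⟨t₁, ht₁, h₁⟩ := exec_parse (ea a)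
  obtain ⟨t₂, ht₂, h₂⟩ := hc ⟨ea a, hp a⟩ []
  obtain ⟨t₃, ht₃, h₃⟩ := exec_unparse (g ⟨ea a, hp a⟩)
  rw [← h a]
  refine ⟨_, ?_, .seq h₁ (.seq h₂ h₃)⟩
  have h1 := size_letters_le (ea a)
  have h2 : ∀ j, (size (ea a) + 2) ^ j ≤ (6 * (ea a).length + 3) ^ j := fun j =>
    Nat.pow_le_pow_left (by omega) j
  have h3 := h2 k
  have h4 := h2 k'
  have h5 : b ⟨ea a, hp a⟩ ≤ (size (ea a) + 2) ^ k := hb ⟨ea a, hp a⟩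
  have h6 : size (g ⟨ea a, hp a⟩) ≤ (size (ea a) + 2) ^ k' := hs ⟨ea a, hp a⟩
  have h7 := length_le_size (g ⟨ea a, hp a⟩)
  simp only [Polynomial.eval_add, Polynomial.eval_mul, Polynomial.eval_pow, Polynomial.eval_X,
    Polynomial.eval_ofNat]
  omega

/-! ## Counting orbits -/

namespace Equiv.Perm

theorem SameCycle.map_of_step {α β : Type} {p : Perm α} {q : Perm β} {r : α → β}
    (hr : ∀ a, q.SameCycle (r a) (r (p a))) {a b : α} (h : p.SameCycle a b) :
    q.SameCycle (r a) (r b) := by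
  obtain ⟨i, rfl⟩ := h
  induction i with
  | zero => exact .refl _ _
  | succ i ih =>
    rw [add_comm, zpow_add, zpow_one, mul_apply]
    exact ih.trans (hr _)
  | pred i ih =>
    refine ih.trans ?_
    have := hr ((p ^ (-(i : ℤ) - 1)) a)
    rw [← mul_apply, ← zpow_one_add, add_sub_cancel] at this
    exact this.symm

theorem SameCycle.eq_of_invariant {α β : Type} {p : Perm α} {f : α → β} (hf : ∀ a, f (p a) = f a)
    {a b : α} (h : p.SameCycle a b) : f a = f b := by
  have := h.map_of_step (q := (1 : Perm β)) (r := f) fun a => by rw [hf]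
  simpa using this

end Equiv.Perm

open Equiv.Perm

section orbitCount

variable {α β : Type}

theorem orbitCount_eq_of_maps (p : Equiv.Perm α) (q : Equiv.Perm β) (r : α → β) (s : β → α)
    (hr : ∀ a, q.SameCycle (r a) (r (p a))) (hs : ∀ b, p.SameCycle (s b) (s (q b)))
    (hsr : ∀ a, p.SameCycle (s (r a)) a) (hrs : ∀ b, q.SameCycle (r (s b)) b) :
    orbitCount p = orbitCount q := by
  refine Nat.card_congr
    ⟨Quotient.map' r fun a b h => SameCycle.map_of_step hr h,
     Quotient.map' s fun a b h => SameCycle.map_of_step hs h, ?_, ?_⟩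
  · rintro ⟨a⟩
    exact Quotient.sound' (hsr a)
  · rintro ⟨b⟩
    exact Quotient.sound' (hrs b)

theorem orbitCount_conj (p : Equiv.Perm α) (σ : Equiv.Perm α) :
    orbitCount ((σ.symm.trans p).trans σ) = orbitCount p :=
  orbitCount_eq_of_maps _ _ σ.symm σ (fun a => ⟨1, by simp⟩) (fun b => ⟨1, by simp⟩)
    (fun a => by simp [SameCycle.rfl]) fun b => by simp [SameCycle.rfl]

theorem sameCycle_optionCongr_some (q : Equiv.Perm β) {a b : β} :
    SameCycle (Equiv.optionCongr q) (some a) (some b) ↔ q.SameCycle a b := by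
  constructor
  · intro h
    have := h.map_of_step (q := q) (r := fun o => o.getD a) (fun o => by
      cases o with
      | none => exact .refl _ _
      | some x => exact ⟨1, by simp⟩)
    simpa using this
  · intro h
    exact h.map_of_step (q := Equiv.optionCongr q) (r := some) fun x => ⟨1, by simp⟩

/-- The extra point `none` is a fixed point. In the removals it plays the part of a boundary walk
that disappears. -/
theorem orbitCount_optionCongr [Finite β] (q : Equiv.Perm β) :
    orbitCount (Equiv.optionCongr q) = orbitCount q + 1 := by
  unfold orbitCount
  rw [← Finite.card_option]
  refine Nat.card_congr ⟨Quotient.lift (fun o => o.map (Quotient.mk _)) ?_,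
    fun o => o.elim (Quotient.mk _ none) (Quotient.map' some fun a b h =>
      (sameCycle_optionCongr_some q).2 h), ?_, ?_⟩
  · rintro (_ | a) (_ | b) h
    · rfl
    · have := SameCycle.eq_of_invariant (f := Option.isSome)
        (fun o => by cases o <;> simp) h
      simp at this
    · have := SameCycle.eq_of_invariant (f := Option.isSome)
        (fun o => by cases o <;> simp) h
      simp at this
    · exact congrArg some (Quotient.sound ((sameCycle_optionCongr_some q).1 h))
  · rintro ⟨_ | a⟩ <;> rfl
  · rintro (_ | a)
    · rfl
    · induction a using Quotient.ind; rfl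

theorem sum_eq_mul_orbitCount [Fintype α] (p : Equiv.Perm α) (w : α → ℕ) (c : ℕ)
    (h : ∀ x, ∃ s : Finset α, (∀ y, y ∈ s ↔ p.SameCycle x y) ∧ ∑ y ∈ s, w y = c) :
    ∑ x, w x = c * orbitCount p := by
  classical
  let _ : DecidableEq (Quotient (SameCycle.setoid p)) := Classical.decEq _
  have : Fintype (Quotient (SameCycle.setoid p)) := Fintype.ofFinite _
  rw [← Finset.sum_fiberwise (s := Finset.univ) (g := Quotient.mk (SameCycle.setoid p)),
    orbitCount, Nat.card_eq_fintype_card, mul_comm, ← smul_eq_mul, ← Finset.card_univ,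
    ← Finset.sum_const]
  refine Finset.sum_congr rfl ?_
  rintro ⟨x⟩ -
  obtain ⟨s, hs, hc⟩ := h x
  rw [← hc]
  refine Finset.sum_congr ?_ fun _ _ => rfl
  ext y
  rw [Finset.mem_filter, hs]
  simp only [Finset.mem_univ, true_and]
  exact Quotient.eq.trans ⟨fun h => h.symm, fun h => h.symm⟩

end orbitCount

/-! ## Building graphs -/

namespace Dart

variable {n : ℕ}

@[simp] theorem flip_mk (e : Fin n) (b : Bool) : Dart.flip (e, b) = (e, !b) := rfl
@[simp] theorem flip_flip' (d : Dart n) : d.flip.flip = d := d.flip_flip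
@[simp] theorem flip_fst (d : Dart n) : d.flip.1 = d.1 := rfl
theorem flip_ne (d : Dart n) : d.flip ≠ d := by
  intro h; have := congrArg Prod.snd h; simp [Dart.flip] at this
theorem flip_injective : Function.Injective (Dart.flip (n := n)) := (flipPerm n).injective
theorem eq_or_eq_flip {d d' : Dart n} (h : d.1 = d'.1) : d = d' ∨ d = d'.flip := by
  obtain ⟨e, b⟩ := d
  obtain ⟨e', b'⟩ := d'
  obtain rfl : e = e' := h
  cases b <;> cases b' <;> simp
theorem flip_eq_iff {d d' : Dart n} : d.flip = d' ↔ d = d'.flip :=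
  ⟨fun h => by rw [← h, flip_flip], fun h => by rw [h, flip_flip]⟩

end Dart

/-- The permutation of the darts that walks along a dart and turns left as sharply as possible. -/
def facePerm {n : ℕ} (rot : Equiv.Perm (Dart n)) : Equiv.Perm (Dart n) :=
  (flipPerm n).trans rot.symm

theorem facePerm_apply {n : ℕ} (rot : Equiv.Perm (Dart n)) (d : Dart n) :
    facePerm rot d = rot.symm d.flip := rfl

/-- The conditions on a graph that concern single vertices. -/
structure LocalRules {n : ℕ} (rot : Equiv.Perm (Dart n)) (dir : Dart n → Option Direction) :
    Prop where
  dir_flip : ∀ d, dir d = none → dir d.flip = none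
  rot_circle : ∀ d, dir d = none → rot d = d.flip
  dir_rot : ∀ d x, dir d = some x → dir (rot d) = some (x + 2)
  rot_rot_rot : ∀ d, dir d ≠ none → rot (rot (rot d)) = d

/-- The number of darts that have a direction. -/
def arcDarts {n : ℕ} (dir : Dart n → Option Direction) : ℕ :=
  (Finset.univ.filter fun d => dir d ≠ none).card

/-- A set of darts closed under the relation that defines connectedness is everything. -/
def Connected {n m : ℕ} (rot : Equiv.Perm (Dart n)) (region : Dart n → Fin m) : Prop :=
  ∀ P : Dart n → Prop, (∀ x, P (rot x) ↔ P x) → (∀ x, P x.flip ↔ P x) →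
    (∀ x y, region x = region y → (P x ↔ P y)) → ∀ x y, P x → P y

namespace LocalRules

variable {n : ℕ} {rot : Equiv.Perm (Dart n)} {dir : Dart n → Option Direction}

theorem dir_rot_ne (h : LocalRules rot dir) {d : Dart n} (hd : dir d ≠ none) :
    dir (rot d) ≠ none := by
  obtain ⟨x, hx⟩ := Option.ne_none_iff_exists'.1 hd
  simp [h.dir_rot d x hx]

theorem rot_ne (h : LocalRules rot dir) (d : Dart n) : rot d ≠ d := by
  intro hd
  rcases hx : dir d with _ | x
  · exact d.flip_ne ((h.rot_circle d hx).symm.trans hd)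
  · have := h.dir_rot d x hx
    rw [hd, hx] at this
    exact absurd (Option.some.inj this) (by clear * -; revert x; decide)

theorem rot_rot_ne (h : LocalRules rot dir) {d : Dart n} (hd : dir d ≠ none) :
    rot (rot d) ≠ d := by
  intro h2
  have := h.rot_rot_rot d hd
  rw [h2] at this
  exact h.rot_ne d this

/-- Give weight 2 to darts with a direction and 3 to darts of circles. Then each trivalent vertex
and each marker on a circle has total weight 6, while the sum over all `2 * n` darts is `6 * n`
minus the number of darts with a direction. -/
theorem six_mul_orbitCount (h : LocalRules rot dir) :
    6 * orbitCount rot + arcDarts dir = 6 * n := by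
  have key := sum_eq_mul_orbitCount rot (fun d => if dir d ≠ none then 2 else 3) 6 fun x => by
    classical
    rcases hx : dir x with _ | y
    · refine ⟨{x, x.flip}, fun y => ?_, ?_⟩
      · have h1 := h.rot_circle x hx
        have h2 := h.rot_circle x.flip (h.dir_flip x hx)
        rw [Dart.flip_flip] at h2
        constructor
        · intro hy
          rcases Finset.mem_insert.1 hy with rfl | hy
          · exact .refl _ _
          · rw [Finset.mem_singleton.1 hy, ← h1]
            exact SameCycle.rfl.apply_right
        · intro hy
          have := SameCycle.eq_of_invariant (f := fun z => z = x ∨ z = x.flip) (fun z => by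
            apply propext
            constructor
            · rintro (hz | hz)
              · right; apply rot.injective; rw [hz, h2]
              · left; apply rot.injective; rw [hz, h1]
            · rintro (rfl | rfl)
              · exact .inr h1
              · exact .inl h2) hy
          simpa using this
      · rw [Finset.sum_pair x.flip_ne.symm]
        simp [hx, h.dir_flip x hx]
    · have hx' : dir x ≠ none := by simp [hx]
      refine ⟨{x, rot x, rot (rot x)}, fun y => ?_, ?_⟩
      · have h3 := h.rot_rot_rot x hx'
        constructor
        · intro hy
          simp only [Finset.mem_insert, Finset.mem_singleton] at hy
          rcases hy with rfl | rfl | rfl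
          · exact .refl _ _
          · exact SameCycle.rfl.apply_right
          · exact SameCycle.rfl.apply_right.apply_right
        · intro hy
          have := SameCycle.eq_of_invariant (f := fun z => z = x ∨ z = rot x ∨ z = rot (rot x))
            (fun z => by
              apply propext
              constructor
              · rintro (hz | hz | hz)
                · right; right; apply rot.injective; rw [hz, h3]
                · left; exact rot.injective hz
                · right; left; exact rot.injective hz
              · rintro (rfl | rfl | rfl)
                · exact .inr (.inl rfl)
                · exact .inr (.inr rfl)
                · exact .inl h3) hy
          simpa using this
      · have h1 := h.dir_rot_ne hx'
        have h2 := h.dir_rot_ne h1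
        rw [Finset.sum_insert, Finset.sum_pair]
        · simp [hx', h1, h2]
        · exact (h.rot_ne (rot x)).symm
        · simp only [Finset.mem_insert, Finset.mem_singleton, not_or]
          exact ⟨(h.rot_ne x).symm, (h.rot_rot_ne hx').symm⟩
  rw [← key, arcDarts, Finset.card_filter, ← Finset.sum_add_distrib,
    Finset.sum_congr rfl (g := fun _ => 3) (fun d _ => by split_ifs <;> rfl)]
  simp [Dart]
  ring

end LocalRules

namespace SphereGraph

variable {n m : ℕ}

/-- The permutation of the darts whose orbits are the boundary walks of the regions. -/
abbrev face (Γ : SphereGraph n m) : Equiv.Perm (Dart n) := facePerm Γ.rot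

theorem rules (Γ : SphereGraph n m) : LocalRules Γ.rot Γ.dir :=
  ⟨Γ.dir_flip, Γ.rot_circle, Γ.dir_rot, Γ.rot_rot_rot⟩

theorem region_face_apply (Γ : SphereGraph n m) (d : Dart n) : Γ.region (Γ.face d) = Γ.region d :=
  Γ.region_face d

theorem region_eq_of_sameCycle (Γ : SphereGraph n m) {d d' : Dart n} (h : Γ.face.SameCycle d d') :
    Γ.region d = Γ.region d' := h.eq_of_invariant Γ.region_face_apply

theorem isConnected (Γ : SphereGraph n m) : Connected Γ.rot Γ.region := by
  intro P h1 h2 h3 x y hx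
  induction Γ.connected x y with
  | refl => exact hx
  | tail _ h ih =>
    rcases h with rfl | rfl | h
    · exact (h1 _).2 ih
    · exact (h2 _).2 ih
    · exact (h3 _ _ h).2 ih

/-- The number of vertices has been eliminated. What remains are regions, and darts and boundary
walks that belong to single regions, so the formula can be distributed over the regions. -/
theorem euler' (Γ : SphereGraph n m) : 12 * m = arcDarts Γ.dir + 6 * orbitCount Γ.face + 12 := by
  have h1 := Γ.rules.six_mul_orbitCount
  have h2 : orbitCount Γ.rot + 2 * m = n + orbitCount Γ.face + 2 := Γ.euler
  omega

/-- A graph from data that satisfy handier conditions. -/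
def ofRules (rot : Equiv.Perm (Dart n)) (dir : Dart n → Option Direction) (region : Dart n → Fin m)
    (h : LocalRules rot dir) (region_face : ∀ d, region (facePerm rot d) = region d)
    (region_surjective : 0 < n → Function.Surjective region) (connected : Connected rot region)
    (euler : 12 * m = arcDarts dir + 6 * orbitCount (facePerm rot) + 12) : SphereGraph n m where
  rot := rot
  dir := dir
  region := region
  dir_flip := h.dir_flip
  rot_circle := h.rot_circle
  dir_rot := h.dir_rot
  rot_rot_rot := h.rot_rot_rot
  region_face := region_face
  region_surjective := region_surjective
  connected := fun d d' => by
    refine connected (fun x => Relation.ReflTransGen _ d x) (fun x => ?_) (fun x => ?_)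
      (fun x y hxy => ?_) d d' .refl
    · constructor
      · intro hx
        -- The relation allows only forward steps along `rot`; a backward step is made by going on
        -- around the finite cycle.
        obtain ⟨k, hk⟩ : ∃ k : ℕ, (rot ^ k) (rot x) = x := by
          obtain ⟨k, -, hk⟩ := (SameCycle.rfl (f := rot) (x := x)).apply_left.exists_pow_eq'
          exact ⟨k, hk⟩
        have : ∀ k : ℕ, Relation.ReflTransGen
            (fun x y => y = rot x ∨ y = x.flip ∨ region y = region x) d ((rot ^ k) (rot x)) := by
          intro k
          induction k with
          | zero => exact hx
          | succ k ih => exact ih.tail (.inl (by rw [pow_succ', mul_apply]))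
        exact hk ▸ this k
      · exact fun hx => hx.tail (.inl rfl)
    · exact ⟨fun hx => hx.tail (.inr (.inl (by rw [Dart.flip_flip]))),
        fun hx => hx.tail (.inr (.inl rfl))⟩
    · exact ⟨fun hx => hx.tail (.inr (.inr hxy.symm)), fun hx => hx.tail (.inr (.inr hxy))⟩
  euler := by
    have h1 := h.six_mul_orbitCount
    change orbitCount rot + 2 * m = n + orbitCount (facePerm rot) + 2
    omega

end SphereGraph

open Equiv.Perm

namespace SphereGraph

variable {n m : ℕ}

/-! ### Changing the orientations of edges -/

/-- The same graph with the darts renamed, compatibly with their pairing into edges. -/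
def relabel (Γ : SphereGraph n m) (σ : Equiv.Perm (Dart n)) (hσ : ∀ x, σ x.flip = (σ x).flip) :
    SphereGraph n m :=
  have hσ' : ∀ x, σ.symm (Dart.flip x) = (σ.symm x).flip := fun x => by
    rw [Equiv.symm_apply_eq, hσ, Equiv.apply_symm_apply]
  have hface : facePerm ((σ.symm.trans Γ.rot).trans σ) = (σ.symm.trans Γ.face).trans σ := by
    ext1 x
    rw [facePerm_apply, Equiv.symm_apply_eq]
    simp only [Equiv.trans_apply, Equiv.symm_apply_apply, facePerm_apply, Equiv.apply_symm_apply,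
      hσ]
  ofRules ((σ.symm.trans Γ.rot).trans σ) (fun x => Γ.dir (σ.symm x)) (fun x => Γ.region (σ.symm x))
    { dir_flip := fun d hd => by rw [hσ']; exact Γ.dir_flip _ hd
      rot_circle := fun d hd => by
        simp only [Equiv.trans_apply, Γ.rot_circle _ hd, hσ, Equiv.apply_symm_apply]
      dir_rot := fun d x hd => by
        simpa only [Equiv.trans_apply, Equiv.symm_apply_apply] using Γ.dir_rot _ x hd
      rot_rot_rot := fun d hd => by
        simp only [Equiv.trans_apply, Equiv.symm_apply_apply, Γ.rot_rot_rot _ hd,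
          Equiv.apply_symm_apply] }
    (fun d => by
      rw [hface]
      simpa only [Equiv.trans_apply, Equiv.symm_apply_apply] using Γ.region_face_apply _)
    (fun hn => (Γ.region_surjective hn).comp σ.symm.surjective)
    (fun P h1 h2 h3 x y hx => by
      have := Γ.isConnected (fun z => P (σ z)) (fun z => by
          simpa only [Equiv.trans_apply, Equiv.symm_apply_apply] using h1 (σ z))
        (fun z => by rw [hσ]; exact h2 (σ z))
        (fun z w hzw => h3 _ _ (by simpa only [Equiv.symm_apply_apply] using hzw))
        (σ.symm x) (σ.symm y)
      simpa only [Equiv.apply_symm_apply] using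
        this (by simpa only [Equiv.apply_symm_apply] using hx))
    (by
      rw [hface, orbitCount_conj, Γ.euler', arcDarts, arcDarts]
      congr 2
      exact Finset.card_equiv σ fun x => by simp)

section relabel

variable (Γ : SphereGraph n m) (σ : Equiv.Perm (Dart n)) (hσ : ∀ x, σ x.flip = (σ x).flip)
  (x : Dart n)

end relabel

/-- Exchange the two darts of those edges where `w` is true. -/
def turn (w : Fin n → Bool) : Equiv.Perm (Dart n) where
  toFun d := (d.1, xor d.2 (w d.1))
  invFun d := (d.1, xor d.2 (w d.1))
  left_inv d := by simp
  right_inv d := by simp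

theorem turn_apply (w : Fin n → Bool) (d : Dart n) : turn w d = (d.1, xor d.2 (w d.1)) := rfl

theorem turn_flip (w : Fin n → Bool) (d : Dart n) : turn w d.flip = (turn w d).flip := by
  simp [turn_apply, Dart.flip]

/-- The graph with the orientations of some edges reversed. -/
def reorient (Γ : SphereGraph n m) (w : Fin n → Bool) : SphereGraph n m :=
  Γ.relabel (turn w) (turn_flip w)

section reorient

variable (Γ : SphereGraph n m) (w : Fin n → Bool) (x : Dart n)

theorem reorient_rot : (Γ.reorient w).rot x = turn w (Γ.rot (turn w x)) := rfl
theorem reorient_dir : (Γ.reorient w).dir x = Γ.dir (turn w x) := rfl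
theorem reorient_region : (Γ.reorient w).region x = Γ.region (turn w x) := rfl

/-- Writing every reoriented graph as `Γ.reorient w` for a fixed `Γ` allows successive reversals
without losing track of darts: the dart `x` of `Γ` is always `turn w x`. -/
theorem edgeReversal_reorient (e : Fin n) :
    EdgeReversal e (Γ.reorient w) (Γ.reorient (Function.update w e (!w e))) := by
  have key : ∀ d, turn (Function.update w e (!w e)) d =
      turn w (Equiv.swap (e, false) (e, true) d) := by
    rintro ⟨e', b⟩
    by_cases h : e' = e
    · subst h
      cases b <;> simp [turn_apply]
    · rw [Equiv.swap_apply_of_ne_of_ne (by simp [h]) (by simp [h])]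
      simp [turn_apply, h]
  have key' : ∀ d, turn (Function.update w e (!w e)) d =
      Equiv.swap (e, false) (e, true) (turn w d) := by
    rintro ⟨e', b⟩
    by_cases h : e' = e
    · subst h
      cases b <;> cases hw : w e' <;> simp [turn_apply, hw]
    · rw [Equiv.swap_apply_of_ne_of_ne (by simp [h, turn_apply]) (by simp [h, turn_apply])]
      simp [turn_apply, h]
  intro d
  refine ⟨?_, ?_, ?_⟩
  · rw [reorient_rot, reorient_rot, key', key, Equiv.swap_apply_self]
  · rw [reorient_dir, reorient_dir, key, Equiv.swap_apply_self]
  · rw [reorient_region, reorient_region, key, Equiv.swap_apply_self]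

theorem reorient_false : Γ.reorient (fun _ => false) = Γ := by
  have h : turn (fun _ : Fin n => false) = 1 := by ext1 d; simp [turn_apply]
  have h1 : (Γ.reorient fun _ => false).rot = Γ.rot := by
    ext1 x; rw [reorient_rot, h]; rfl
  have h2 : (Γ.reorient fun _ => false).dir = Γ.dir := by
    funext x; rw [reorient_dir, h]; rfl
  have h3 : (Γ.reorient fun _ => false).region = Γ.region := by
    funext x; rw [reorient_region, h]; rfl
  revert h1 h2 h3
  generalize Γ.reorient (fun _ => false) = Δ
  intro h1 h2 h3
  cases Γ
  cases Δ
  simp_all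

end reorient

/-! ### Turning vertices -/

/-- The graph with the vertex of `v` turned by one notch counterclockwise. -/
noncomputable def spiral (Γ : SphereGraph n m) (v : Dart n) : SphereGraph n m :=
  have hnone : ∀ d, (if Γ.rot.SameCycle v d then (Γ.dir d).map (· + 1) else Γ.dir d) = none ↔
      Γ.dir d = none := fun d => by split_ifs <;> simp
  ofRules Γ.rot (fun d => if Γ.rot.SameCycle v d then (Γ.dir d).map (· + 1) else Γ.dir d) Γ.region
    { dir_flip := fun d => by simpa only [hnone] using Γ.dir_flip d
      rot_circle := fun d => by simpa only [hnone] using Γ.rot_circle d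
      rot_rot_rot := fun d => by simpa only [ne_eq, hnone] using Γ.rot_rot_rot d
      dir_rot := fun d x => by
        simp only [sameCycle_apply_right]
        split_ifs with h
        · simp only [Option.map_eq_some_iff]
          rintro ⟨y, hy, rfl⟩
          exact ⟨y + 2, Γ.dir_rot d y hy, by ring⟩
        · exact Γ.dir_rot d x }
    Γ.region_face Γ.region_surjective Γ.isConnected
    (by
      rw [Γ.euler', arcDarts, arcDarts]
      congr 3
      ext d
      simp [hnone])

theorem vertexSpiral_spiral (Γ : SphereGraph n m) {v : Dart n} (hv : Γ.dir v ≠ none) :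
    VertexSpiral v 1 Γ (Γ.spiral v) := by
  refine ⟨hv, .inl rfl, rfl, rfl, fun d => rfl⟩

/-! ### The `F`-move -/

/-- The way in which an `F`-move permutes the positions of darts. -/
def shift (a b c e : Dart n) : Equiv.Perm (Dart n) :=
  Equiv.swap b c * (Equiv.swap c e * Equiv.swap e a)

section shift

variable {a b c e x : Dart n}

theorem shift_first (hab : a ≠ b) (hac : a ≠ c) (hae : a ≠ e) (hbc : b ≠ c) (hbe : b ≠ e)
    (hce : c ≠ e) : shift a b c e a = b ∧ shift a b c e b = c ∧ shift a b c e c = e ∧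
    shift a b c e e = a := by
  simp [shift, Equiv.swap_apply_def, *, hab.symm, hac.symm, hbe.symm, hce.symm]

theorem shift_of_ne (hxa : x ≠ a) (hxb : x ≠ b) (hxc : x ≠ c) (hxe : x ≠ e) :
    shift a b c e x = x := by
  simp [shift, Equiv.swap_apply_of_ne_of_ne, *]

end shift

/-- The move is conjugation by the 4-cycle `shift`: the position of `a` passes to `b`, that of `b`
to `c`, that of `c` to `e` and that of `e` to `a`. The local rules are therefore inherited. In the
boundary walks the two darts of `e` leave their old places and are inserted elsewhere, and nothing
else changes, so the number of walks is the same. The new regions beside `e` are the ones to the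
left of `c` and of `a`. -/
theorem exists_fMove (Γ : SphereGraph n m) {e a b c d : Fin n} (h : Γ.MergeLeft e a b c d)
    (hde : d ≠ e) : ∃ Γ' : SphereGraph n m, FMove e Γ Γ' ∧
      (∀ x, Γ'.rot x = shift (a, true) (b, true) (c, true) (e, true)
        (Γ.rot ((shift (a, true) (b, true) (c, true) (e, true)).symm x))) ∧
      (∀ x, Γ'.dir x = Γ.dir ((shift (a, true) (b, true) (c, true) (e, true)).symm x)) ∧
      (∀ x, Γ'.region x = if x = (e, false) then Γ.region (c, false) else
        if x = (e, true) then Γ.region (a, false) else Γ.region x) := by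
  obtain ⟨⟨da, db, de, rb, ra, re⟩, ⟨de', dc, dd, rc, re', rd⟩⟩ := h
  have hdir : ∀ {x y : Dart n} {u v : Direction}, Γ.dir x = some u → Γ.dir y = some v → u ≠ v →
      x ≠ y := fun hx hy huv hxy => huv (by rw [hxy, hy] at hx; exact (Option.some.inj hx).symm)
  -- If `a = e`, both ends of `e` lie at one vertex, and comparing successors gives `d = e`. The
  -- other inequalities follow from directions or from this one.
  have hae : a ≠ e := by
    rintro rfl
    have := re'.symm.trans ra
    exact hde (congrArg Prod.fst this)
  have hbe : b ≠ e := by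
    rintro rfl
    exact hdir db de' (by decide) rfl
  have hce : c ≠ e := by
    rintro rfl
    exact hdir dc de' (by decide) rfl
  have hab : a ≠ b := by
    rintro rfl
    exact hdir da db (by decide) rfl
  have hac : a ≠ c := by
    rintro rfl
    exact hdir da dc (by decide) rfl
  have hbc : b ≠ c := by
    rintro rfl
    exact hae (congrArg Prod.fst (rb.symm.trans rc))
  set σ := shift (a, true) (b, true) (c, true) (e, true) with hσ
  obtain ⟨sa, sb, sc, se⟩ := shift_first (a := (a, true)) (b := (b, true)) (c := (c, true))
    (e := (e, true)) (by simpa) (by simpa) (by simpa) (by simpa) (by simpa) (by simpa)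
  rw [← hσ] at sa sb sc se
  have hfix : ∀ {x : Dart n}, x ≠ (a, true) → x ≠ (b, true) → x ≠ (c, true) → x ≠ (e, true) →
      σ x = x := fun h1 h2 h3 h4 => shift_of_ne h1 h2 h3 h4
  have se0 : σ (e, false) = (e, false) := hfix (by simp) (by simp) (by simp) (by simp)
  have sd : σ (d, false) = (d, false) := hfix (by simp) (by simp) (by simp) (by simp)
  have inv : ∀ {x y : Dart n}, σ x = y → σ.symm y = x := fun h => by
    rw [Equiv.symm_apply_eq, h]
  have hfix' : ∀ {x : Dart n}, x ≠ (a, true) → x ≠ (b, true) → x ≠ (c, true) → x ≠ (e, true) →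
      σ.symm x = x := fun h1 h2 h3 h4 => inv (hfix h1 h2 h3 h4)
  set rot' : Equiv.Perm (Dart n) := (σ.symm.trans Γ.rot).trans σ with hrot'
  have rot'_apply : ∀ x, rot' x = σ (Γ.rot (σ.symm x)) := fun x => rfl
  have rc' : rot' (c, true) = (b, true) := by rw [rot'_apply, inv sb, rb, sa]
  have rb' : rot' (b, true) = (e, false) := by rw [rot'_apply, inv sa, ra, se0]
  have re0' : rot' (e, false) = (c, true) := by rw [rot'_apply, inv se0, re, sb]
  have re1' : rot' (e, true) = (a, true) := by rw [rot'_apply, inv sc, rc, se]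
  have ra' : rot' (a, true) = (d, false) := by rw [rot'_apply, inv se, re', sd]
  have rd' : rot' (d, false) = (e, true) := by rw [rot'_apply, inv sd, rd, sc]
  have hother : ∀ x : Dart n, x ≠ (a, true) → x ≠ (b, true) → x ≠ (c, true) → x ≠ (e, true) →
      x ≠ (e, false) → x ≠ (d, false) → rot' x = Γ.rot x ∧ Γ.rot x ≠ (a, true) ∧
      Γ.rot x ≠ (b, true) ∧ Γ.rot x ≠ (c, true) ∧ Γ.rot x ≠ (e, true) := by
    intro x h1 h2 h3 h4 h5 h6
    have g1 : Γ.rot x ≠ (a, true) := fun h => h2 (Γ.rot.injective (h.trans rb.symm))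
    have g2 : Γ.rot x ≠ (b, true) := fun h => h5 (Γ.rot.injective (h.trans re.symm))
    have g3 : Γ.rot x ≠ (c, true) := fun h => h6 (Γ.rot.injective (h.trans rd.symm))
    have g4 : Γ.rot x ≠ (e, true) := fun h => h3 (Γ.rot.injective (h.trans rc.symm))
    exact ⟨by rw [rot'_apply, hfix' h1 h2 h3 h4, hfix g1 g2 g3 g4], g1, g2, g3, g4⟩
  have fot : ∀ {x y : Dart n}, Γ.rot y = x.flip → Γ.face x = y := fun {x y} h => by
    rw [facePerm_apply, Equiv.symm_apply_eq, h]
  have fot' : ∀ {x y : Dart n}, rot' y = x.flip → facePerm rot' x = y := fun {x y} h => by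
    rw [facePerm_apply, Equiv.symm_apply_eq, h]
  have fb : Γ.face (b, false) = (e, false) := fot re
  have fe0 : Γ.face (e, false) = (c, true) := fot rc
  have fc : Γ.face (c, false) = (d, false) := fot rd
  have fa : Γ.face (a, false) = (b, true) := fot rb
  have fd : Γ.face (d, true) = (e, true) := fot re'
  have fe1 : Γ.face (e, true) = (a, true) := fot ra
  have fb' : facePerm rot' (b, false) = (c, true) := fot' rc'
  have fc' : facePerm rot' (c, false) = (e, false) := fot' re0'
  have fe0' : facePerm rot' (e, false) = (d, false) := fot' rd'
  have fa' : facePerm rot' (a, false) = (e, true) := fot' re1'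
  have fe1' : facePerm rot' (e, true) = (b, true) := fot' rb'
  have fd' : facePerm rot' (d, true) = (a, true) := fot' ra'
  -- the remaining darts
  have fother : ∀ x : Dart n, x ≠ (a, false) → x ≠ (b, false) → x ≠ (c, false) → x ≠ (e, false) →
      x ≠ (e, true) → x ≠ (d, true) → facePerm rot' x = Γ.face x ∧ (Γ.face x).1 ≠ e := by
    intro x h1 h2 h3 h4 h5 h6
    have hy : ∀ y : Dart n, Γ.face x = y → Γ.rot y = x.flip := fun y hy => by
      rw [← hy, facePerm_apply, Equiv.apply_symm_apply]
    have g : ∀ y z : Dart n, Γ.rot y = z.flip → x ≠ z → Γ.face x ≠ y := fun y z hyz hxz hxy =>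
      hxz (Dart.flip_injective ((hy y hxy).symm.trans hyz))
    have ge1 : Γ.face x ≠ (e, true) := g _ (d, true) re' h6
    have ge0 : Γ.face x ≠ (e, false) := g _ (b, false) re h2
    refine ⟨fot' ?_, fun he => ?_⟩
    · rw [(hother _ (g _ (e, true) ra h5) (g _ (a, false) rb h1) (g _ (e, false) rc h4) ge1 ge0
        (g _ (c, false) rd h3)).1, hy _ rfl]
    · rcases Dart.eq_or_eq_flip (d' := (e, true)) he with h | h
      · exact ge1 h
      · exact ge0 h
  -- `r` replaces a dart of `e` by its predecessor in the new walk, `s` replaces it by its successor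
  -- in the old walk. Both fix all other darts, and they are inverse to each other up to walks.
  let r : Dart n → Dart n := fun x => if x = (e, false) then (c, false) else
    if x = (e, true) then (a, false) else x
  let s : Dart n → Dart n := fun x => if x = (e, false) then (c, true) else
    if x = (e, true) then (a, true) else x
  have r_of_ne : ∀ {x : Dart n}, x.1 ≠ e → r x = x := fun {x} hx => by
    have h1 : x ≠ (e, false) := fun h => hx (by rw [h])
    have h2 : x ≠ (e, true) := fun h => hx (by rw [h])
    simp [r, h1, h2]
  have s_of_ne : ∀ {x : Dart n}, x.1 ≠ e → s x = x := fun {x} hx => by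
    have h1 : x ≠ (e, false) := fun h => hx (by rw [h])
    have h2 : x ≠ (e, true) := fun h => hx (by rw [h])
    simp [s, h1, h2]
  have re0 : r (e, false) = (c, false) := by simp [r]
  have re1 : r (e, true) = (a, false) := by simp [r]
  have se0' : s (e, false) = (c, true) := by simp [s]
  have se1' : s (e, true) = (a, true) := by simp [s]
  have hr : ∀ x, Γ.face.SameCycle (r x) (r (facePerm rot' x)) := by
    intro x
    by_cases ha : x = (a, false)
    · subst ha; rw [fa', re1, r_of_ne (by simpa)]
    by_cases hb : x = (b, false)
    · subst hb; rw [fb', r_of_ne (by simpa), r_of_ne (by simpa)]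
      exact ⟨2, by rw [zpow_ofNat, pow_two, mul_apply, fb, fe0]⟩
    by_cases hc : x = (c, false)
    · subst hc; rw [fc', re0, r_of_ne (by simpa)]
    by_cases he0 : x = (e, false)
    · subst he0; rw [fe0', re0, r_of_ne (by simpa)]; exact ⟨1, by rw [zpow_one, fc]⟩
    by_cases he1 : x = (e, true)
    · subst he1; rw [fe1', re1, r_of_ne (by simpa)]; exact ⟨1, by rw [zpow_one, fa]⟩
    by_cases hd : x = (d, true)
    · subst hd; rw [fd', r_of_ne (by simpa), r_of_ne (by simpa)]
      exact ⟨2, by rw [zpow_ofNat, pow_two, mul_apply, fd, fe1]⟩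
    obtain ⟨h1, h2⟩ := fother x ha hb hc he0 he1 hd
    rw [h1, r_of_ne h2, r_of_ne]
    · exact ⟨1, by rw [zpow_one]⟩
    · intro he
      rcases Dart.eq_or_eq_flip (d' := (e, true)) he with h | h
      · exact he1 h
      · exact he0 h
  have hs : ∀ x, (facePerm rot').SameCycle (s x) (s (Γ.face x)) := by
    intro x
    by_cases ha : x = (a, false)
    · subst ha; rw [fa, s_of_ne (by simpa), s_of_ne (by simpa)]
      exact ⟨2, by rw [zpow_ofNat, pow_two, mul_apply, fa', fe1']⟩
    by_cases hb : x = (b, false)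
    · subst hb; rw [fb, se0', s_of_ne (by simpa)]; exact ⟨1, by rw [zpow_one, fb']⟩
    by_cases hc : x = (c, false)
    · subst hc; rw [fc, s_of_ne (by simpa), s_of_ne (by simpa)]
      exact ⟨2, by rw [zpow_ofNat, pow_two, mul_apply, fc', fe0']⟩
    by_cases he0 : x = (e, false)
    · subst he0; rw [fe0, se0', s_of_ne (by simpa)]
    by_cases he1 : x = (e, true)
    · subst he1; rw [fe1, se1', s_of_ne (by simpa)]
    by_cases hd : x = (d, true)
    · subst hd; rw [fd, se1', s_of_ne (by simpa)]; exact ⟨1, by rw [zpow_one, fd']⟩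
    obtain ⟨h1, h2⟩ := fother x ha hb hc he0 he1 hd
    rw [s_of_ne h2, s_of_ne]
    · exact ⟨1, by rw [zpow_one, h1]⟩
    · intro he
      rcases Dart.eq_or_eq_flip (d' := (e, true)) he with h | h
      · exact he1 h
      · exact he0 h
  have hcount : orbitCount (facePerm rot') = orbitCount Γ.face := by
    refine orbitCount_eq_of_maps _ _ r s hr hs (fun x => ?_) fun x => ?_
    · by_cases he0 : x = (e, false)
      · subst he0; rw [re0, s_of_ne (by simpa)]; exact ⟨1, by rw [zpow_one, fc']⟩
      by_cases he1 : x = (e, true)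
      · subst he1; rw [re1, s_of_ne (by simpa)]; exact ⟨1, by rw [zpow_one, fa']⟩
      simp [r, s, he0, he1, SameCycle.rfl]
    · by_cases he0 : x = (e, false)
      · subst he0; rw [se0', r_of_ne (by simpa)]
        exact SameCycle.symm ⟨1, by rw [zpow_one, fe0]⟩
      by_cases he1 : x = (e, true)
      · subst he1; rw [se1', r_of_ne (by simpa)]
        exact SameCycle.symm ⟨1, by rw [zpow_one, fe1]⟩
      simp [r, s, he0, he1, SameCycle.rfl]
  have hregion : ∀ x, (if x = (e, false) then Γ.region (c, false) else
      if x = (e, true) then Γ.region (a, false) else Γ.region x) = Γ.region (r x) := fun x => by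
    simp only [r]
    split_ifs <;> rfl
  have hsome : ∀ x, Γ.dir x = none → σ.symm x = x := by
    intro x hx
    refine hfix' ?_ ?_ ?_ ?_ <;> rintro rfl <;> simp_all
  have hnone : ∀ x, Γ.dir (σ.symm x) = none ↔ Γ.dir x = none := by
    intro x
    refine ⟨fun hx => ?_, fun hx => by rw [hsome x hx, hx]⟩
    by_cases ha : x = (a, true)
    · subst ha; rw [inv se, de'] at hx; simp at hx
    by_cases hb : x = (b, true)
    · subst hb; rw [inv sa, da] at hx; simp at hx
    by_cases hc : x = (c, true)
    · subst hc; rw [inv sb, db] at hx; simp at hx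
    by_cases he : x = (e, true)
    · subst he; rw [inv sc, dc] at hx; simp at hx
    rwa [hfix' ha hb hc he] at hx
  have hrules : LocalRules rot' (fun x => Γ.dir (σ.symm x)) :=
    { dir_flip := fun x => by simpa only [hnone] using Γ.dir_flip x
      rot_circle := fun x hx => by
        have h1 := (hnone x).1 hx
        have h2 := hsome _ (Γ.dir_flip x h1)
        rw [rot'_apply, hsome x h1, Γ.rot_circle x h1, ← Equiv.eq_symm_apply, h2]
      dir_rot := fun x y hx => by
        rw [rot'_apply, Equiv.symm_apply_apply]
        exact Γ.dir_rot _ y hx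
      rot_rot_rot := fun x hx => by
        simp only [rot'_apply, Equiv.symm_apply_apply, Γ.rot_rot_rot _ hx,
          Equiv.apply_symm_apply] }
  refine ⟨ofRules rot' (fun x => Γ.dir (σ.symm x)) (fun x => if x = (e, false) then
    Γ.region (c, false) else if x = (e, true) then Γ.region (a, false) else Γ.region x) hrules
    ?_ ?_ ?_ ?_, ⟨a, b, c, d, hde, .inl ⟨⟨⟨da, db, de, rb, ra, re⟩, ⟨de', dc, dd, rc, re', rd⟩⟩, ?_⟩,
      ?_, ?_⟩, fun x => rfl, fun x => rfl, fun x => rfl⟩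
  · intro x
    simp only [hregion]
    exact (Γ.region_eq_of_sameCycle (hr x)).symm
  · intro hn R
    obtain ⟨x, rfl⟩ := Γ.region_surjective hn R
    refine ⟨s x, ?_⟩
    refine (hregion _).trans ?_
    by_cases he0 : x = (e, false)
    · subst he0; rw [se0', r_of_ne (by simpa), ← fe0, Γ.region_face_apply]
    by_cases he1 : x = (e, true)
    · subst he1; rw [se1', r_of_ne (by simpa), ← fe1, Γ.region_face_apply]
    simp [r, s, he0, he1]
  · intro P h1 h2 h3
    simp only [hregion] at h3
    -- The six darts at the two ends of `e` are linked by the new rotation and by `e` itself, so `P`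
    -- is constant on them, whichever rotation is used.
    have p1 : P (b, true) ↔ P (c, true) := by rw [← h1 (c, true), rc']
    have p2 : P (e, false) ↔ P (c, true) := by rw [← p1, ← h1 (b, true), rb']
    have p3 : P (e, true) ↔ P (c, true) := by rw [← p2, ← h2 (e, false)]; rfl
    have p4 : P (a, true) ↔ P (c, true) := by rw [← p3, ← h1 (e, true), re1']
    have p5 : P (d, false) ↔ P (c, true) := by rw [← p4, ← h1 (a, true), ra']
    refine Γ.isConnected P (fun x => ?_) h2 fun x y hxy => ?_
    · by_cases ha : x = (a, true)
      · subst ha; rw [ra, p2, p4]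
      by_cases hb : x = (b, true)
      · subst hb; rw [rb, p4, p1]
      by_cases hc : x = (c, true)
      · subst hc; rw [rc, p3]
      by_cases he : x = (e, true)
      · subst he; rw [re', p5, p3]
      by_cases he0 : x = (e, false)
      · subst he0; rw [re, p1, p2]
      by_cases hd : x = (d, false)
      · subst hd; rw [rd, p5]
      rw [← (hother x ha hb hc he he0 hd).1]
      exact h1 x
    · have hPs : ∀ x, P x ↔ P (s x) := fun x => by
        by_cases he0 : x = (e, false)
        · subst he0; rw [se0', p2]
        by_cases he1 : x = (e, true)
        · subst he1; rw [se1', p4, p3]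
        simp [s, he0, he1]
      have hrs : ∀ x, Γ.region (r (s x)) = Γ.region x := fun x => by
        by_cases he0 : x = (e, false)
        · subst he0; rw [se0', r_of_ne (by simpa), ← fe0, Γ.region_face_apply]
        by_cases he1 : x = (e, true)
        · subst he1; rw [se1', r_of_ne (by simpa), ← fe1, Γ.region_face_apply]
        simp [r, s, he0, he1]
      rw [hPs x, hPs y]
      exact h3 _ _ (by rw [hrs, hrs, hxy])
  · rw [hcount, Γ.euler', arcDarts, arcDarts]
    simp only [ne_eq, hnone]
  · refine ⟨⟨?_, ?_, ?_, rc', rb', re0'⟩, ⟨?_, ?_, ?_, re1', ra', rd'⟩⟩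
    · change Γ.dir (σ.symm _) = _; rw [inv sa, da]
    · change Γ.dir (σ.symm _) = _; rw [inv sb, db]
    · change Γ.dir (σ.symm _) = _; rw [inv se0, de]
    · change Γ.dir (σ.symm _) = _; rw [inv se, de']
    · change Γ.dir (σ.symm _) = _; rw [inv sc, dc]
    · change Γ.dir (σ.symm _) = _; rw [inv sd, dd]
  · intro x hx0 hx1
    have n1 : x ≠ (a, true) := by
      rintro rfl; exact hx0 (SameCycle.symm ⟨1, by rw [zpow_one, ra]⟩)
    have n2 : x ≠ (b, true) := by
      rintro rfl; exact hx0 ⟨1, by rw [zpow_one, re]⟩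
    have n3 : x ≠ (c, true) := by
      rintro rfl; exact hx1 (SameCycle.symm ⟨1, by rw [zpow_one, rc]⟩)
    have n4 : x ≠ (e, true) := by rintro rfl; exact hx1 .rfl
    have n5 : x ≠ (e, false) := by rintro rfl; exact hx0 .rfl
    have n6 : x ≠ (d, false) := by
      rintro rfl; exact hx1 ⟨1, by rw [zpow_one, re']⟩
    exact ⟨(hother x n1 n2 n3 n4 n5 n6).1, by
      change Γ.dir (σ.symm x) = _; rw [hfix' n1 n2 n3 n4]⟩
  · intro x hx
    have h1 : x ≠ (e, false) := fun h => hx (by rw [h])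
    have h2 : x ≠ (e, true) := fun h => hx (by rw [h])
    change (if _ then _ else _) = _
    simp [h1, h2]

end SphereGraph

open Equiv.Perm

namespace SphereGraph

variable {n m n' m' : ℕ}

/-! ### Deleting a region -/

theorem dropsRegion_succAbove (R : Fin (m + 1)) : DropsRegion R R.succAbove :=
  ⟨Fin.succAbove_right_injective, Fin.range_succAbove R⟩

/-- `Q` retracts the old darts onto the new ones. It preserves every region but `R`, collapses `R`,
and respects vertices and edges as far as closed sets can tell. A closed set of new darts thus pulls
back to a closed set of old darts, which transfers connectedness. `Q` can exist only if some dart is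
left, hence the condition on `n'`. -/
theorem exists_restrict (Γ : SphereGraph n (m + 1)) (R : Fin (m + 1)) (ι : Dart n' → Dart n)
    (rot' : Equiv.Perm (Dart n')) (dir' : Dart n' → Option Direction)
    (hrules : LocalRules rot' dir')
    (hface : ∀ x, Γ.region (ι (facePerm rot' x)) = Γ.region (ι x))
    (hR : ∀ x, Γ.region (ι x) ≠ R)
    (hQ : 0 < n' → ∃ Q : Dart n → Dart n', (∀ x, Q (ι x) = x) ∧
      (∀ z, Γ.region z ≠ R → Γ.region (ι (Q z)) = Γ.region z) ∧
      (∀ z w, Γ.region z = R → Γ.region w = R → Q z = Q w) ∧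
      ∀ P : Dart n' → Prop, (∀ x, P (rot' x) ↔ P x) → (∀ x, P x.flip ↔ P x) →
        ∀ z, (P (Q (Γ.rot z)) ↔ P (Q z)) ∧ (P (Q z.flip) ↔ P (Q z)))
    (heuler : 12 * m = arcDarts dir' + 6 * orbitCount (facePerm rot') + 12) :
    ∃ Γ' : SphereGraph n' m, Γ'.rot = rot' ∧ Γ'.dir = dir' ∧
      ∀ x, Γ.region (ι x) = R.succAbove (Γ'.region x) := by
  choose reg hreg using fun x => Fin.exists_succAbove_eq (hR x)
  have inj : ∀ {i j}, R.succAbove i = R.succAbove j → i = j := fun h =>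
    Fin.succAbove_right_injective h
  refine ⟨ofRules rot' dir' reg hrules (fun x => inj ?_) (fun hn R' => ?_) ?_ heuler, rfl, rfl,
    fun x => (hreg x).symm⟩
  · rw [hreg, hreg, hface]
  · obtain ⟨Q, -, h2, -, -⟩ := hQ hn
    obtain ⟨z, hz⟩ := Γ.region_surjective (ι (⟨0, hn⟩, true)).1.pos (R.succAbove R')
    exact ⟨Q z, inj (by rw [hreg, h2 z (hz ▸ Fin.succAbove_ne R R'), hz])⟩
  · intro P h1 h2 h3 x y hx
    obtain ⟨Q, q1, q2, q3, q4⟩ := hQ x.1.pos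
    have := Γ.isConnected (fun z => P (Q z)) (fun z => (q4 P h1 h2 z).1)
      (fun z => (q4 P h1 h2 z).2) (fun z w hzw => ?_) (ι x) (ι y)
    · simpa only [q1] using this (by simpa only [q1] using hx)
    · by_cases hz : Γ.region z = R
      · rw [q3 z w hz (hzw ▸ hz)]
      · exact h3 _ _ (inj (by rw [hreg, hreg, q2 z hz, q2 w (hzw ▸ hz), hzw]))

/-- The darts of the edges `e j`, the terminal half of `a` being replaced by that of `b`. -/
def spliceDart (a b : Fin n) (e : Fin n' → Fin n) (x : Dart n') : Dart n :=
  Equiv.swap (a, true) (b, true) (e x.1, x.2)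

/-- The common core of bubble pops and tadpole trims. `S` consists of the six darts at the two
vertices that vanish. `cls` sorts them by boundary walk: `some false` and `some true` mark those
that run along the two sides of the joined edge, in the walk of `(a, false)` or of `(b, true)`, and
`none` marks the walk of `R`. The numbers balance because one walk and six darts with a direction
are lost. -/
theorem exists_splice (Γ : SphereGraph n (m + 1)) (R : Fin (m + 1)) {a b k l : Fin n}
    (hak : a ≠ k) (hal : a ≠ l) (hbk : b ≠ k) (hbl : b ≠ l) (hkl : k ≠ l)
    {e : Fin n' → Fin n} (he : Function.Injective e)
    (hrange : ∀ x, x ∈ Set.range e ↔ x ≠ k ∧ x ≠ l ∧ (a ≠ b → x ≠ b))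
    (S : Finset (Dart n)) (hS : ∀ z, z ∈ S ↔ z = (a, true) ∨ z = (b, false) ∨ z.1 = k ∨ z.1 = l)
    (hrot : ∀ z, Γ.rot z ∈ S ↔ z ∈ S) (hdir : ∀ z ∈ S, Γ.dir z ≠ none)
    (cls : Dart n → Option Bool) (c1 : cls (a, true) = some true) (c2 : cls (b, false) = some false)
    (c3 : cls (Γ.rot.symm (a, true)) = some false) (c4 : cls (Γ.rot.symm (b, false)) = some true)
    (c5 : ∀ z : Dart n, z.1 = k ∨ z.1 = l → cls (Γ.face z) = cls z)
    (s1 : ∀ z ∈ S, cls z = some false → Γ.face.SameCycle (a, false) z)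
    (s2 : ∀ z ∈ S, cls z = some true → Γ.face.SameCycle (b, true) z)
    (z₀ : Dart n) (hz₀ : z₀ ∈ S ∧ cls z₀ = none)
    (s3 : ∀ z ∈ S, cls z = none → Γ.face.SameCycle z₀ z)
    (hR : ∀ z, Γ.region z = R ↔ z ∈ S ∧ cls z = none) :
    ∃ Γ' : SphereGraph n' m, Splice {k, l} R a b Γ Γ' ∧
      (∀ x, Γ.region (spliceDart a b e x) = R.succAbove (Γ'.region x)) ∧
      ∀ x, if a = b ∧ (spliceDart a b e x).1 = a then Γ'.dir x = none
        else Γ.rot (spliceDart a b e x) = spliceDart a b e (Γ'.rot x) ∧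
          Γ.dir (spliceDart a b e x) = Γ'.dir x := by
  set ι : Dart n' → Dart n := spliceDart a b e with hι
  obtain ⟨ja, hja⟩ : ∃ j, e j = a := (hrange a).2 ⟨hak, hal, fun h => h⟩
  have e_ne : ∀ j, e j ≠ k ∧ e j ≠ l ∧ (a ≠ b → e j ≠ b) := fun j => (hrange _).1 ⟨j, rfl⟩
  have ι_inj : Function.Injective ι := fun x y h => by
    have := (Equiv.swap (a, true) (b, true)).injective h
    exact Prod.ext (he (congrArg Prod.fst this :)) (congrArg Prod.snd this :)
  have ι0 : ι (ja, false) = (a, false) := by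
    rw [hι, spliceDart, hja, Equiv.swap_apply_of_ne_of_ne (by simp) (by simp)]
  have ι1 : ι (ja, true) = (b, true) := by rw [hι, spliceDart, hja, Equiv.swap_apply_left]
  have ι_of_ne : ∀ x, x.1 ≠ ja → ι x = (e x.1, x.2) := fun x hx => by
    have h1 : e x.1 ≠ a := fun h => hx (he (h.trans hja.symm))
    by_cases hab : a = b
    · rw [hι, spliceDart, hab, Equiv.swap_self]; rfl
    · exact Equiv.swap_apply_of_ne_of_ne (by simp [h1]) (by simp [(e_ne x.1).2.2 hab])
  have ι_flip : ∀ x : Dart n', x.1 ≠ ja → ι x.flip = (ι x).flip := fun x hx => by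
    rw [ι_of_ne x hx, ι_of_ne x.flip hx]; rfl
  have ι_a : ∀ x, (ι x).1 = a → x.1 = ja := fun x hx => by
    by_contra h
    rw [ι_of_ne x h] at hx
    exact h (he (hx.trans hja.symm))
  have cases_ja : ∀ x : Dart n', x.1 = ja → x = (ja, false) ∨ x = (ja, true) := by
    rintro ⟨j, _ | _⟩ rfl <;> simp
  have ι_notMem : ∀ x, (a = b → x.1 ≠ ja) → ι x ∉ S := fun x hx => by
    rw [hS]
    by_cases hj : x.1 = ja
    · have hab : a ≠ b := fun h => hx h hj
      rcases cases_ja x hj with rfl | rfl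
      · rw [ι0]; simp [hak, hal, hab]
      · rw [ι1]; simp [hbk, hbl, hab.symm]
    · rw [ι_of_ne x hj]
      obtain ⟨h1, h2, h3⟩ := e_ne x.1
      have h4 : e x.1 ≠ a := fun h => hj (he (h.trans hja.symm))
      have h5 : e x.1 ≠ b := by
        by_cases hab : a = b
        · exact hab ▸ h4
        · exact h3 hab
      simp [h1, h2, h4, h5]
  have exists_ι : ∀ z, z ∉ S → ∃ x, ι x = z := fun z hz => by
    simp only [hS, not_or] at hz
    obtain ⟨h1, h2, h3, h4⟩ := hz
    by_cases hb : z = (b, true)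
    · exact ⟨_, hb ▸ ι1⟩
    have hb' : z.1 ≠ b := fun h => by
      rcases Dart.eq_or_eq_flip (d' := (b, false)) h with h | h
      · exact h2 h
      · exact hb h
    obtain ⟨j, hj⟩ := (hrange z.1).2 ⟨h3, h4, fun _ => hb'⟩
    refine ⟨(j, z.2), ?_⟩
    rw [hι, spliceDart, hj]
    exact Equiv.swap_apply_of_ne_of_ne h1 hb
  have range_circ : ∀ x, a = b → x.1 = ja → ι x = (a, x.2) := fun x hab hx => by
    rw [hι, spliceDart, hab, Equiv.swap_self, hx, hja]; simp [hab]
  -- If `a = b`, the joined edge becomes a circle, whose darts are each other's successors. All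
  -- other darts keep their successor, which lies outside `S` because `S` is a union of vertices.
  have hex : ∀ x : Dart n', ∃ y : Dart n', if a = b ∧ x.1 = ja then y = x.flip else
      ι y = Γ.rot (ι x) := by
    intro x
    split_ifs with h
    · exact ⟨_, rfl⟩
    · exact exists_ι _ (by rw [hrot]; exact ι_notMem x fun h1 h2 => h ⟨h1, h2⟩)
  choose f hf using hex
  have f_circ : ∀ x, a = b → x.1 = ja → f x = x.flip := fun x h1 h2 => by simpa [h1, h2] using hf x
  have f_ι : ∀ x, ¬ (a = b ∧ x.1 = ja) → ι (f x) = Γ.rot (ι x) := fun x h => by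
    simpa only [h, if_false] using hf x
  have f_iff : ∀ x, (a = b ∧ (f x).1 = ja) ↔ a = b ∧ x.1 = ja := fun x => by
    constructor
    · rintro ⟨h1, h2⟩
      refine ⟨h1, ?_⟩
      by_contra h
      have h3 := f_ι x fun h' => h h'.2
      have h4 : ι (f x) ∈ S := by
        rw [range_circ _ h1 h2, hS]
        rcases (f x).2 with _ | _ <;> simp [h1]
      rw [h3, hrot] at h4
      exact ι_notMem x (fun _ => h) h4
    · rintro ⟨h1, h2⟩
      rw [f_circ x h1 h2]
      exact ⟨h1, h2⟩
  have f_inj : Function.Injective f := fun x y h => by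
    by_cases hx : a = b ∧ x.1 = ja
    · have hy := (f_iff y).1 (h ▸ (f_iff x).2 hx)
      rw [f_circ x hx.1 hx.2, f_circ y hy.1 hy.2] at h
      exact Dart.flip_injective h
    · have hy : ¬ (a = b ∧ y.1 = ja) := fun hy => hx ((f_iff x).1 (h ▸ (f_iff y).2 hy))
      exact ι_inj (Γ.rot.injective (by rw [← f_ι x hx, ← f_ι y hy, h]))
  set rot' : Equiv.Perm (Dart n') := Equiv.ofBijective f (Finite.injective_iff_bijective.1 f_inj)
    with hrot'
  have rot'_apply : ∀ x, rot' x = f x := fun x => rfl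
  have hface : ∀ x, f (facePerm rot' x) = x.flip := fun x => by
    rw [← rot'_apply, facePerm_apply, Equiv.apply_symm_apply]
  have face_iff : ∀ x, (a = b ∧ (facePerm rot' x).1 = ja) ↔ a = b ∧ x.1 = ja := fun x => by
    rw [← f_iff, hface]; rfl
  have rot_face : ∀ x, ¬ (a = b ∧ x.1 = ja) → Γ.rot (ι (facePerm rot' x)) = ι x.flip := fun x hx => by
    rw [← f_ι _ (by rwa [face_iff]), hface]
  have face_ι : ∀ x : Dart n', x.1 ≠ ja → Γ.face (ι x) = ι (facePerm rot' x) := fun x hx => by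
    rw [facePerm_apply, Equiv.symm_apply_eq, rot_face x (fun h => hx h.2), ι_flip x hx]
  have face_a : a ≠ b → Γ.face (a, true) = ι (facePerm rot' (ja, true)) := fun hab => by
    rw [facePerm_apply, Equiv.symm_apply_eq, rot_face _ (fun h => hab h.1)]
    exact ι0.symm
  have face_b : a ≠ b → Γ.face (b, false) = ι (facePerm rot' (ja, false)) := fun hab => by
    rw [facePerm_apply, Equiv.symm_apply_eq, rot_face _ (fun h => hab h.1)]
    exact ι1.symm
  have face_circ : ∀ x : Dart n', a = b → x.1 = ja → facePerm rot' x = x := fun x hab hx =>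
    f_inj ((hface x).trans (f_circ x hab hx).symm)
  have ha1 : ((a, true) : Dart n) ∈ S := (hS _).2 (.inl rfl)
  have hb0 : ((b, false) : Dart n) ∈ S := (hS _).2 (.inr (.inl rfl))
  have hcyc : ∀ x, Γ.face.SameCycle (ι x) (ι (facePerm rot' x)) := fun x => by
    by_cases hx : x.1 = ja
    · by_cases hab : a = b
      · rw [face_circ x hab hx]
      · rcases cases_ja x hx with rfl | rfl
        · rw [← face_b hab, ι0]; exact (s1 _ hb0 c2).apply_right
        · rw [← face_a hab, ι1]; exact (s2 _ ha1 c1).apply_right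
    · rw [← face_ι x hx]; exact SameCycle.rfl.apply_right
  classical
  obtain ⟨g, hg⟩ : ∃ g : Dart n → Dart n', ∀ z, z ∉ S → ι (g z) = z :=
    ⟨fun z => if h : z ∉ S then (exists_ι z h).choose else (ja, false), fun z hz => by
      simpa only [hz, not_false_eq_true, dite_true] using (exists_ι z hz).choose_spec⟩
  -- A deleted dart goes to the dart of the joined edge on its side, or to `none` if it belongs to
  -- the walk of `R`; every other dart goes to its counterpart.
  set r : Dart n → Option (Dart n') := fun z => if z ∈ S then (cls z).map (Prod.mk ja) else some (g z)
    with hr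
  have r_of_mem : ∀ z ∈ S, r z = (cls z).map (Prod.mk ja) := fun z hz => by simp [r, hz]
  have r_of_notMem : ∀ x, ι x ∉ S → r (ι x) = some x := fun x hx => by
    simp only [r, hx, if_false, Option.some_inj]
    exact ι_inj (hg _ hx)
  have r_ι : ∀ x, r (ι x) = some x := fun x => by
    by_cases hx : a = b ∧ x.1 = ja
    · obtain ⟨hab, hx⟩ := hx
      rcases cases_ja x hx with rfl | rfl
      · rw [ι0, hab, r_of_mem _ hb0, c2]; rfl
      · rw [ι1, ← hab, r_of_mem _ ha1, c1]; rfl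
    · exact r_of_notMem x (ι_notMem x fun h1 h2 => hx ⟨h1, h2⟩)
  have r_some : ∀ z x, r z = some x → Γ.face.SameCycle (ι x) z := fun z x hx => by
    by_cases hz : z ∈ S
    · rw [r_of_mem z hz] at hx
      rcases h : cls z with _ | _ | _
      · simp [h] at hx
      · obtain rfl : (ja, false) = x := by simpa [h] using hx
        rw [ι0]; exact s1 z hz h
      · obtain rfl : (ja, true) = x := by simpa [h] using hx
        rw [ι1]; exact s2 z hz h
    · obtain rfl : g z = x := by simpa [r, hz] using hx
      rw [hg z hz]
  have r_none : ∀ z, r z = none ↔ z ∈ S ∧ cls z = none := fun z => by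
    by_cases hz : z ∈ S <;> simp [r, hz]
  have face_mem : ∀ z, Γ.face z ∈ S ↔ z.flip ∈ S := fun z => by
    rw [← hrot, facePerm_apply, Equiv.apply_symm_apply]
  have hstep : ∀ z, SameCycle (Equiv.optionCongr (facePerm rot')) (r z) (r (Γ.face z)) := by
    intro z
    by_cases hz : z ∈ S
    · rcases (hS z).1 hz with rfl | rfl | hz'
      · rw [r_of_mem _ hz, c1]
        by_cases hab : a = b
        · have : Γ.face (a, true) ∈ S := (face_mem _).2 (by rw [hab]; exact hb0)
          rw [r_of_mem _ this]
          have h : cls (Γ.face (a, true)) = some true := by rw [← c4, ← hab]; rfl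
          rw [h]
        · rw [face_a hab, r_ι]; exact (sameCycle_optionCongr_some _).2 SameCycle.rfl.apply_right
      · rw [r_of_mem _ hz, c2]
        by_cases hab : a = b
        · have : Γ.face (b, false) ∈ S := (face_mem _).2 (by rw [← hab]; exact ha1)
          rw [r_of_mem _ this]
          have h : cls (Γ.face (b, false)) = some false := by rw [← c3, hab]; rfl
          rw [h]
        · rw [face_b hab, r_ι]; exact (sameCycle_optionCongr_some _).2 SameCycle.rfl.apply_right
      · have : Γ.face z ∈ S := (face_mem _).2 ((hS _).2 (.inr (.inr hz')))
        rw [r_of_mem _ hz, r_of_mem _ this, c5 z hz']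
    · obtain ⟨x, rfl⟩ := exists_ι z hz
      rw [r_ι]
      by_cases hx : x.1 = ja
      · have hab : a ≠ b := by
          rintro hab
          refine hz ?_
          rw [range_circ x hab hx]
          cases x.2
          · rw [hab]; exact hb0
          · exact ha1
        rcases cases_ja x hx with rfl | rfl
        · have : Γ.face (a, false) ∈ S := (face_mem _).2 ha1
          rw [ι0, r_of_mem _ this]
          have h : cls (Γ.face (a, false)) = some false := c3
          rw [h]; rfl
        · have : Γ.face (b, true) ∈ S := (face_mem _).2 hb0
          rw [ι1, r_of_mem _ this]
          have h : cls (Γ.face (b, true)) = some true := c4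
          rw [h]; rfl
      · rw [face_ι x hx, r_ι]; exact (sameCycle_optionCongr_some _).2 SameCycle.rfl.apply_right
  have hcount : orbitCount Γ.face = orbitCount (facePerm rot') + 1 := by
    rw [← orbitCount_optionCongr]
    refine orbitCount_eq_of_maps _ _ r (fun o => o.elim z₀ ι) hstep ?_ ?_ ?_
    · rintro (_ | x)
      · exact .refl _ _
      · exact hcyc x
    · intro z
      rcases h : r z with _ | x
      · exact s3 z ((r_none z).1 h).1 ((r_none z).1 h).2
      · exact r_some z x h
    · rintro (_ | x)
      · rw [show r ((none : Option (Dart n')).elim z₀ ι) = none from (r_none _).2 hz₀]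
      · rw [show r ((some x).elim z₀ ι) = some x from r_ι x]
  set dir' : Dart n' → Option Direction := fun x => if a = b ∧ x.1 = ja then none else Γ.dir (ι x)
    with hdir'
  have dir'_circ : ∀ x, a = b ∧ x.1 = ja → dir' x = none := fun x hx => if_pos hx
  have dir'_ι : ∀ x, ¬ (a = b ∧ x.1 = ja) → dir' x = Γ.dir (ι x) := fun x hx => if_neg hx
  have da1 := hdir _ ha1
  have db0 := hdir _ hb0
  have da0 : Γ.dir (a, false) ≠ none := fun h => da1 (Γ.dir_flip _ h)
  have db1 : Γ.dir (b, true) ≠ none := fun h => db0 (Γ.dir_flip _ h)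
  have dir_ja : ∀ x, x.1 = ja → Γ.dir (ι x) ≠ none := fun x hx => by
    rcases cases_ja x hx with rfl | rfl
    · rwa [ι0]
    · rwa [ι1]
  have hrules : LocalRules rot' dir' :=
    { dir_flip := fun x hx => by
        by_cases hc : a = b ∧ x.1 = ja
        · exact dir'_circ _ hc
        · rw [dir'_ι x hc] at hx
          rw [dir'_ι x.flip hc, ι_flip x fun h => dir_ja x h hx]
          exact Γ.dir_flip _ hx
      rot_circle := fun x hx => by
        by_cases hc : a = b ∧ x.1 = ja
        · exact f_circ x hc.1 hc.2
        · rw [dir'_ι x hc] at hx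
          apply ι_inj
          rw [rot'_apply, f_ι x hc, ι_flip x fun h => dir_ja x h hx, Γ.rot_circle _ hx]
      dir_rot := fun x y hx => by
        by_cases hc : a = b ∧ x.1 = ja
        · simp [dir'_circ x hc] at hx
        · rw [dir'_ι x hc] at hx
          rw [rot'_apply, dir'_ι _ (by rwa [f_iff]), f_ι x hc]
          exact Γ.dir_rot _ _ hx
      rot_rot_rot := fun x hx => by
        by_cases hc : a = b ∧ x.1 = ja
        · exact absurd (dir'_circ x hc) hx
        · rw [dir'_ι x hc] at hx
          apply ι_inj
          rw [rot'_apply, rot'_apply, rot'_apply, f_ι _ (by rwa [f_iff, f_iff]),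
            f_ι _ (by rwa [f_iff]), f_ι x hc, Γ.rot_rot_rot _ hx] }
  -- The darts that lose their direction or disappear are exactly those of `S`. If `a = b`, both
  -- halves of `a` are in `S`, so the case of a circle fits too.
  have harc : arcDarts Γ.dir = arcDarts dir' + 6 := by
    have hcard : S.card = 6 := by
      have : S = {(a, true), (b, false), (k, false), (k, true), (l, false), (l, true)} := by
        ext ⟨i, j⟩
        rw [hS]
        cases j <;> simp
      rw [this]
      simp [hak, hal, hbk, hbl, hkl]
    rw [arcDarts, arcDarts, ← hcard, ← Finset.card_map ⟨ι, ι_inj⟩, ← Finset.card_union_of_disjoint]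
    · congr 1
      ext z
      simp only [Finset.mem_filter, Finset.mem_univ, true_and, Finset.mem_union, Finset.mem_map,
        Function.Embedding.coeFn_mk]
      constructor
      · intro hz
        by_cases hzS : z ∈ S
        · exact .inr hzS
        · obtain ⟨x, rfl⟩ := exists_ι z hzS
          refine .inl ⟨x, ?_, rfl⟩
          rwa [dir'_ι]
          rintro ⟨hab, hx⟩
          refine hzS ?_
          rw [range_circ x hab hx]
          cases x.2
          · rw [hab]; exact hb0
          · exact ha1
      · rintro (⟨x, hx, rfl⟩ | hz)
        · have hc : ¬ (a = b ∧ x.1 = ja) := fun h => hx (dir'_circ x h)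
          rwa [dir'_ι x hc] at hx
        · exact hdir z hz
    · rw [Finset.disjoint_left]
      intro z hz
      simp only [Finset.mem_filter, Finset.mem_univ, true_and, Finset.mem_map,
        Function.Embedding.coeFn_mk] at hz
      obtain ⟨x, hx, rfl⟩ := hz
      exact ι_notMem x fun h1 h2 => hx (dir'_circ x ⟨h1, h2⟩)
  obtain ⟨Γ', g1, g2, g3⟩ := Γ.exists_restrict R ι rot' dir' hrules
    (fun x => (Γ.region_eq_of_sameCycle (hcyc x)).symm)
    (fun x => by rw [ne_eq, hR, ← r_none, r_ι]; simp)
    (fun _ => by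
      refine ⟨fun z => (r z).getD (ja, false), fun x => by simp [r_ι], fun z hz => ?_,
        fun z w hz hw => ?_, fun P h1 h2 z => ?_⟩
      · rw [ne_eq, hR, ← r_none] at hz
        obtain ⟨x, hx⟩ := Option.ne_none_iff_exists'.1 hz
        simp only [hx, Option.getD_some]
        exact Γ.region_eq_of_sameCycle (r_some z x hx)
      · rw [hR, ← r_none] at hz hw
        simp only [hz, hw]
      · have hP : P (ja, true) ↔ P (ja, false) := h2 (ja, false)
        have hPS : ∀ z ∈ S, P ((r z).getD (ja, false)) ↔ P (ja, false) := fun z hz => by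
          rw [r_of_mem z hz]
          rcases cls z with _ | _ | _
          · simp
          · simp
          · simpa using hP
        by_cases hz : z ∈ S
        · refine ⟨by rw [hPS z hz, hPS _ ((hrot z).2 hz)], ?_⟩
          beta_reduce
          by_cases hz' : z.flip ∈ S
          · rw [hPS z hz, hPS _ hz']
          · rw [hPS z hz]
            rcases (hS z).1 hz with rfl | rfl | h
            · rw [show Dart.flip (a, true) = ι (ja, false) from ι0.symm, r_ι]; rfl
            · rw [show Dart.flip (b, false) = ι (ja, true) from ι1.symm, r_ι]; exact hP
            · exact absurd ((hS z.flip).2 (.inr (.inr h))) hz'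
        · obtain ⟨x, rfl⟩ := exists_ι z hz
          have hc : ¬ (a = b ∧ x.1 = ja) := by
            rintro ⟨hab, hx⟩
            refine hz ?_
            rw [range_circ x hab hx]
            cases x.2
            · rw [hab]; exact hb0
            · exact ha1
          beta_reduce
          rw [← f_ι x hc, r_ι, r_ι]
          refine ⟨h1 x, ?_⟩
          by_cases hx : x.1 = ja
          · have hab : a ≠ b := fun h => hc ⟨h, hx⟩
            rcases cases_ja x hx with rfl | rfl
            · rw [ι0, show Dart.flip (a, false) = (a, true) from rfl, hPS _ ha1]; rfl
            · rw [ι1, show Dart.flip (b, true) = (b, false) from rfl, hPS _ hb0]; exact hP.symm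
          · rw [← ι_flip x hx, r_ι]; exact h2 x)
    (by have := Γ.euler'; omega)
  have hlast : ∀ x, if a = b ∧ (ι x).1 = a then Γ'.dir x = none
      else Γ.rot (ι x) = ι (Γ'.rot x) ∧ Γ.dir (ι x) = Γ'.dir x := fun x => by
    have hc : (a = b ∧ (ι x).1 = a) ↔ a = b ∧ x.1 = ja :=
      and_congr_right fun hab => ⟨ι_a x, fun h => by rw [range_circ x hab h]⟩
    simp only [hc, g1, g2]
    split_ifs with h
    · exact dir'_circ x h
    · exact ⟨(f_ι x h).symm, (dir'_ι x h).symm⟩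
  refine ⟨Γ', ⟨ι, R.succAbove, ι_inj, fun z => ?_, fun j => ?_, dropsRegion_succAbove R, g3, hlast⟩,
    g3, hlast⟩
  · constructor
    · rintro ⟨x, rfl⟩
      by_cases hc : a = b ∧ x.1 = ja
      · rw [range_circ x hc.1 hc.2]
        simp [hbk, hbl, hc.1]
      · have := ι_notMem x fun h1 h2 => hc ⟨h1, h2⟩
        simp only [hS, not_or] at this
        obtain ⟨h1, h2, h3, h4⟩ := this
        simp [h1, h2, h3, h4]
    · rintro ⟨h1, h2⟩
      simp only [Set.mem_insert_iff, Set.mem_singleton_iff, not_or] at h1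
      by_cases hz : z ∈ S
      · by_cases hab : a = b
        · rcases (hS z).1 hz with rfl | rfl | h
          · exact ⟨_, by rw [ι1, hab]⟩
          · exact ⟨_, by rw [ι0, hab]⟩
          · tauto
        · rcases (hS z).1 hz with h | h | h
          · exact absurd h (h2 hab).1
          · exact absurd h (h2 hab).2
          · tauto
      · exact exists_ι z hz
  · by_cases hj : j = ja
    · subst hj
      rw [ι0, ι1]
      simp
    · rw [ι_of_ne (j, false) hj, ι_of_ne (j, true) hj]
      have : e j ≠ a := fun h => hj (he (h.trans hja.symm))
      simp [this]

end SphereGraph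

/-! ### Existence of bubble pops, tadpole trims and circle removals. -/

open Equiv.Perm

namespace SphereGraph

variable {n m n' m' : ℕ}

theorem dir_ne {Γ : SphereGraph n m} {x y : Dart n} {u v : Direction} (hx : Γ.dir x = some u)
    (hy : Γ.dir y = some v) (huv : u ≠ v) : x ≠ y := by
  rintro rfl
  exact huv (Option.some.inj (hx.symm.trans hy))

theorem face_eq_of_rot_eq {Γ : SphereGraph n m} {x y : Dart n} (h : Γ.rot y = x.flip) :
    Γ.face x = y := by
  rw [facePerm_apply, Equiv.symm_apply_eq, h]

/-- Outside the bubble, the walk `(b, true), (l, true), (t, true)` runs up on the left and `(t,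
false), (r, false), (b, false)` runs down on the right; these become the two sides of the joined
edge. The inner walk `(l, false), (r, true)` disappears. -/
theorem exists_bubblePop (Γ : SphereGraph n (m + 1)) {t l r b : Fin n}
    (h1 : Γ.IsInvY (t, true) (l, false) (r, false)) (h2 : Γ.IsY (l, true) (r, true) (b, false))
    (h3 : ∀ x, Γ.region x = Γ.region (l, false) ↔ x = (l, false) ∨ x = (r, true))
    {e : Fin n' → Fin n} (he : Function.Injective e)
    (hrange : ∀ x, x ∈ Set.range e ↔ x ≠ l ∧ x ≠ r ∧ (t ≠ b → x ≠ b)) :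
    ∃ Γ' : SphereGraph n' m, BubblePop Γ Γ' ∧
      (∀ x, Γ.region (spliceDart t b e x) = (Γ.region (l, false)).succAbove (Γ'.region x)) ∧
      ∀ x, if t = b ∧ (spliceDart t b e x).1 = t then Γ'.dir x = none
        else Γ.rot (spliceDart t b e x) = spliceDart t b e (Γ'.rot x) ∧
          Γ.dir (spliceDart t b e x) = Γ'.dir x := by
  obtain ⟨dt, dl0, dr0, rt, rl0, rr0⟩ := h1
  obtain ⟨dl1, dr1, db, rr1, rl1, rb⟩ := h2
  have htl : t ≠ l := by rintro rfl; exact dir_ne dt dl1 (by decide) rfl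
  have htr : t ≠ r := by rintro rfl; exact dir_ne dt dr1 (by decide) rfl
  have hbl : b ≠ l := by rintro rfl; exact dir_ne db dl0 (by decide) rfl
  have hbr : b ≠ r := by rintro rfl; exact dir_ne db dr0 (by decide) rfl
  have hlr : l ≠ r := by rintro rfl; exact dir_ne dl0 dr0 (by decide) rfl
  have fl0 : Γ.face (l, false) = (r, true) := face_eq_of_rot_eq rr1
  have fr1 : Γ.face (r, true) = (l, false) := face_eq_of_rot_eq rl0
  have fl1 : Γ.face (l, true) = (t, true) := face_eq_of_rot_eq rt
  have fr0 : Γ.face (r, false) = (b, false) := face_eq_of_rot_eq rb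
  have ft0 : Γ.face (t, false) = (r, false) := face_eq_of_rot_eq rr0
  have fb1 : Γ.face (b, true) = (l, true) := face_eq_of_rot_eq rl1
  let S : Finset (Dart n) :=
    {(t, true), (b, false), (l, false), (l, true), (r, false), (r, true)}
  have hS : ∀ z, z ∈ S ↔ z = (t, true) ∨ z = (b, false) ∨ z.1 = l ∨ z.1 = r := by
    rintro ⟨i, j⟩
    cases j <;> simp [S]
  have hS' : ∀ {p : Dart n → Prop}, (∀ z ∈ S, p z) ↔ p (t, true) ∧ p (b, false) ∧ p (l, false) ∧
      p (l, true) ∧ p (r, false) ∧ p (r, true) := by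
    intro p; simp only [S, Finset.forall_mem_insert, Finset.mem_singleton, forall_eq]
  let cls : Dart n → Option Bool := fun z => if z = (l, false) ∨ z = (r, true) then none
    else some (decide (z = (t, true) ∨ z = (l, true)))
  have ct : cls (t, true) = some true := by simp [cls, htr]
  have cb : cls (b, false) = some false := by simp [cls, hbl]
  have cl0 : cls (l, false) = none := by simp [cls]
  have cl1 : cls (l, true) = some true := by simp [cls, hlr]
  have cr0 : cls (r, false) = some false := by simp [cls, hlr.symm]
  have cr1 : cls (r, true) = none := by simp [cls]
  have cnone : ∀ z, cls z = none ↔ z = (l, false) ∨ z = (r, true) := fun z => by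
    simp only [cls, ite_eq_left_iff, reduceCtorEq, imp_false, not_not]
  obtain ⟨Γ', g1, g2, g3⟩ := Γ.exists_splice (Γ.region (l, false)) htl htr hbl hbr hlr he hrange S hS
    (fun z => by
      constructor
      · intro hz
        have : ∀ w ∈ S, Γ.rot.symm w ∈ S := hS'.2 (by
          refine ⟨?_, ?_, ?_, ?_, ?_, ?_⟩
          · rw [← rr0, Equiv.symm_apply_apply]; simp [S]
          · rw [← rl1, Equiv.symm_apply_apply]; simp [S]
          · rw [← rt, Equiv.symm_apply_apply]; simp [S]
          · rw [← rr1, Equiv.symm_apply_apply]; simp [S]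
          · rw [← rl0, Equiv.symm_apply_apply]; simp [S]
          · rw [← rb, Equiv.symm_apply_apply]; simp [S])
        simpa using this _ hz
      · revert z
        exact hS'.2 (by simp [S, rt, rb, rl0, rl1, rr0, rr1]))
    (hS'.2 (by simp [dt, db, dl0, dl1, dr0, dr1])) cls ct cb
    (by rw [← rr0, Equiv.symm_apply_apply, cr0]) (by rw [← rl1, Equiv.symm_apply_apply, cl1])
    (by
      rintro ⟨i, j⟩ (rfl | rfl) <;> cases j
      · rw [fl0, cl0, cr1]
      · rw [fl1, cl1, ct]
      · rw [fr0, cr0, cb]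
      · rw [fr1, cr1, cl0])
    (hS'.2 (by
      simp only [ct, cl0, cl1, cr1, ← fr0, ← ft0]
      simp [SameCycle.rfl]))
    (hS'.2 (by
      simp only [cb, cl0, cr0, cr1, ← fl1, ← fb1]
      simp [SameCycle.rfl]))
    (l, false) ⟨(hS _).2 (by simp), cl0⟩
    (hS'.2 (by
      simp only [ct, cb, cl0, cl1, cr0, ← fl0]
      simp [SameCycle.rfl]))
    (fun z => by
      rw [h3, cnone]
      constructor
      · rintro (rfl | rfl) <;> simp [S]
      · exact fun h => h.2)
  exact ⟨Γ', ⟨t, l, r, b, ⟨dt, dl0, dr0, rt, rl0, rr0⟩, ⟨dl1, dr1, db, rr1, rl1, rb⟩, h3, g1⟩, g2, g3⟩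

/-- On one side the walk goes around the whole tadpole, `(a, false), (s, true), (p, false), (s,
false), (b, false)`; on the other it passes from `(b, true)` straight to `(a, true)`. The walk that
disappears is the single dart `(p, true)`. -/
theorem exists_tadpoleTrim (Γ : SphereGraph n (m + 1)) {p s a b : Fin n}
    (h1 : Γ.IsY (p, false) (p, true) (s, false)) (h2 : Γ.IsInvY (s, true) (a, true) (b, false))
    (h3 : ∀ x, Γ.region x = Γ.region (p, true) ↔ x = (p, true))
    {e : Fin n' → Fin n} (he : Function.Injective e)
    (hrange : ∀ x, x ∈ Set.range e ↔ x ≠ p ∧ x ≠ s ∧ (a ≠ b → x ≠ b)) :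
    ∃ Γ' : SphereGraph n' m, TadpoleTrim Γ Γ' ∧
      (∀ x, Γ.region (spliceDart a b e x) = (Γ.region (p, true)).succAbove (Γ'.region x)) ∧
      ∀ x, if a = b ∧ (spliceDart a b e x).1 = a then Γ'.dir x = none
        else Γ.rot (spliceDart a b e x) = spliceDart a b e (Γ'.rot x) ∧
          Γ.dir (spliceDart a b e x) = Γ'.dir x := by
  obtain ⟨dp0, dp1, ds0, rp1, rp0, rs0⟩ := h1
  obtain ⟨ds1, da, db, rs1, ra, rb⟩ := h2
  have hap : a ≠ p := by rintro rfl; exact dir_ne da dp1 (by decide) rfl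
  have has : a ≠ s := by rintro rfl; exact dir_ne da ds1 (by decide) rfl
  have hbp : b ≠ p := by rintro rfl; exact dir_ne db dp0 (by decide) rfl
  have hbs : b ≠ s := by rintro rfl; exact dir_ne db ds0 (by decide) rfl
  have hps : p ≠ s := by rintro rfl; exact dir_ne dp0 ds0 (by decide) rfl
  have fp1 : Γ.face (p, true) = (p, true) := face_eq_of_rot_eq rp1
  have fp0 : Γ.face (p, false) = (s, false) := face_eq_of_rot_eq rs0
  have fs0 : Γ.face (s, false) = (b, false) := face_eq_of_rot_eq rb
  have fs1 : Γ.face (s, true) = (p, false) := face_eq_of_rot_eq rp0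
  have fa0 : Γ.face (a, false) = (s, true) := face_eq_of_rot_eq rs1
  have fb1 : Γ.face (b, true) = (a, true) := face_eq_of_rot_eq ra
  let S : Finset (Dart n) :=
    {(a, true), (b, false), (p, false), (p, true), (s, false), (s, true)}
  have hS : ∀ z, z ∈ S ↔ z = (a, true) ∨ z = (b, false) ∨ z.1 = p ∨ z.1 = s := by
    rintro ⟨i, j⟩
    cases j <;> simp [S]
  have hS' : ∀ {q : Dart n → Prop}, (∀ z ∈ S, q z) ↔ q (a, true) ∧ q (b, false) ∧ q (p, false) ∧
      q (p, true) ∧ q (s, false) ∧ q (s, true) := by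
    intro p; simp only [S, Finset.forall_mem_insert, Finset.mem_singleton, forall_eq]
  let cls : Dart n → Option Bool := fun z => if z = (p, true) then none
    else some (decide (z = (a, true)))
  have ca : cls (a, true) = some true := by simp [cls, hap]
  have cb : cls (b, false) = some false := by simp [cls]
  have cp0 : cls (p, false) = some false := by simp [cls]
  have cp1 : cls (p, true) = none := by simp [cls]
  have cs0 : cls (s, false) = some false := by simp [cls]
  have cs1 : cls (s, true) = some false := by simp [cls, hps.symm, has.symm]
  have cnone : ∀ z, cls z = none ↔ z = (p, true) := fun z => by simp [cls]
  obtain ⟨Γ', g1, g2, g3⟩ := Γ.exists_splice (Γ.region (p, true)) hap has hbp hbs hps he hrange S hS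
    (fun z => by
      constructor
      · intro hz
        have : ∀ w ∈ S, Γ.rot.symm w ∈ S := hS'.2 (by
          refine ⟨?_, ?_, ?_, ?_, ?_, ?_⟩
          · rw [← rs1, Equiv.symm_apply_apply]; simp [S]
          · rw [← ra, Equiv.symm_apply_apply]; simp [S]
          · rw [← rp1, Equiv.symm_apply_apply]; simp [S]
          · rw [← rs0, Equiv.symm_apply_apply]; simp [S]
          · rw [← rp0, Equiv.symm_apply_apply]; simp [S]
          · rw [← rb, Equiv.symm_apply_apply]; simp [S])
        simpa using this _ hz
      · revert z
        exact hS'.2 (by simp [S, ra, rb, rp0, rp1, rs0, rs1]))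
    (hS'.2 (by simp [da, db, dp0, dp1, ds0, ds1])) cls ca cb
    (by rw [← rs1, Equiv.symm_apply_apply, cs1]) (by rw [← ra, Equiv.symm_apply_apply, ca])
    (by
      rintro ⟨i, j⟩ (rfl | rfl) <;> cases j
      · rw [fp0, cp0, cs0]
      · rw [fp1]
      · rw [fs0, cs0, cb]
      · rw [fs1, cs1, cp0])
    (hS'.2 (by
      simp only [ca, cp1, ← fs0, ← fp0, ← fs1, ← fa0]
      simp [SameCycle.rfl]))
    (hS'.2 (by
      simp only [cb, cp0, cp1, cs0, cs1, ← fb1]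
      simp [SameCycle.rfl]))
    (p, true) ⟨(hS _).2 (by simp), cp1⟩
    (hS'.2 (by
      simp only [ca, cb, cp0, cp1, cs0, cs1]
      simp [SameCycle.rfl]))
    (fun z => by
      rw [h3, cnone]
      constructor
      · rintro rfl
        simp [S]
      · exact fun h => h.2)
  exact ⟨Γ', ⟨p, s, a, b, ⟨dp0, dp1, ds0, rp1, rp0, rs0⟩, ⟨ds1, da, db, rs1, ra, rb⟩, h3, g1⟩, g2, g3⟩

/-- The region inside the circle goes, the one outside stays. No dart with a direction is lost, but
two boundary walks are, one on each side of the circle, and this balances Euler's formula. -/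
theorem exists_circleRemoval (Γ : SphereGraph n (m + 1)) {c : Fin n} (hc : Γ.dir (c, false) = none)
    (hR : ∀ x, Γ.region x = Γ.region (c, false) ↔ x = (c, false))
    {e : Fin n' → Fin n} (he : Function.Injective e) (hrange : Set.range e = {c}ᶜ) :
    ∃ Γ' : SphereGraph n' m, CircleRemoval Γ Γ' ∧ ∀ x : Dart n',
      Γ.rot (e x.1, x.2) = (e (Γ'.rot x).1, (Γ'.rot x).2) ∧
      Γ.dir (e x.1, x.2) = Γ'.dir x ∧
      Γ.region (e x.1, x.2) = (Γ.region (c, false)).succAbove (Γ'.region x) := by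
  set ι : Dart n' → Dart n := fun x => (e x.1, x.2) with hι
  have hc1 : Γ.dir (c, true) = none := Γ.dir_flip _ hc
  have r0 : Γ.rot (c, false) = (c, true) := Γ.rot_circle _ hc
  have r1 : Γ.rot (c, true) = (c, false) := Γ.rot_circle _ hc1
  have ι_inj : Function.Injective ι := fun x y h =>
    Prod.ext (he (congrArg Prod.fst h :)) (congrArg Prod.snd h :)
  have ι_flip : ∀ x : Dart n', ι x.flip = (ι x).flip := fun x => rfl
  have ι_ne : ∀ x, (ι x).1 ≠ c := fun x => by
    have : e x.1 ∈ Set.range e := ⟨_, rfl⟩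
    rw [hrange] at this
    exact this
  have exists_ι : ∀ z : Dart n, z.1 ≠ c → ∃ x, ι x = z := fun z hz => by
    have : z.1 ∈ Set.range e := by rw [hrange]; exact hz
    obtain ⟨j, hj⟩ := this
    exact ⟨(j, z.2), by rw [hι]; simp [hj]⟩
  have exists_ι' := exists_ι
  choose g hg using exists_ι'
  have gι : ∀ x h, g (ι x) h = x := fun x h => ι_inj (hg _ _)
  have rot_c : ∀ z : Dart n, z.1 = c → (Γ.rot z).1 = c := by
    rintro ⟨i, j⟩ rfl
    cases j
    · rw [r0]
    · rw [r1]
  have face_c : ∀ z : Dart n, z.1 = c → Γ.face z = z := by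
    rintro ⟨i, j⟩ rfl
    cases j
    · exact face_eq_of_rot_eq r0
    · exact face_eq_of_rot_eq r1
  have rot_ne : ∀ z : Dart n, z.1 ≠ c → (Γ.rot z).1 ≠ c := by
    intro z hz h
    rcases hj : (Γ.rot z).2 with _ | _
    · have : Γ.rot z = Γ.rot (c, true) := by rw [r1]; exact Prod.ext h hj
      exact hz (congrArg Prod.fst (Γ.rot.injective this))
    · have : Γ.rot z = Γ.rot (c, false) := by rw [r0]; exact Prod.ext h hj
      exact hz (congrArg Prod.fst (Γ.rot.injective this))
  choose f hf using fun x => exists_ι (Γ.rot (ι x)) (rot_ne _ (ι_ne x))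
  have f_inj : Function.Injective f := fun x y h =>
    ι_inj (Γ.rot.injective (by rw [← hf, ← hf, h]))
  set rot' : Equiv.Perm (Dart n') := Equiv.ofBijective f (Finite.injective_iff_bijective.1 f_inj)
    with hrot'
  have rot'_apply : ∀ x, ι (rot' x) = Γ.rot (ι x) := hf
  have face_ι : ∀ x, Γ.face (ι x) = ι (facePerm rot' x) := fun x => by
    refine face_eq_of_rot_eq ?_
    rw [← rot'_apply, facePerm_apply, Equiv.apply_symm_apply, ι_flip]
  have hrules : LocalRules rot' (fun x => Γ.dir (ι x)) :=
    { dir_flip := fun x hx => Γ.dir_flip _ hx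
      rot_circle := fun x hx => ι_inj (by rw [rot'_apply, Γ.rot_circle _ hx, ι_flip])
      dir_rot := fun x y hx => by rw [rot'_apply]; exact Γ.dir_rot _ _ hx
      rot_rot_rot := fun x hx => ι_inj (by simp only [rot'_apply]; exact Γ.rot_rot_rot _ hx) }
  have harc : arcDarts Γ.dir = arcDarts (fun x => Γ.dir (ι x)) := by
    rw [arcDarts, arcDarts]
    symm
    rw [← Finset.card_map ⟨ι, ι_inj⟩]
    congr 1
    ext z
    simp only [Finset.mem_filter, Finset.mem_univ, true_and, Finset.mem_map,
      Function.Embedding.coeFn_mk]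
    constructor
    · rintro ⟨x, hx, rfl⟩
      exact hx
    · intro hz
      obtain ⟨x, rfl⟩ := exists_ι z (by
        obtain ⟨i, j⟩ := z
        rintro rfl
        cases j
        · exact hz hc
        · exact hz hc1)
      exact ⟨x, hz, rfl⟩
  classical
  -- Both darts of the circle are fixed points of the face permutation; they correspond to the two
  -- added points.
  have hcount : orbitCount Γ.face = orbitCount (facePerm rot') + 2 := by
    rw [show orbitCount (facePerm rot') + 2 = orbitCount (facePerm rot') + 1 + 1 from rfl,
      ← orbitCount_optionCongr, ← orbitCount_optionCongr]
    refine orbitCount_eq_of_maps _ _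
      (fun z => if hz : z.1 = c then (if z.2 then none else some none) else some (some (g z hz)))
      (fun o => o.elim (c, true) fun o => o.elim (c, false) ι) (fun z => ?_) ?_ (fun z => ?_) ?_
    · by_cases hz : z.1 = c
      · rw [face_c z hz]
      · obtain ⟨x, rfl⟩ := exists_ι z hz
        have h1 := ι_ne x
        have h2 := ι_ne (facePerm rot' x)
        rw [face_ι]
        simp only [h1, h2, dite_false]
        rw [gι, gι, sameCycle_optionCongr_some, sameCycle_optionCongr_some]
        exact SameCycle.rfl.apply_right
    · rintro (_ | _ | x)
      · exact .refl _ _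
      · exact .refl _ _
      · change Γ.face.SameCycle (ι x) (ι (facePerm rot' x))
        rw [← face_ι]
        exact SameCycle.rfl.apply_right
    · by_cases hz : z.1 = c
      · obtain ⟨i, j⟩ := z
        obtain rfl : i = c := hz
        cases j <;> simp [SameCycle.rfl]
      · simp [hz, hg, SameCycle.rfl]
    · rintro (_ | _ | x)
      · simp [SameCycle.rfl]
      · simp [SameCycle.rfl]
      · have h1 := ι_ne x
        simp [h1, gι, SameCycle.rfl]
  obtain ⟨Γ', g1, g2, g3⟩ := Γ.exists_restrict (Γ.region (c, false)) ι rot' _ hrules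
    (fun x => by rw [← face_ι, Γ.region_face_apply])
    (fun x hx => ι_ne x (by rw [(hR _).1 hx]))
    (fun hn => by
      -- If any other edge exists, some dart off the circle borders the outer region; otherwise the
      -- circle would be cut off from the rest, against connectedness. The retraction sends the
      -- circle to this dart.
      have : ∃ x, 0 < n' → Γ.region (ι x) = Γ.region (c, true) := by
        by_contra! hno
        have := Γ.isConnected (fun z => z.1 = c) (fun z => ⟨fun h => by_contra fun h' => rot_ne z h' h,
          rot_c z⟩) (fun z => Iff.rfl) (fun z w hzw => ?_) (c, true) (ι (⟨0, hn⟩, true)) rfl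
        · exact ι_ne _ this
        · have key : ∀ z w : Dart n, Γ.region z = Γ.region w → z.1 = c → w.1 = c := by
            rintro ⟨i, j⟩ w hzw rfl
            by_contra h
            obtain ⟨x, rfl⟩ := exists_ι w h
            cases j
            · exact ι_ne x (by rw [(hR _).1 hzw.symm])
            · exact (hno x).2 hzw.symm
          exact ⟨key z w hzw, key w z hzw.symm⟩
      obtain ⟨x₀, hx₀⟩ := this
      refine ⟨fun z => if hz : z.1 = c then x₀ else g z hz, fun x => ?_, fun z hz => ?_,
        fun z w hz hw => ?_, fun P h1 h2 z => ?_⟩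
      · simp [ι_ne, gι]
      · by_cases h : z.1 = c
        · simp only [h, dite_true]
          rw [hx₀ hn]
          obtain ⟨i, j⟩ := z
          obtain rfl : i = c := h
          cases j
          · exact absurd rfl hz
          · rfl
        · simp [h, hg]
      · rw [(hR z).1 hz, (hR w).1 hw]
      · by_cases h : z.1 = c
        · simp [h, rot_c z h]
        · obtain ⟨x, rfl⟩ := exists_ι z h
          rw [← rot'_apply, ← ι_flip]
          simp [ι_ne, gι, h1, h2])
    (by have := Γ.euler'; omega)
  have hlast : ∀ x : Dart n', Γ.rot (ι x) = ι (Γ'.rot x) ∧ Γ.dir (ι x) = Γ'.dir x ∧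
      Γ.region (ι x) = (Γ.region (c, false)).succAbove (Γ'.region x) := fun x =>
    ⟨by rw [g1, rot'_apply], by rw [g2], g3 x⟩
  exact ⟨Γ', ⟨c, hc, hR, e, _, he, hrange, dropsRegion_succAbove _, hlast⟩, hlast⟩

end SphereGraph

open Equiv.Perm

namespace SphereGraph

variable {n m : ℕ}

/-! ### Regions with few edges -/

/-- The region to the left of `d` is a disk whose boundary walk starts at `d`, is shorter than `k`
steps up to repetition, and has no edge on both sides. -/
def Good (Γ : SphereGraph n m) (k : ℕ) (d : Dart n) : Prop :=
  (∀ x, Γ.region x = Γ.region d → ∃ i < k, (Γ.face ^ i) d = x) ∧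
    ∀ x, Γ.region x = Γ.region d → Γ.region x.flip ≠ Γ.region d

section exists_good

variable (Γ : SphereGraph n m)

theorem face_circle {d : Dart n} (h : Γ.dir d = none) : Γ.face d = d :=
  face_eq_of_rot_eq (Γ.rot_circle d h)

theorem face_ne_flip (d : Dart n) : Γ.face d ≠ d.flip := by
  intro h
  rw [facePerm_apply, Equiv.symm_apply_eq] at h
  exact Γ.rules.rot_ne _ h.symm

/-- The vertex at the far end of `d` carries `d.flip` and both halves of the edge of `Γ.face d`. So
this edge is a loop hanging on `d`, and the walk on its other side closes up after one step. -/
theorem face_flip_eq_of_face_face {d : Dart n} (hd : Γ.dir d ≠ none)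
    (h : Γ.face (Γ.face d) = d.flip) : Γ.face (Γ.face d).flip = (Γ.face d).flip := by
  have h1 : Γ.rot (Γ.face d) = d.flip := by rw [facePerm_apply, Equiv.apply_symm_apply]
  have h2 : Γ.rot d.flip = (Γ.face d).flip := by
    rw [← h, facePerm_apply _ (Γ.face d), Equiv.apply_symm_apply]
  have h3 : Γ.dir (Γ.face d) ≠ none := fun h0 => by
    have := Γ.dir_flip _ h0
    rw [← Γ.rot_circle _ h0, h1] at this
    exact hd (by simpa using Γ.dir_flip _ this)
  refine face_eq_of_rot_eq ?_
  rw [← h2, ← h1, Γ.rot_rot_rot _ h3, h1, h2, Dart.flip_flip]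

open Classical in
/-- The weight of a dart in the count of darts that have a direction, where the darts inside empty
loops hand their weight to the outside. -/
noncomputable def weight (x : Dart n) : ℕ :=
  if Γ.dir x = none then 0 else
    (if Γ.face x = x then 0 else 1) + if Γ.face x.flip = x.flip then 1 else 0

/-- Weight only moves from a dart to its flip, and `flipPerm` matches what is given with what is
received. -/
theorem sum_weight : ∑ x, Γ.weight x = arcDarts Γ.dir := by
  classical
  have hflip : ∀ x : Dart n, Γ.dir x.flip = none ↔ Γ.dir x = none := fun x =>
    ⟨fun h => by simpa using Γ.dir_flip _ h, Γ.dir_flip x⟩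
  have h1 : ∑ x, (if Γ.dir x = none then 0 else if Γ.face x.flip = x.flip then 1 else 0) =
      ∑ x, if Γ.dir x = none then 0 else if Γ.face x = x then 1 else 0 := by
    rw [← Equiv.sum_comp (flipPerm n)]
    refine Finset.sum_congr rfl fun x _ => ?_
    change (if Γ.dir x.flip = none then 0 else if Γ.face x.flip.flip = x.flip.flip then 1 else 0) = _
    simp only [hflip, Dart.flip_flip]
  have h2 : ∀ x, Γ.weight x = (if Γ.dir x = none then 0 else if Γ.face x = x then 0 else 1) +
      if Γ.dir x = none then 0 else if Γ.face x.flip = x.flip then 1 else 0 := fun x => by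
    unfold weight
    split_ifs <;> rfl
  rw [Finset.sum_congr rfl fun x _ => h2 x, Finset.sum_add_distrib, h1, ← Finset.sum_add_distrib,
    arcDarts, Finset.card_filter]
  refine Finset.sum_congr rfl fun x _ => ?_
  by_cases h : Γ.dir x = none <;> by_cases h' : Γ.face x = x <;> simp [h, h']

-- By Euler's formula, six times the number of boundary walks plus the weight, summed over all
-- regions, is `12 * m - 12`. Some region therefore has a value below 12: it has at most one walk,
-- and if it has one, its weight is below 6.
open Classical in
theorem exists_light_region : ∃ R, (∀ x y, Γ.region x = R → Γ.region y = R →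
    Γ.face.SameCycle x y) ∧ (0 < n → ∑ x with Γ.region x = R, Γ.weight x < 6) := by
  let _ : DecidableEq (Quotient (SameCycle.setoid Γ.face)) := Classical.decEq _
  have : Fintype (Quotient (SameCycle.setoid Γ.face)) := Fintype.ofFinite _
  let reg : Quotient (SameCycle.setoid Γ.face) → Fin m :=
    Quotient.lift Γ.region fun x y h => Γ.region_eq_of_sameCycle h
  have hsum : ∑ R : Fin m, (6 * (Finset.univ.filter fun q => reg q = R).card +
      ∑ x with Γ.region x = R, Γ.weight x) < ∑ R : Fin m, 12 := by
    rw [Finset.sum_add_distrib, ← Finset.mul_sum,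
      Finset.sum_fiberwise (s := Finset.univ) (g := Γ.region), Γ.sum_weight,
      ← Finset.card_eq_sum_card_fiberwise (f := reg) (fun _ _ => Finset.mem_univ _)]
    have h1 := Γ.euler'
    rw [orbitCount, Nat.card_eq_fintype_card, ← Finset.card_univ] at h1
    simp only [Finset.sum_const, Finset.card_univ, Fintype.card_fin, smul_eq_mul] at h1 ⊢
    omega
  obtain ⟨R, -, hR⟩ := Finset.exists_lt_of_sum_lt hsum
  refine ⟨R, fun x y hx hy => ?_, fun hn => ?_⟩
  · have hle : (Finset.univ.filter fun q => reg q = R).card ≤ 1 := by omega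
    rw [Finset.card_le_one] at hle
    exact Quotient.exact (hle (Quotient.mk _ x) (by simp [reg, hx]) (Quotient.mk _ y)
      (by simp [reg, hy]))
  · obtain ⟨x, hx⟩ := Γ.region_surjective hn R
    have : 0 < (Finset.univ.filter fun q => reg q = R).card :=
      Finset.card_pos.2 ⟨Quotient.mk _ x, by simp [reg, hx]⟩
    omega

/-- The light region works. If one of its darts is a walk by itself, the region has just one side.
Otherwise each dart weighs at least 1, so there are at most five. If an edge had the region on both
sides, its two darts would cut the walk into two stretches. Neither is empty, and each weighs at
least 2, since a stretch of one dart is a loop that has inherited the weight of its inside. The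
total would be at least 6. -/
theorem exists_good (hn : 0 < n) : ∃ d, Γ.Good 5 d := by
  classical
  obtain ⟨R, hone, hlight⟩ := Γ.exists_light_region
  replace hlight := hlight hn
  obtain ⟨d, rfl⟩ := Γ.region_surjective hn R
  -- A walk of one step is the entire boundary of the region, as there is only one walk.
  have good_of_fixed : ∀ x, Γ.region x = Γ.region d → Γ.face x = x → ∃ d, Γ.Good 5 d := by
    intro x hx hfix
    have key : ∀ y, Γ.region y = Γ.region d → y = x := fun y hy => by
      have := (hone x y hx hy).eq_of_invariant (f := fun z => z = x) (fun z => by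
        apply propext
        constructor
        · intro h; exact Γ.face.injective (h.trans hfix.symm)
        · rintro rfl; exact hfix)
      simpa using this
    refine ⟨x, fun y hy => ⟨0, by simp, (key y (hy.trans hx)).symm⟩, fun y hy hy' => ?_⟩
    have h1 := key y (hy.trans hx)
    have h2 := key _ (hy'.trans hx)
    exact y.flip_ne (h2.trans h1.symm)
  by_cases hfix : ∃ x, Γ.region x = Γ.region d ∧ Γ.face x = x
  · obtain ⟨x, h1, h2⟩ := hfix
    exact good_of_fixed x h1 h2
  push Not at hfix
  set s := Finset.univ.filter fun x => Γ.region x = Γ.region d with hs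
  have mem_s : ∀ x, x ∈ s ↔ Γ.region x = Γ.region d := fun x => by simp [s]
  have hdir : ∀ x, Γ.region x = Γ.region d → Γ.dir x ≠ none := fun x hx h =>
    hfix x hx (Γ.face_circle h)
  have hw : ∀ x ∈ s, 1 ≤ Γ.weight x := fun x hx => by
    rw [mem_s] at hx
    simp [weight, hdir x hx, hfix x hx]
  have hface : ∀ x, Γ.region x = Γ.region d → Γ.region (Γ.face x) = Γ.region d := fun x hx => by
    rw [Γ.region_face_apply, hx]
  have hcard : ∀ t ⊆ s, t.card ≤ 5 := fun t ht => by
    have h1 : ∑ x ∈ t, 1 ≤ ∑ x ∈ s, Γ.weight x :=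
      (Finset.sum_le_sum fun x hx => hw x (ht hx)).trans (Finset.sum_le_sum_of_subset ht)
    simp only [Finset.sum_const, smul_eq_mul, mul_one] at h1
    omega
  have hflip : ∀ x, Γ.region x = Γ.region d → Γ.region x.flip ≠ Γ.region d := by
    intro x hx hx'
    -- A stretch of a single dart between the two sides of an edge weighs 2.
    have hout : ∀ x, Γ.region x = Γ.region d → Γ.face (Γ.face x) = x.flip →
        2 ≤ Γ.weight (Γ.face x) := fun x hx h => by
      have h1 := hface x hx
      have h2 := Γ.face_flip_eq_of_face_face (hdir x hx) h
      simp [weight, hdir _ h1, hfix _ h1, h2]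
    set y := x.flip with hy
    have hyx : y.flip = x := x.flip_flip
    have n1 : y ≠ x := x.flip_ne
    have n2 : Γ.face x ≠ x := hfix x hx
    have n3 : Γ.face y ≠ y := hfix y hx'
    have n4 : Γ.face x ≠ y := Γ.face_ne_flip x
    have n5 : Γ.face y ≠ x := hyx ▸ Γ.face_ne_flip y
    have n6 : Γ.face x ≠ Γ.face y := fun h => n1 (Γ.face.injective h).symm
    have r1 := hface x hx
    have r2 := hface y hx'
    have r3 := hface _ r1
    have r4 := hface _ r2
    have sum_le : ∀ t ⊆ s, ∑ z ∈ t, Γ.weight z < 6 := fun t ht =>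
      (Finset.sum_le_sum_of_subset ht).trans_lt hlight
    have n7 : Γ.face (Γ.face x) ≠ Γ.face x := fun h => n2 (Γ.face.injective h)
    have n8 : Γ.face (Γ.face y) ≠ Γ.face y := fun h => n3 (Γ.face.injective h)
    have n9 : Γ.face (Γ.face x) ≠ Γ.face y := fun h => n4 (Γ.face.injective h)
    have n10 : Γ.face (Γ.face y) ≠ Γ.face x := fun h => n5 (Γ.face.injective h)
    have n11 : Γ.face (Γ.face x) ≠ Γ.face (Γ.face y) := fun h => n6 (Γ.face.injective h)
    have w1 := hw x ((mem_s x).2 hx)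
    have w2 := hw y ((mem_s y).2 hx')
    have w3 := hw _ ((mem_s _).2 r1)
    have w4 := hw _ ((mem_s _).2 r2)
    have w5 := hw _ ((mem_s _).2 r3)
    have w6 := hw _ ((mem_s _).2 r4)
    -- Four cases, according to which of the two stretches between `x` and `y` consist of a single
    -- dart. Each case exhibits distinct darts of total weight at least 6.
    by_cases c1 : Γ.face (Γ.face x) = y
    · have v1 := hout x hx c1
      by_cases c2 : Γ.face (Γ.face y) = x
      · have v2 := hout y hx' (c2.trans hyx.symm)
        have := sum_le {x, y, Γ.face x, Γ.face y} (by
          intro z hz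
          simp only [Finset.mem_insert, Finset.mem_singleton] at hz
          rcases hz with rfl | rfl | rfl | rfl <;> rwa [mem_s])
        rw [Finset.sum_insert (by simp [n1.symm, n2.symm, n5.symm]),
          Finset.sum_insert (by simp [n4.symm, n3.symm]), Finset.sum_pair n6] at this
        omega
      · have n12 : Γ.face (Γ.face y) ≠ y := fun h =>
          n6 (Γ.face.injective (c1.trans h.symm))
        have := sum_le {x, y, Γ.face x, Γ.face y, Γ.face (Γ.face y)} (by
          intro z hz
          simp only [Finset.mem_insert, Finset.mem_singleton] at hz
          rcases hz with rfl | rfl | rfl | rfl | rfl <;> rwa [mem_s])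
        rw [Finset.sum_insert (by simp [n1.symm, n2.symm, n5.symm, Ne.symm c2]),
          Finset.sum_insert (by simp [n4.symm, n3.symm, n12.symm]),
          Finset.sum_insert (by simp [n6, n10.symm]), Finset.sum_pair n8.symm] at this
        omega
    · by_cases c2 : Γ.face (Γ.face y) = x
      · have v2 := hout y hx' (c2.trans hyx.symm)
        have n12 : Γ.face (Γ.face x) ≠ x := fun h =>
          n6 (Γ.face.injective (h.trans c2.symm))
        have := sum_le {x, y, Γ.face x, Γ.face y, Γ.face (Γ.face x)} (by
          intro z hz
          simp only [Finset.mem_insert, Finset.mem_singleton] at hz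
          rcases hz with rfl | rfl | rfl | rfl | rfl <;> rwa [mem_s])
        rw [Finset.sum_insert (by simp [n1.symm, n2.symm, n5.symm, n12.symm]),
          Finset.sum_insert (by simp [n4.symm, n3.symm, Ne.symm c1]),
          Finset.sum_insert (by simp [n6, n7.symm]), Finset.sum_pair n9.symm] at this
        omega
      -- A walk that closes up after two steps from `x` would miss `y`, although both lie on the
      -- same walk.
      · have n12 : Γ.face (Γ.face x) ≠ x := fun h => by
          have := (hone x y hx hx').eq_of_invariant (f := fun z => z = x ∨ z = Γ.face x)
            (fun z => by
              apply propext
              constructor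
              · rintro (h' | h')
                · exact .inr (Γ.face.injective (h'.trans h.symm))
                · exact .inl (Γ.face.injective h')
              · rintro (rfl | rfl)
                · exact .inr rfl
                · exact .inl h)
          simp only [true_or, eq_iff_iff, true_iff] at this
          rcases this with h' | h'
          · exact n1 h'
          · exact n4 h'.symm
        have n13 : Γ.face (Γ.face y) ≠ y := fun h => by
          have := (hone y x hx' hx).eq_of_invariant (f := fun z => z = y ∨ z = Γ.face y)
            (fun z => by
              apply propext
              constructor
              · rintro (h' | h')
                · exact .inr (Γ.face.injective (h'.trans h.symm))
                · exact .inl (Γ.face.injective h')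
              · rintro (rfl | rfl)
                · exact .inr rfl
                · exact .inl h)
          simp only [true_or, eq_iff_iff, true_iff] at this
          rcases this with h' | h'
          · exact n1 h'.symm
          · exact n5 h'.symm
        have := hcard {x, y, Γ.face x, Γ.face y, Γ.face (Γ.face x), Γ.face (Γ.face y)} (by
          intro z hz
          simp only [Finset.mem_insert, Finset.mem_singleton] at hz
          rcases hz with rfl | rfl | rfl | rfl | rfl | rfl <;> rwa [mem_s])
        rw [Finset.card_insert_of_notMem (by simp [n1.symm, n2.symm, n5.symm, n12.symm, Ne.symm c2]),
          Finset.card_insert_of_notMem (by simp [n4.symm, n3.symm, Ne.symm c1, n13.symm]),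
          Finset.card_insert_of_notMem (by simp [n6, n7.symm, n10.symm]),
          Finset.card_insert_of_notMem (by simp [n9.symm, n8.symm]), Finset.card_pair n11] at this
        omega
  refine ⟨d, fun x hx => ?_, hflip⟩
  -- The number of steps needed is less than the length of the cycle, whose darts all lie in the
  -- region and so number at most five.
  obtain ⟨i, hi, hix⟩ := (hone d x rfl hx).exists_pow_eq_of_mem_support
    (mem_support.2 (hfix d rfl))
  refine ⟨i, hi.trans_le (hcard _ fun y hy => ?_), hix⟩
  rw [mem_support_cycleOf_iff] at hy
  rw [mem_s]
  exact (Γ.region_eq_of_sameCycle hy.1).symm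

end exists_good

end SphereGraph

open Equiv.Perm

/-! ## Tables -/

open TrivalentGraph (dartNumber directionNumber dartNumber_injective)

/-- Three lists that give for each dart, by its number, the next dart around the vertex, the
direction, and the region. -/
abbrev Tables : Type := List ℕ × List ℕ × List ℕ

namespace Tables

def rot (T : Tables) (i : ℕ) : ℕ := T.1.getD i 0
def dir (T : Tables) (i : ℕ) : ℕ := T.2.1.getD i 0
def region (T : Tables) (i : ℕ) : ℕ := T.2.2.getD i 0
def size (T : Tables) : ℕ := T.1.length

def build (N : ℕ) (f g h : ℕ → ℕ) : Tables :=
  ((List.range N).map f, (List.range N).map g, (List.range N).map h)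

/-- The number of the initial half of the same edge. -/
def initial (i : ℕ) : ℕ := i - i % 2

def flip (i : ℕ) : ℕ := if i % 2 = 0 then i + 1 else i - 1

def swap (i j k : ℕ) : ℕ := if k = i then j else if k = j then i else k

/-- At a trivalent vertex the inverse of the rotation is its square, so no inverse table is needed.
A dart of a circle is a walk by itself. -/
def face (T : Tables) (i : ℕ) : ℕ := if dir T i = 0 then i else rot T (rot T (flip i))

def reverse (T : Tables) (i : ℕ) : Tables :=
  build (size T) (fun k => swap i (i + 1) (rot T (swap i (i + 1) k)))
    (fun k => dir T (swap i (i + 1) k)) fun k => region T (swap i (i + 1) k)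

/-- The directions are numbered from `1` to `6`, and `0` means that there is none. -/
def nextDirection (y : ℕ) : ℕ := if y = 6 then 1 else y + 1

def spiral (T : Tables) (v : ℕ) : Tables :=
  build (size T) (fun k => rot T k)
    (fun k => if k = v ∨ k = rot T v ∨ k = rot T (rot T v) then nextDirection (dir T k) else dir T k)
    fun k => region T k

def shift (a b c e k : ℕ) : ℕ := swap b c (swap c e (swap e a k))
def shiftBack (a b c e k : ℕ) : ℕ := swap e a (swap c e (swap b c k))

def fMove (T : Tables) (a b c e : ℕ) : Tables :=
  build (size T)
    (fun k => shift (a + 1) (b + 1) (c + 1) (e + 1)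
      (rot T (shiftBack (a + 1) (b + 1) (c + 1) (e + 1) k)))
    (fun k => dir T (shiftBack (a + 1) (b + 1) (c + 1) (e + 1) k))
    fun k => if k = e then region T c else if k = e + 1 then region T a else region T k

/-- The darts of all edges except three. -/
def keep (T : Tables) (k l b : ℕ) : List ℕ :=
  ((List.range (size T)).filter fun i => i % 2 = 0 ∧ i ≠ k ∧ i ≠ l ∧ i ≠ b).flatMap
    fun i => [i, i + 1]

def position (K : List ℕ) (v : ℕ) : ℕ :=
  ((List.range K.length).filter fun i => K.getD i 0 = v).headD 0

/-- Keep only the listed darts, with the roles of `p` and `q` exchanged, drop the region `R`, and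
make the edge `z` a circle. -/
def restrict (T : Tables) (K : List ℕ) (p q z R : ℕ) : Tables :=
  build K.length
    (fun i => position K (swap p q (if initial (swap p q (K.getD i 0)) = z
      then flip (swap p q (K.getD i 0)) else rot T (swap p q (K.getD i 0)))))
    (fun i => if initial (swap p q (K.getD i 0)) = z then 0 else dir T (swap p q (K.getD i 0)))
    fun i => if R < region T (swap p q (K.getD i 0)) then region T (swap p q (K.getD i 0)) - 1
      else region T (swap p q (K.getD i 0))

/-- The exchange is trivial, and `size T` is not the number of any dart, so no edge is turned into a
circle. -/
def removeCircle (T : Tables) (c : ℕ) : Tables :=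
  restrict T (keep T c c c) 0 0 (size T) (region T c)

/-- If `a = b`, the edge itself must stay and become a circle, so the third excluded edge is a mere
repetition of `k`. Otherwise `b` is dropped and its terminal half takes the place of that of `a`,
while `size T` ensures that no circle is made. -/
def splice (T : Tables) (a b k l R : ℕ) : Tables :=
  restrict T (keep T k l (if a = b then k else b)) (a + 1) (b + 1) (if a = b then a else size T)
    (region T R)

/-- The tables describe the graph. -/
structure Describes {n m : ℕ} (T : Tables) (Γ : SphereGraph n m) : Prop where
  length_rot : T.1.length = 2 * n
  length_dir : T.2.1.length = 2 * n
  length_region : T.2.2.length = 2 * n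
  rot_eq : ∀ x, rot T (dartNumber x) = dartNumber (Γ.rot x)
  dir_eq : ∀ x, dir T (dartNumber x) = directionNumber (Γ.dir x)
  region_eq : ∀ x, region T (dartNumber x) = (Γ.region x).val

section numbers

variable {n : ℕ}

theorem dartNumber_lt (x : Dart n) : dartNumber x < 2 * n := by
  obtain ⟨⟨i, hi⟩, _ | _⟩ := x <;> simp [dartNumber] <;> omega

theorem exists_dartNumber {i : ℕ} (h : i < 2 * n) : ∃ x : Dart n, dartNumber x = i := by
  refine ⟨(⟨i / 2, by omega⟩, decide (i % 2 = 1)), ?_⟩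
  rcases Nat.mod_two_eq_zero_or_one i with h | h <;> simp [dartNumber, h] <;> omega

theorem dartNumber_inj {x y : Dart n} : dartNumber x = dartNumber y ↔ x = y :=
  dartNumber_injective.eq_iff

theorem dartNumber_mod (x : Dart n) : dartNumber x % 2 = x.2.toNat := by
  obtain ⟨i, _ | _⟩ := x <;> simp [dartNumber]

theorem initial_dartNumber (x : Dart n) : initial (dartNumber x) = dartNumber (x.1, false) := by
  obtain ⟨i, _ | _⟩ := x <;> simp [dartNumber, initial]

theorem dartNumber_true (i : Fin n) : dartNumber (i, true) = dartNumber (i, false) + 1 := by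
  simp [dartNumber]

theorem flip_dartNumber (x : Dart n) : flip (dartNumber x) = dartNumber x.flip := by
  obtain ⟨i, _ | _⟩ := x <;> simp [dartNumber, flip, Nat.add_mod]

theorem swap_dartNumber (x y z : Dart n) :
    swap (dartNumber x) (dartNumber y) (dartNumber z) = dartNumber (Equiv.swap x y z) := by
  simp only [swap, dartNumber_inj, Equiv.swap_apply_def]
  split_ifs <;> rfl

theorem directionNumber_eq_zero {y : Option Direction} : directionNumber y = 0 ↔ y = none := by
  cases y <;> simp [directionNumber]

theorem nextDirection_directionNumber (y : Direction) :
    nextDirection (directionNumber (some y)) = directionNumber (some (y + 1)) := by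
  revert y; decide

theorem mem_filter_headD {N : ℕ} {p : ℕ → Prop} [DecidablePred p] (h : ∃ i < N, p i) :
    ((List.range N).filter fun i => p i).headD 0 < N ∧
      p (((List.range N).filter fun i => p i).headD 0) := by
  obtain ⟨i, hi, hp⟩ := h
  have hmem : i ∈ (List.range N).filter fun i => p i := by simp [hi, hp]
  rcases hl : (List.range N).filter fun i => p i with _ | ⟨j, l⟩
  · simp [hl] at hmem
  · have : j ∈ (List.range N).filter fun i => p i := by rw [hl]; simp
    simpa using this

theorem filter_even_range (n : ℕ) (p : ℕ → Prop) [DecidablePred p] :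
    ((List.range (2 * n)).filter fun i => i % 2 = 0 ∧ p i) =
      ((List.finRange n).filter fun i => p (2 * i.val)).map fun i => 2 * i.val := by
  have h : ((List.range (2 * n)).filter fun i => i % 2 = 0) = (List.range n).map (2 * ·) := by
    induction n with
    | zero => rfl
    | succ n ih =>
      rw [show 2 * (n + 1) = 2 * n + 1 + 1 by ring, List.range_succ, List.range_succ,
        List.filter_append, List.filter_append, ih, List.range_succ]
      simp [Nat.add_mod]
  have h2 : ((List.range (2 * n)).filter fun i => i % 2 = 0 ∧ p i) =
      ((List.range (2 * n)).filter fun i => i % 2 = 0).filter fun i => p i := by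
    rw [List.filter_filter]
    simp [Bool.and_comm]
  rw [h2, h, ← List.map_coe_finRange_eq_range, List.map_map, List.filter_map]
  rfl

theorem getD_flatMap_pair {α : Type} (l : List α) (f : α → Bool → ℕ) (j : Fin l.length) (b : Bool) :
    (l.flatMap fun i => [f i false, f i true]).getD (2 * j.val + b.toNat) 0 = f (l.get j) b := by
  induction l with
  | nil => exact j.elim0
  | cons a l ih =>
    obtain ⟨_ | j, hj⟩ := j
    · cases b <;> simp
    · have := ih ⟨j, by simpa using hj⟩
      simp only [List.flatMap_cons]
      rw [show 2 * (⟨j + 1, hj⟩ : Fin (a :: l).length).val + b.toNat = 2 * j + b.toNat + 1 + 1 by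
        simp; ring]
      simpa using this

theorem length_flatMap_pair {α : Type} (l : List α) (f : α → Bool → ℕ) :
    (l.flatMap fun i => [f i false, f i true]).length = 2 * l.length := by
  induction l with
  | nil => rfl
  | cons a l ih => simp [List.flatMap_cons] at ih ⊢; omega

theorem position_eq {K : List ℕ} {i : ℕ} (hi : i < K.length) (h : ∀ j < K.length,
    K.getD j 0 = K.getD i 0 → j = i) : position K (K.getD i 0) = i := by
  obtain ⟨h1, h2⟩ := mem_filter_headD (N := K.length) (p := fun j => K.getD j 0 = K.getD i 0)
    ⟨i, hi, rfl⟩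
  exact h _ h1 h2

end numbers

namespace Describes

variable {n m n' m' : ℕ} {T : Tables} {Γ : SphereGraph n m}

theorem size_eq (h : Describes T Γ) : size T = 2 * n := h.length_rot

theorem of_build {N : ℕ} {f g r : ℕ → ℕ} (hN : N = 2 * n)
    (hf : ∀ x, f (dartNumber x) = dartNumber (Γ.rot x))
    (hg : ∀ x, g (dartNumber x) = directionNumber (Γ.dir x))
    (hr : ∀ x, r (dartNumber x) = (Γ.region x).val) : Describes (build N f g r) Γ := by
  have key : ∀ (f : ℕ → ℕ) (x : Dart n), ((List.range N).map f).getD (dartNumber x) 0 =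
      f (dartNumber x) := fun f x => by
    have := dartNumber_lt x
    simp [List.getD_eq_getElem?_getD, hN, this]
  exact ⟨by simp [build, hN], by simp [build, hN], by simp [build, hN],
    fun x => (key f x).trans (hf x), fun x => (key g x).trans (hg x),
    fun x => (key r x).trans (hr x)⟩

theorem face_eq (h : Describes T Γ) (x : Dart n) :
    face T (dartNumber x) = dartNumber (Γ.face x) := by
  simp only [face, h.dir_eq, directionNumber_eq_zero, flip_dartNumber, h.rot_eq]
  split_ifs with hx
  · rw [Γ.face_circle hx]
  · have : Γ.dir x.flip ≠ none := fun h0 => hx (by simpa using Γ.dir_flip _ h0)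
    congr 1
    rw [facePerm_apply, Equiv.eq_symm_apply, Γ.rot_rot_rot _ this]

theorem reverse (h : Describes T Γ) {Γ' : SphereGraph n m} {e : Fin n}
    (hΓ : SphereGraph.EdgeReversal e Γ Γ') :
    Describes (Tables.reverse T (dartNumber (e, false))) Γ' := by
  have hs : ∀ x : Dart n, swap (dartNumber (e, false)) (dartNumber (e, false) + 1) (dartNumber x) =
      dartNumber (Equiv.swap (e, false) (e, true) x) := fun x => by
    rw [← dartNumber_true, swap_dartNumber]
  have hΓ' : ∀ x, Γ'.rot x = Equiv.swap (e, false) (e, true) (Γ.rot (Equiv.swap (e, false) (e, true) x)) ∧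
      Γ'.dir x = Γ.dir (Equiv.swap (e, false) (e, true) x) ∧
      Γ'.region x = Γ.region (Equiv.swap (e, false) (e, true) x) := fun x => by
    simpa using hΓ (Equiv.swap (e, false) (e, true) x)
  refine of_build h.size_eq (fun x => ?_) (fun x => ?_) fun x => ?_
  · rw [hs, h.rot_eq, hs, (hΓ' x).1]
  · rw [hs, h.dir_eq, (hΓ' x).2.1]
  · rw [hs, h.region_eq, (hΓ' x).2.2]

theorem sameCycle_iff {v : Dart n} (hv : Γ.dir v ≠ none) (x : Dart n) :
    Γ.rot.SameCycle v x ↔ x = v ∨ x = Γ.rot v ∨ x = Γ.rot (Γ.rot v) := by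
  constructor
  · intro hx
    have h3 := Γ.rot_rot_rot v hv
    have := hx.eq_of_invariant (f := fun z => z = v ∨ z = Γ.rot v ∨ z = Γ.rot (Γ.rot v))
      (fun z => by
        apply propext
        constructor
        · rintro (hz | hz | hz)
          · right; right; apply Γ.rot.injective; rw [hz, h3]
          · left; exact Γ.rot.injective hz
          · right; left; exact Γ.rot.injective hz
        · rintro (rfl | rfl | rfl)
          · exact .inr (.inl rfl)
          · exact .inr (.inr rfl)
          · exact .inl h3)
    simpa using this
  · rintro (rfl | rfl | rfl)
    · exact .refl _ _
    · exact SameCycle.rfl.apply_right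
    · exact SameCycle.rfl.apply_right.apply_right

theorem spiral (h : Describes T Γ) {v : Dart n} (hv : Γ.dir v ≠ none) :
    Describes (Tables.spiral T (dartNumber v)) (Γ.spiral v) := by
  refine of_build h.size_eq (fun x => h.rot_eq x) (fun x => ?_) fun x => h.region_eq x
  simp only [h.rot_eq, dartNumber_inj, ← sameCycle_iff hv, h.dir_eq]
  have hdir : (Γ.spiral v).dir x = if Γ.rot.SameCycle v x then (Γ.dir x).map (· + 1) else Γ.dir x :=
    rfl
  rw [hdir]
  split_ifs with hx
  · rcases hy : Γ.dir x with _ | y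
    · rw [sameCycle_iff hv] at hx
      have h1 := Γ.rules.dir_rot_ne hv
      have h2 := Γ.rules.dir_rot_ne h1
      rcases hx with rfl | rfl | rfl <;> contradiction
    · exact nextDirection_directionNumber y
  · rfl

theorem fMove (h : Describes T Γ) {Γ' : SphereGraph n m} {a b c e : Fin n}
    (hrot : ∀ x, Γ'.rot x = SphereGraph.shift (a, true) (b, true) (c, true) (e, true)
      (Γ.rot ((SphereGraph.shift (a, true) (b, true) (c, true) (e, true)).symm x)))
    (hdir : ∀ x, Γ'.dir x =
      Γ.dir ((SphereGraph.shift (a, true) (b, true) (c, true) (e, true)).symm x))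
    (hregion : ∀ x, Γ'.region x = if x = (e, false) then Γ.region (c, false) else
      if x = (e, true) then Γ.region (a, false) else Γ.region x) :
    Describes (Tables.fMove T (dartNumber (a, false)) (dartNumber (b, false))
      (dartNumber (c, false)) (dartNumber (e, false))) Γ' := by
  have h1 : ∀ x : Dart n, shift (dartNumber (a, true)) (dartNumber (b, true)) (dartNumber (c, true))
      (dartNumber (e, true)) (dartNumber x) =
      dartNumber (SphereGraph.shift (a, true) (b, true) (c, true) (e, true) x) := fun x => by
    simp only [shift, swap_dartNumber]
    rfl
  have h2 : ∀ x : Dart n, shiftBack (dartNumber (a, true)) (dartNumber (b, true))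
      (dartNumber (c, true)) (dartNumber (e, true)) (dartNumber x) =
      dartNumber ((SphereGraph.shift (a, true) (b, true) (c, true) (e, true)).symm x) := fun x => by
    simp only [shiftBack, swap_dartNumber]
    rfl
  refine of_build h.size_eq (fun x => ?_) (fun x => ?_) fun x => ?_
  · simp only [← dartNumber_true]
    rw [h2, h.rot_eq, h1, hrot]
  · simp only [← dartNumber_true]
    rw [h2, h.dir_eq, hdir]
  · simp only [← dartNumber_true, dartNumber_inj, h.region_eq, hregion]
    split_ifs <;> rfl

theorem exists_keep (h : Describes T Γ) (k l b : Fin n) :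
    ∃ (n' : ℕ) (e : Fin n' → Fin n), n' ≤ n ∧ Function.Injective e ∧
      (∀ x, x ∈ Set.range e ↔ x ≠ k ∧ x ≠ l ∧ x ≠ b) ∧
      (keep T (dartNumber (k, false)) (dartNumber (l, false)) (dartNumber (b, false))).length =
        2 * n' ∧ ∀ x : Dart n',
      (keep T (dartNumber (k, false)) (dartNumber (l, false)) (dartNumber (b, false))).getD
        (dartNumber x) 0 = dartNumber (e x.1, x.2) := by
  set ks := (List.finRange n).filter fun i => i ≠ k ∧ i ≠ l ∧ i ≠ b with hks
  have hK : keep T (dartNumber (k, false)) (dartNumber (l, false)) (dartNumber (b, false)) =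
      ks.flatMap fun i => [dartNumber (i, false), dartNumber (i, true)] := by
    rw [keep, h.size_eq, filter_even_range, List.flatMap_map, hks]
    simp [dartNumber, Fin.ext_iff]
  have hnodup : ks.Nodup := (List.nodup_finRange n).filter _
  refine ⟨ks.length, ks.get, ?_, List.nodup_iff_injective_get.1 hnodup, fun x => ?_, ?_,
    fun x => ?_⟩
  · exact (List.length_filter_le _ _).trans_eq (List.length_finRange)
  · rw [Set.range_list_get]
    simp [ks]
  · rw [hK, length_flatMap_pair ks fun i b => dartNumber (i, b)]
  · rw [hK]
    exact getD_flatMap_pair ks (fun i b => dartNumber (i, b)) x.1 x.2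

theorem restrict {Γ : SphereGraph n (m + 1)} (h : Describes T Γ) {Γ' : SphereGraph n' m}
    {K : List ℕ} (hK : K.length = 2 * n') {p q z : ℕ} {R : Fin (m + 1)} {ι : Dart n' → Dart n}
    (hinj : Function.Injective ι) (hι : ∀ x, swap p q (K.getD (dartNumber x) 0) = dartNumber (ι x))
    (hrot : ∀ x, (if initial (dartNumber (ι x)) = z then flip (dartNumber (ι x))
      else rot T (dartNumber (ι x))) = dartNumber (ι (Γ'.rot x)))
    (hdir : ∀ x, (if initial (dartNumber (ι x)) = z then 0 else dir T (dartNumber (ι x))) =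
      directionNumber (Γ'.dir x))
    (hregion : ∀ x, Γ.region (ι x) = R.succAbove (Γ'.region x)) :
    Describes (Tables.restrict T K p q z R.val) Γ' := by
  have swap_swap : ∀ k, swap p q (swap p q k) = k := fun k => by
    simp only [swap]
    split_ifs <;> simp_all
  have hι' : ∀ x, swap p q (dartNumber (ι x)) = K.getD (dartNumber x) 0 := fun x => by
    rw [← hι, swap_swap]
  have hpos : ∀ x, position K (K.getD (dartNumber x) 0) = dartNumber x := fun x => by
    refine position_eq (hK ▸ dartNumber_lt x) fun j hj hjx => ?_
    obtain ⟨y, rfl⟩ := exists_dartNumber (hK ▸ hj)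
    have := congrArg (swap p q) hjx
    rw [hι, hι, dartNumber_inj] at this
    rw [hinj this]
  refine of_build hK (fun x => ?_) (fun x => ?_) fun x => ?_
  · simp only [hι, hrot, hι', hpos]
  · simp only [hι, hdir]
  · simp only [hι, h.region_eq, hregion]
    -- Lowering the region numbers above `R` by one inverts `R.succAbove`.
    rcases lt_or_ge (Γ'.region x).castSucc R with hlt | hge
    · rw [Fin.succAbove_of_castSucc_lt _ _ hlt]
      rw [Fin.lt_def, Fin.val_castSucc] at hlt
      rw [Fin.val_castSucc, if_neg (by omega)]
    · rw [Fin.succAbove_of_le_castSucc _ _ hge]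
      rw [Fin.le_def, Fin.val_castSucc] at hge
      rw [Fin.val_succ, if_pos (by omega)]
      rfl

theorem exists_removeCircle {Γ : SphereGraph n (m + 1)} (h : Describes T Γ) {c : Fin n}
    (hc : Γ.dir (c, false) = none) (hR : ∀ x, Γ.region x = Γ.region (c, false) ↔ x = (c, false)) :
    ∃ (n' : ℕ) (Γ' : SphereGraph n' m), n' ≤ n ∧ SphereGraph.CircleRemoval Γ Γ' ∧
      Describes (removeCircle T (dartNumber (c, false))) Γ' := by
  obtain ⟨n', e, hn, he, hrange, hlen, hget⟩ := h.exists_keep c c c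
  obtain ⟨Γ', h1, h2⟩ := Γ.exists_circleRemoval hc hR he (by
    ext x
    rw [hrange]
    simp)
  refine ⟨n', Γ', hn, h1, ?_⟩
  have hz : ∀ x : Dart n, initial (dartNumber x) ≠ size T := fun x => by
    rw [initial_dartNumber, h.size_eq]
    exact (dartNumber_lt _).ne
  rw [removeCircle, h.region_eq]
  refine h.restrict hlen (ι := fun x => (e x.1, x.2)) (fun x y hxy =>
    Prod.ext (he (congrArg Prod.fst hxy :)) (congrArg Prod.snd hxy :)) (fun x => ?_) (fun x => ?_)
    (fun x => ?_) fun x => (h2 x).2.2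
  · rw [hget]
    simp only [swap]
    split_ifs with h0
    · exact h0.symm
    · rfl
  · rw [if_neg (hz _), h.rot_eq, (h2 x).1]
  · rw [if_neg (hz _), h.dir_eq, (h2 x).2.1]

/-- The list of kept edges provides `e` first; the new graph is then built from this very `e`. Hence
the last clause speaks of any graph `Γ'` that satisfies the equations of `exists_splice`. -/
theorem spliced {Γ : SphereGraph n (m + 1)} (h : Describes T Γ) {a b k l : Fin n} {R : Dart n} :
    ∃ (n' : ℕ) (e : Fin n' → Fin n), n' ≤ n ∧ Function.Injective e ∧
      (∀ x, x ∈ Set.range e ↔ x ≠ k ∧ x ≠ l ∧ (a ≠ b → x ≠ b)) ∧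
      ∀ Γ' : SphereGraph n' m,
        (∀ x, Γ.region (SphereGraph.spliceDart a b e x) =
          (Γ.region R).succAbove (Γ'.region x)) →
        (∀ x, if a = b ∧ (SphereGraph.spliceDart a b e x).1 = a then Γ'.dir x = none
          else Γ.rot (SphereGraph.spliceDart a b e x) = SphereGraph.spliceDart a b e (Γ'.rot x) ∧
            Γ.dir (SphereGraph.spliceDart a b e x) = Γ'.dir x) →
        Describes (Tables.splice T (dartNumber (a, false)) (dartNumber (b, false))
          (dartNumber (k, false)) (dartNumber (l, false)) (dartNumber R)) Γ' := by
  obtain ⟨n', e, hn, he, hrange, hlen, hget⟩ := h.exists_keep k l (if a = b then k else b)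
  refine ⟨n', e, hn, he, fun x => ?_, fun Γ' h1 h2 => ?_⟩
  · rw [hrange]
    split_ifs with hab
    · simp [hab]; tauto
    · simp [hab]
  have hab' : (dartNumber ((a, false) : Dart n) = dartNumber ((b, false) : Dart n)) ↔ a = b := by
    rw [dartNumber_inj]; simp
  have hk : (if dartNumber ((a, false) : Dart n) = dartNumber ((b, false) : Dart n)
      then dartNumber ((k, false) : Dart n) else dartNumber ((b, false) : Dart n)) =
      dartNumber (((if a = b then k else b), false) : Dart n) := by
    simp only [hab']
    split_ifs <;> rfl
  rw [Tables.splice, hk, h.region_eq, ← dartNumber_true, ← dartNumber_true]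
  have hz : ∀ x : Dart n, initial (dartNumber x) = (if dartNumber ((a, false) : Dart n) =
      dartNumber ((b, false) : Dart n) then dartNumber ((a, false) : Dart n) else size T) ↔
      a = b ∧ x.1 = a := fun x => by
    rw [initial_dartNumber, h.size_eq]
    simp only [hab']
    split_ifs with hab
    · rw [dartNumber_inj]; simp [hab]
    · simp [hab, (dartNumber_lt ((x.1, false) : Dart n)).ne]
  have hinj : Function.Injective (SphereGraph.spliceDart a b e) := fun x y hxy => by
    have := (Equiv.swap (a, true) (b, true)).injective hxy
    exact Prod.ext (he (congrArg Prod.fst this :)) (congrArg Prod.snd this :)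
  refine h.restrict hlen hinj (fun x => ?_) (fun x => ?_) (fun x => ?_) h1
  · rw [hget, swap_dartNumber]; rfl
  · have := h2 x
    simp only [hz]
    split_ifs with hc
    · rw [if_pos hc] at this
      rw [Γ'.rot_circle _ this, flip_dartNumber]
      congr 1
      obtain ⟨rfl, -⟩ := hc
      simp [SphereGraph.spliceDart, Dart.flip]
    · rw [if_neg hc] at this
      rw [h.rot_eq, this.1]
  · have := h2 x
    simp only [hz]
    split_ifs with hc
    · rw [if_pos hc] at this
      rw [this]; rfl
    · rw [if_neg hc] at this
      rw [h.dir_eq, this.2]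

end Describes

end Tables

/-! ### The journal of moves, and bringing edges and vertices into position. -/

open Equiv.Perm

open TrivalentGraph (dartNumber directionNumber dartNumber_injective)

namespace TrivalentGraph

/-- One step of the sequence that is to be constructed. -/
def Move (Δ Δ' : TrivalentGraph) : Prop :=
  (Rearrangement Δ Δ' ∧ Δ'.regions = Δ.regions) ∨ (Removal Δ Δ' ∧ Δ'.regions + 1 = Δ.regions)

end TrivalentGraph

/-- The tables of the current graph, and of the earlier graphs, the latest one first. -/
abbrev Journal : Type := Tables × List Tables

namespace Journal

open Tables (initial)

def push (s : Journal) (T : Tables) : Journal := (T, s.1 :: s.2)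

/-- The journal records a sequence of moves from one graph to another. -/
inductive Records (Γ₀ : TrivalentGraph) : Journal → TrivalentGraph → Prop
  | start {T : Tables} : T.Describes Γ₀.graph → Records Γ₀ (T, []) Γ₀
  | step {s : Journal} {Δ Δ' : TrivalentGraph} {T : Tables} : Records Γ₀ s Δ → Δ.Move Δ' →
      Δ'.edges ≤ Δ.edges → T.Describes Δ'.graph → Records Γ₀ (s.push T) Δ'

/-- `w` is the parity wanted for the number of the dart: `0` makes it an initial half and `1` a
terminal half. -/
def orient (s : Journal) (x w : ℕ) : Journal :=
  if x % 2 = w then s else push s (Tables.reverse s.1 (initial x))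

def turnStep (v t : ℕ) (s : Journal) : Journal :=
  if Tables.dir s.1 v = t then s else push s (Tables.spiral s.1 v)

/-- There are six directions, so five notches counterclockwise reach any of them. -/
def turnTo (s : Journal) (v t : ℕ) : Journal :=
  turnStep v t (turnStep v t (turnStep v t (turnStep v t (turnStep v t s))))

def circleStep (s : Journal) (d : ℕ) : Journal :=
  push (orient s d 0) (Tables.removeCircle (orient s d 0).1 (initial d))

/-- Orient two edges, which may be the same. -/
def orientEnds (s : Journal) (z w z' w' : ℕ) : Journal :=
  if w = Tables.flip z then orient s z z' else orient (orient s z z') w w'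

def pushSplice (s : Journal) (a b k l R : ℕ) : Journal :=
  push s (Tables.splice s.1 (initial a) (initial b) (initial k) (initial l) R)

/-- The last arguments of `turnTo` are numbers of directions: here `5` is down and `2` is up; in
`moveEdge` the number `3` is up-left. The region dropped is the one to the left of the terminal half
of `p`. -/
def trimTadpole (s : Journal) (p t a b : ℕ) : Journal :=
  pushSplice (turnTo (turnTo (orientEnds (orient (orient s p 1) t 0) a b 1 0) (initial t) 5) (initial t + 1) 2)
    a b p t (initial p + 1)

def tadpoleStep (s : Journal) (d : ℕ) : Journal :=
  trimTadpole s d (Tables.rot s.1 (Tables.flip d))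
    (Tables.rot s.1 (Tables.flip (Tables.rot s.1 (Tables.flip d))))
    (Tables.rot s.1 (Tables.rot s.1 (Tables.flip (Tables.rot s.1 (Tables.flip d)))))

def popBubble (s : Journal) (l r t b : ℕ) : Journal :=
  pushSplice (turnTo (turnTo (orientEnds (orient (orient s l 0) r 0) t b 1 0) (initial t + 1) 2) (initial b) 5)
    t b l r (initial l)

def bubbleStep (s : Journal) (d : ℕ) : Journal :=
  popBubble s d (Tables.rot s.1 d) (Tables.rot s.1 (Tables.rot s.1 d))
    (Tables.rot s.1 (Tables.flip d))

def pushFMove (s : Journal) (a b c e : ℕ) : Journal :=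
  push s (Tables.fMove s.1 (initial a) (initial b) (initial c) (initial e))

def moveEdge (s : Journal) (e b a c d : ℕ) : Journal :=
  pushFMove (turnTo (turnTo (orientEnds (orient (orient (orient s e 0) b 1) c 1) a d 1 0)
    (initial e) 5) (initial e + 1) 3) a b c e

/-- On the walk along the region to the left of `d`, the edge of `Tables.rot s.1 d` comes just
before `d` and the fourth dart passed to `moveEdge` comes just after. These two become neighbours
when `d` leaves the boundary. -/
def fStep (s : Journal) (d : ℕ) : Journal :=
  moveEdge s d (Tables.rot s.1 d) (Tables.rot s.1 (Tables.rot s.1 d))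
    (Tables.rot s.1 (Tables.rot s.1 (Tables.flip d))) (Tables.rot s.1 (Tables.flip d))

end Journal

namespace SphereGraph

variable {n m : ℕ} {Γ : SphereGraph n m}

/-- The rotation adds 2 to directions, so one direction at a vertex determines the other two. -/
theorem isY_of_rot {x y z : Dart n} (hz : Γ.dir z = some Direction.down) (h1 : Γ.rot z = y)
    (h2 : Γ.rot y = x) (h3 : Γ.rot x = z) : Γ.IsY x y z := by
  have hy := Γ.dir_rot _ _ hz
  have hx := Γ.dir_rot _ _ hy
  rw [h1] at hx hy
  rw [h2] at hx
  exact ⟨hx.trans (by decide), hy.trans (by decide), hz, h2, h3, h1⟩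

theorem isInvY_of_rot {x y z : Dart n} (hx : Γ.dir x = some Direction.up) (h1 : Γ.rot x = y)
    (h2 : Γ.rot y = z) (h3 : Γ.rot z = x) : Γ.IsInvY x y z := by
  have hy := Γ.dir_rot _ _ hx
  have hz := Γ.dir_rot _ _ hy
  rw [h1] at hz hy
  rw [h2] at hz
  exact ⟨hx, hy.trans (by decide), hz.trans (by decide), h1, h2, h3⟩

theorem Good.congr {Γ' : SphereGraph n m} {k : ℕ} {d : Dart n} (h : Γ.Good k d)
    (σ : Equiv.Perm (Dart n)) (hσ : ∀ x, σ x.flip = (σ x).flip)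
    (hrot : ∀ x, Γ'.rot (σ x) = σ (Γ.rot x)) (hregion : ∀ x, Γ'.region (σ x) = Γ.region x) :
    Γ'.Good k (σ d) := by
  have hface : ∀ x, Γ'.face (σ x) = σ (Γ.face x) := fun x => by
    refine face_eq_of_rot_eq ?_
    rw [hrot, facePerm_apply, Equiv.apply_symm_apply, hσ]
  have hpow : ∀ i x, (Γ'.face ^ i) (σ x) = σ ((Γ.face ^ i) x) := fun i x => by
    induction i with
    | zero => rfl
    | succ i ih => rw [pow_succ', pow_succ', mul_apply, mul_apply, ih, hface]
  refine ⟨fun x hx => ?_, fun x hx => ?_⟩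
  · obtain ⟨y, rfl⟩ := σ.surjective x
    rw [hregion, hregion] at hx
    obtain ⟨i, hi, rfl⟩ := h.1 y hx
    exact ⟨i, hi, hpow i d⟩
  · obtain ⟨y, rfl⟩ := σ.surjective x
    rw [hregion, hregion] at hx
    rw [← hσ, hregion, hregion]
    exact h.2 y hx

section reorient

variable (Γ) (w : Fin n → Bool) (x : Dart n)

theorem turn_turn : turn w (turn w x) = x := by simp [turn_apply]

theorem reorient_rot_turn : (Γ.reorient w).rot (turn w x) = turn w (Γ.rot x) := by
  rw [reorient_rot, turn_turn]
theorem reorient_dir_turn : (Γ.reorient w).dir (turn w x) = Γ.dir x := by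
  rw [reorient_dir, turn_turn]
theorem reorient_region_turn : (Γ.reorient w).region (turn w x) = Γ.region x := by
  rw [reorient_region, turn_turn]

end reorient

end SphereGraph

namespace Journal

open Tables (initial initial_dartNumber dartNumber_mod dartNumber_inj dartNumber_true flip_dartNumber
  directionNumber_eq_zero)
open SphereGraph

variable {Γ₀ : TrivalentGraph} {s : Journal} {n m : ℕ} {Γ : SphereGraph n m}

theorem Records.describes {Δ : TrivalentGraph} (h : Records Γ₀ s Δ) : s.1.Describes Δ.graph := by
  cases h <;> assumption

/-- Since the edge of `x` has not been reversed yet, `x` still has its original number in the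
reoriented graph. This is why `orient_list` asks for distinct edges. -/
theorem Records.orient {w : Fin n → Bool} (h : Records Γ₀ s ⟨n, m, Γ.reorient w⟩) {x : Dart n}
    (hw : w x.1 = false) (b : Bool) : ∃ w' : Fin n → Bool,
      Records Γ₀ (orient s (dartNumber x) b.toNat) ⟨n, m, Γ.reorient w'⟩ ∧
      turn w' x = (x.1, b) ∧ ∀ i, i ≠ x.1 → w' i = w i := by
  by_cases hb : x.2 = b
  · refine ⟨w, ?_, by simp [turn_apply, hw, hb], fun _ _ => rfl⟩
    rwa [Journal.orient, if_pos (by rw [dartNumber_mod, hb])]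
  · refine ⟨Function.update w x.1 (!w x.1), ?_, ?_, fun i hi => Function.update_of_ne hi _ _⟩
    · rw [Journal.orient, if_neg (by
        rw [dartNumber_mod]; revert hb; cases x.2 <;> cases b <;> simp), initial_dartNumber]
      exact .step h (.inl ⟨.edgeReversal x.1 (edgeReversal_reorient Γ w x.1), rfl⟩) le_rfl
        (h.describes.reverse (edgeReversal_reorient Γ w x.1))
    · simp only [turn_apply, Function.update_self, hw]
      revert hb; cases x.2 <;> cases b <;> simp

theorem Records.orient_list {w : Fin n → Bool} (L : List (Dart n × Bool))
    (h : Records Γ₀ s ⟨n, m, Γ.reorient w⟩) (hL : (L.map fun p => p.1.1).Nodup)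
    (hw : ∀ p ∈ L, w p.1.1 = false) : ∃ w' : Fin n → Bool,
      Records Γ₀ (L.foldl (fun s p => Journal.orient s (dartNumber p.1) p.2.toNat) s)
        ⟨n, m, Γ.reorient w'⟩ ∧
      (∀ p ∈ L, turn w' p.1 = (p.1.1, p.2)) ∧ ∀ i ∉ L.map fun p => p.1.1, w' i = w i := by
  induction L generalizing s w with
  | nil => exact ⟨w, h, by simp, by simp⟩
  | cons p L ih =>
    rw [List.map_cons, List.nodup_cons] at hL
    obtain ⟨w₁, h1, h2, h3⟩ := h.orient (hw p (by simp)) p.2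
    obtain ⟨w₂, g1, g2, g3⟩ := ih h1 hL.2 fun q hq => by
      rw [h3, hw q (by simp [hq])]
      intro hpq
      exact hL.1 (hpq ▸ List.mem_map_of_mem hq)
    refine ⟨w₂, g1, fun q hq => ?_, fun i hi => ?_⟩
    · rcases List.mem_cons.1 hq with rfl | hq
      · rw [← h2, turn_apply, turn_apply, g3 _ hL.1]
      · exact g2 q hq
    · rw [List.map_cons, List.mem_cons, not_or] at hi
      rw [g3 i hi.2, h3 i hi.1]

/-- The target is at most `j` notches away, and steps after it has been reached do nothing. -/
theorem Records.turn_iterate {v : Dart n} {t : Direction} (j : ℕ)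
    (h : Records Γ₀ s ⟨n, m, Γ⟩) {u : Direction} (hu : Γ.dir v = some u)
    (hj : ∃ i ≤ j, u + (i : Direction) = t) : ∃ Γ' : SphereGraph n m,
      Records Γ₀ ((turnStep (dartNumber v) (directionNumber (some t)))^[j] s) ⟨n, m, Γ'⟩ ∧
      Γ'.rot = Γ.rot ∧ Γ'.region = Γ.region ∧ Γ'.dir v = some t ∧
      ∀ x, ¬ Γ.rot.SameCycle v x → Γ'.dir x = Γ.dir x := by
  induction j generalizing s Γ u with
  | zero =>
    obtain ⟨i, hi, hit⟩ := hj
    obtain rfl : i = 0 := by omega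
    refine ⟨Γ, h, rfl, rfl, ?_, fun _ _ => rfl⟩
    rw [hu, ← hit]; simp
  | succ j ih =>
    rw [Function.iterate_succ_apply]
    by_cases hut : u = t
    · rw [turnStep, if_pos (by rw [h.describes.dir_eq, ← hut]; exact congrArg _ hu)]
      exact ih h hu ⟨0, by simp, by simpa using hut⟩
    · rw [turnStep, if_neg (by
        rw [h.describes.dir_eq]
        intro h'
        have := TrivalentGraph.directionNumber_injective h'
        exact hut (Option.some.inj (hu.symm.trans this)))]
      have hv : Γ.dir v ≠ none := by simp [hu]
      have hdir : ∀ x, (Γ.spiral v).dir x =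
        if Γ.rot.SameCycle v x then (Γ.dir x).map (· + 1) else Γ.dir x := fun x => rfl
      have hstep : Records Γ₀ (push s (Tables.spiral s.1 (dartNumber v))) ⟨n, m, Γ.spiral v⟩ :=
        .step h (.inl ⟨.vertexSpiral v 1 (vertexSpiral_spiral Γ hv), rfl⟩) le_rfl
          (h.describes.spiral hv)
      obtain ⟨Γ', g1, g2, g3, g4, g5⟩ := ih hstep (u := u + 1)
        (by rw [hdir, if_pos SameCycle.rfl, hu]; rfl) (by
          obtain ⟨i, hi, hit⟩ := hj
          rcases i with _ | i
          · exact absurd (by simpa using hit) hut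
          · refine ⟨i, by omega, ?_⟩
            rw [← hit]; push_cast; ring)
      refine ⟨Γ', g1, g2, g3, g4, fun x hx => ?_⟩
      rw [g5 x hx, hdir, if_neg hx]

theorem turnTo_eq_iterate (s : Journal) (v t : ℕ) :
    turnTo s v t = (turnStep v t)^[5] s := by
  simp only [Journal.turnTo, Function.iterate_succ_apply, Function.iterate_zero, id_eq]

theorem Records.turnTo (h : Records Γ₀ s ⟨n, m, Γ⟩) {v : Dart n} (hv : Γ.dir v ≠ none)
    (t : Direction) : ∃ Γ' : SphereGraph n m,
      Records Γ₀ (turnTo s (dartNumber v) (directionNumber (some t))) ⟨n, m, Γ'⟩ ∧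
      Γ'.rot = Γ.rot ∧ Γ'.region = Γ.region ∧ Γ'.dir v = some t ∧
      ∀ x, ¬ Γ.rot.SameCycle v x → Γ'.dir x = Γ.dir x := by
  obtain ⟨u, hu⟩ := Option.ne_none_iff_exists'.1 hv
  have hj : ∃ i ≤ 5, u + ((i : ℕ) : Direction) = t :=
    ⟨(t - u : Direction).val, Nat.le_of_lt_succ (ZMod.val_lt (t - u)), by
      rw [ZMod.natCast_zmod_val, add_sub_cancel]⟩
  have key := h.turn_iterate 5 hu hj
  rwa [← turnTo_eq_iterate] at key

theorem Records.turn_two (h : Records Γ₀ s ⟨n, m, Γ⟩) {v v' : Dart n} (hv : Γ.dir v ≠ none)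
    (hv' : Γ.dir v' ≠ none) (hvv' : ¬ Γ.rot.SameCycle v v') (t t' : Direction) :
    ∃ Γ' : SphereGraph n m,
      Records Γ₀ (Journal.turnTo (Journal.turnTo s (dartNumber v) (directionNumber (some t)))
        (dartNumber v') (directionNumber (some t'))) ⟨n, m, Γ'⟩ ∧
      Γ'.rot = Γ.rot ∧ Γ'.region = Γ.region ∧ Γ'.dir v = some t ∧ Γ'.dir v' = some t' := by
  obtain ⟨Γ₁, h1, h2, h3, h4, h5⟩ := h.turnTo hv t
  obtain ⟨Γ₂, g1, g2, g3, g4, g5⟩ := h1.turnTo (v := v') (by rwa [h5 v' hvv']) t'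
  refine ⟨Γ₂, g1, g2.trans h2, g3.trans h3, ?_, g4⟩
  rw [g5, h4]
  rw [h2]
  exact fun h' => hvv' h'.symm

/-- The two outer ends `z` and `w` may be the two halves of one edge; this is the case in which a
removal produces a circle. As opposite roles are wanted for them, orienting `z` then settles `w` as
well. -/
theorem Records.orientEnds (h : Records Γ₀ s ⟨n, m, Γ⟩) (L : List (Dart n × Bool)) {z w : Dart n}
    (z' : Bool) (hL : (L.map fun p => p.1.1).Nodup) (hz : z.1 ∉ L.map fun p => p.1.1)
    (hw : w.1 ∉ L.map fun p => p.1.1) (hzw : w ≠ z) : ∃ o : Fin n → Bool,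
      Records Γ₀ (Journal.orientEnds
        (L.foldl (fun s p => Journal.orient s (dartNumber p.1) p.2.toNat) s)
        (dartNumber z) (dartNumber w) z'.toNat (!z').toNat) ⟨n, m, Γ.reorient o⟩ ∧
      (∀ p ∈ L, turn o p.1 = (p.1.1, p.2)) ∧ turn o z = (z.1, z') ∧ turn o w = (w.1, !z') := by
  simp only [Journal.orientEnds, flip_dartNumber, dartNumber_inj]
  have h' : Records Γ₀ s ⟨n, m, Γ.reorient fun _ => false⟩ := by rwa [reorient_false]
  split_ifs with hwz
  · obtain ⟨o, h1, h2, -⟩ := h'.orient_list (L ++ [(z, z')])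
      (by
        rw [List.map_append, List.nodup_append]
        refine ⟨hL, by simp, fun i hi j hj => ?_⟩
        simp only [List.map_cons, List.map_nil, List.mem_cons, List.not_mem_nil, or_false] at hj
        rintro rfl
        exact hz (hj ▸ hi))
      (by simp)
    rw [List.foldl_append] at h1
    have hz2 := h2 (z, z') (by simp)
    refine ⟨o, h1, fun p hp => h2 p (by simp [hp]), hz2, ?_⟩
    rw [hwz, turn_flip, hz2]; rfl
  · have hzw' : z.1 ≠ w.1 := fun hh => by
      rcases Dart.eq_or_eq_flip hh.symm with h | h
      · exact hzw h
      · exact hwz h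
    obtain ⟨o, h1, h2, -⟩ := h'.orient_list (L ++ [(z, z'), (w, !z')])
      (by
        rw [List.map_append, List.nodup_append]
        refine ⟨hL, by simp [hzw'], fun i hi j hj => ?_⟩
        simp only [List.map_cons, List.map_nil, List.mem_cons, List.not_mem_nil, or_false] at hj
        rcases hj with rfl | rfl
        · rintro rfl; exact hz hi
        · rintro rfl; exact hw hi) (by simp)
    rw [List.foldl_append] at h1
    exact ⟨o, h1, fun p hp => h2 p (by simp [hp]), h2 (z, z') (by simp), h2 (w, !z') (by simp)⟩

end Journal

/-! ### One round that removes a region. -/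

open Equiv.Perm

open TrivalentGraph (dartNumber directionNumber dartNumber_injective)

namespace Journal

open Tables (initial initial_dartNumber dartNumber_mod dartNumber_inj dartNumber_true flip_dartNumber
  directionNumber_eq_zero)
open SphereGraph

variable {Γ₀ : TrivalentGraph} {s : Journal} {n m : ℕ} {Γ : SphereGraph n m}

theorem notMem_vertex {v x : Dart n} (hv : Γ.dir v ≠ none) (h1 : x ≠ v) (h2 : x ≠ Γ.rot v)
    (h3 : Γ.rot x ≠ v) : ¬ Γ.rot.SameCycle v x := by
  rw [Tables.Describes.sameCycle_iff hv]
  rintro (h | h | h)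
  · exact h1 h
  · exact h2 h
  · exact h3 (by rw [h, Γ.rot_rot_rot v hv])

theorem exists_circleStep (h : Records Γ₀ s ⟨n, m, Γ⟩) {d : Dart n} (hd : Γ.dir d = none)
    (hR : ∀ x, Γ.region x = Γ.region d ↔ x = d) :
    ∃ Δ, Records Γ₀ (circleStep s (dartNumber d)) Δ ∧ Δ.regions + 1 = m := by
  have h' : Records Γ₀ s ⟨n, m, Γ.reorient fun _ => false⟩ := by rwa [reorient_false]
  obtain ⟨o, h1, h2, -⟩ := h'.orient (x := d) rfl false
  have hreg : ∀ x, (Γ.reorient o).region x = (Γ.reorient o).region (d.1, false) ↔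
      x = (d.1, false) := fun x => by
    rw [← h2, reorient_region_turn, reorient_region, hR]
    constructor
    · rintro rfl; rw [turn_turn]
    · rintro rfl; rw [turn_turn]
  have hdir : (Γ.reorient o).dir (d.1, false) = none := by rw [← h2, reorient_dir_turn, hd]
  rcases m with _ | m
  · exact (Γ.region d).elim0
  obtain ⟨n', Γ', g1, g2, g3⟩ := h1.describes.exists_removeCircle hdir hreg
  refine ⟨⟨n', m, Γ'⟩, ?_, rfl⟩
  rw [circleStep, initial_dartNumber]
  exact .step h1 (.inr ⟨.circleRemoval g2, rfl⟩) g1 g3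

/-- A one-step walk on an edge with vertices means that `d` and `d.flip` lie at the same vertex. The
third dart there is the stem `t`, and `t.flip`, `a`, `b` form the vertex at its other end.
Injectivity of the rotation separates these six darts; only `a` and `b` may belong to the same edge.
-/
theorem exists_tadpoleStep (h : Records Γ₀ s ⟨n, m, Γ⟩) {d : Dart n} (hd : Γ.dir d ≠ none)
    (hface : Γ.face d = d) (hR : ∀ x, Γ.region x = Γ.region d ↔ x = d) :
    ∃ Δ, Records Γ₀ (tadpoleStep s (dartNumber d)) Δ ∧ Δ.regions + 1 = m := by
  have r1 : Γ.rot d = d.flip := by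
    rw [facePerm_apply, Equiv.symm_apply_eq] at hface; exact hface.symm
  set t := Γ.rot d.flip with ht
  have r3 : Γ.rot t = d := by rw [ht, ← r1, Γ.rot_rot_rot d hd]
  set a := Γ.rot t.flip with ha
  set b := Γ.rot a with hb
  have hdt : Γ.dir t ≠ none := by
    rw [ht, ← r1]; exact Γ.rules.dir_rot_ne (Γ.rules.dir_rot_ne hd)
  have hdt' : Γ.dir t.flip ≠ none := fun h0 => hdt (by simpa using Γ.dir_flip _ h0)
  have r6 : Γ.rot b = t.flip := by rw [hb, ha, Γ.rot_rot_rot _ hdt']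
  have inj : ∀ {x y}, Γ.rot x = Γ.rot y → x = y := fun h => Γ.rot.injective h
  have ne_rot : ∀ x, Γ.rot x ≠ x := Γ.rules.rot_ne
  have ntd : t ≠ d := fun h => ne_rot t (r3.trans h.symm)
  have ntd' : t ≠ d.flip := fun h => ne_rot d.flip h
  have ntd2 : t.flip ≠ d := fun h => ntd' (by rw [← h, Dart.flip_flip])
  have ntd3 : t.flip ≠ d.flip := fun h => ntd (Dart.flip_injective h)
  have ntt : t.flip ≠ t := t.flip_ne
  have nad : a ≠ d := fun h => ntt (inj (h.trans r3.symm))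
  have nad' : a ≠ d.flip := fun h => ntd2 (inj (h.trans r1.symm))
  have nat : a ≠ t := fun h => ntd3 (inj h)
  have nat' : a ≠ t.flip := ne_rot _
  have nbd : b ≠ d := fun h => nat (inj (h.trans r3.symm))
  have nbd' : b ≠ d.flip := fun h => nad (inj (h.trans r1.symm))
  have nbt : b ≠ t := fun h => nad' (inj h)
  have nbt' : b ≠ t.flip := fun h => ne_rot b (r6.trans h.symm)
  have edge_ne : ∀ {x y : Dart n}, x ≠ y → x ≠ y.flip → x.1 ≠ y.1 := fun h1 h2 h => by
    rcases Dart.eq_or_eq_flip h with h | h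
    · exact h1 h
    · exact h2 h
  have e1 := edge_ne ntd ntd'
  have e2 := edge_ne nad nad'
  have e3 := edge_ne nat nat'
  have e4 := edge_ne nbd nbd'
  have e5 := edge_ne nbt nbt'
  obtain ⟨o, h1, h2, o3, o4⟩ := h.orientEnds [(d, true), (t, false)] (z := a) (w := b) true
    (by simp [e1.symm]) (by simp [e2, e3]) (by simp [e4, e5]) (ne_rot a)
  simp only [List.mem_cons, List.not_mem_nil, or_false, forall_eq_or_imp, forall_eq] at h2
  obtain ⟨o1, o2⟩ := h2
  have o1' : turn o d.flip = (d.1, false) := by rw [turn_flip, o1]; rfl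
  have o2' : turn o t.flip = (t.1, true) := by rw [turn_flip, o2]; rfl
  have hv : (Γ.reorient o).dir (t.1, false) ≠ none := by rwa [← o2, reorient_dir_turn]
  have hv' : (Γ.reorient o).dir (t.1, true) ≠ none := by rwa [← o2', reorient_dir_turn]
  obtain ⟨Γ₂, g1, g2, g3, g4, g5⟩ := h1.turn_two hv hv' (by
    refine notMem_vertex hv (by simp) ?_ ?_
    · rw [← o2, ← o2', reorient_rot_turn, r3]
      exact fun h => ntd2 ((turn o).injective h)
    · rw [← o2, ← o2', reorient_rot_turn]
      exact fun h => nat ((turn o).injective h)) Direction.down Direction.up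
  have hrot : ∀ x, Γ₂.rot (turn o x) = turn o (Γ.rot x) := fun x => by rw [g2, reorient_rot_turn]
  rcases m with _ | m
  · exact (Γ.region d).elim0
  obtain ⟨n', e, k1, k2, k3, k4⟩ := g1.describes.spliced (a := a.1) (b := b.1) (k := d.1) (l := t.1)
    (R := (d.1, true))
  obtain ⟨Γ', f1, f2, f3⟩ := Γ₂.exists_tadpoleTrim (p := d.1) (s := t.1) (a := a.1) (b := b.1)
    (isY_of_rot g4 (by rw [← o2, hrot, r3, o1]) (by rw [← o1, hrot, r1, o1'])
      (by rw [← o1', hrot, ← o2]))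
    (isInvY_of_rot g5 (by rw [← o2', hrot, ← o3]) (by rw [← o3, hrot]; exact o4)
      (by rw [show (b.1, false) = turn o b from o4.symm, hrot, r6, o2']))
    (fun x => by
      rw [g3, ← o1, reorient_region_turn, reorient_region, hR]
      constructor
      · intro h; rw [← h, turn_turn]
      · rintro rfl; rw [turn_turn]) k2 k3
  have hD := h.describes
  refine ⟨⟨n', m, Γ'⟩, ?_, rfl⟩
  have hraw : tadpoleStep s (dartNumber d) =
      trimTadpole s (dartNumber d) (dartNumber t) (dartNumber a) (dartNumber b) := by
    rw [tadpoleStep, flip_dartNumber, hD.rot_eq, flip_dartNumber, hD.rot_eq, hD.rot_eq]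
  rw [hraw, trimTadpole, pushSplice]
  simp only [initial_dartNumber, ← dartNumber_true]
  exact .step g1 (.inr ⟨.tadpoleTrim f1, rfl⟩) k1 (k4 Γ' f2 f3)

/-- The two steps `d` and `r.flip` of the walk join the vertex `d, r, t` to the vertex `d.flip, b,
r.flip`. The six darts are distinct, and only `t` and `b` may belong to the same edge. -/
theorem exists_bubbleStep (h : Records Γ₀ s ⟨n, m, Γ⟩) {d : Dart n} (hd : Γ.face d ≠ d)
    (hface : Γ.face (Γ.face d) = d) (hR : ∀ x, Γ.region x = Γ.region d ↔ x = d ∨ x = Γ.face d) :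
    ∃ Δ, Records Γ₀ (bubbleStep s (dartNumber d)) Δ ∧ Δ.regions + 1 = m := by
  have hdir : Γ.dir d ≠ none := fun h0 => hd (Γ.face_circle h0)
  have hdir' : Γ.dir d.flip ≠ none := fun h0 => hdir (by simpa using Γ.dir_flip _ h0)
  set r := Γ.rot d with hr
  set t := Γ.rot r with ht
  set b := Γ.rot d.flip with hb
  have inj : ∀ {x y}, Γ.rot x = Γ.rot y → x = y := fun h => Γ.rot.injective h
  have ne_rot : ∀ x, Γ.rot x ≠ x := Γ.rules.rot_ne
  have hfr : Γ.face d = r.flip := by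
    rw [hr, ← Dart.flip_eq_iff]
    nth_rw 2 [← hface]
    rw [facePerm_apply Γ.rot (Γ.face d), Equiv.apply_symm_apply]
  have r1 : Γ.rot r.flip = d.flip := by rw [← hfr, facePerm_apply, Equiv.apply_symm_apply]
  have r2 : Γ.rot t = d := Γ.rot_rot_rot d hdir
  have r3 : Γ.rot b = r.flip := by
    apply inj
    rw [r1, hb, Γ.rot_rot_rot _ hdir']
  have nrd : r ≠ d := ne_rot d
  have nrd' : r ≠ d.flip := fun h => hd (by rw [hfr, h, Dart.flip_flip])
  have nrd2 : r.flip ≠ d := fun h => nrd' (by rw [← h, Dart.flip_flip])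
  have nrr : r.flip ≠ r := r.flip_ne
  have ntd : t ≠ d := fun h => ne_rot t (r2.trans h.symm)
  have ntr : t ≠ r := ne_rot r
  have ntd' : t ≠ d.flip := fun h => nrr (inj (r1.trans h.symm))
  have ntr' : t ≠ r.flip := fun h => d.flip_ne (by rw [← r1, ← h, r2])
  have nbd' : b ≠ d.flip := ne_rot _
  have nbr' : b ≠ r.flip := fun h => ne_rot b (r3.trans h.symm)
  have nbd : b ≠ d := fun h => nrr (by rw [← r3, h])
  have nbr : b ≠ r := fun h => ntr' (by rw [← r3, h])
  have nbt : b ≠ t := fun h => nrd2 (by rw [← r3, h, r2])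
  have edge_ne : ∀ {x y : Dart n}, x ≠ y → x ≠ y.flip → x.1 ≠ y.1 := fun h1 h2 h => by
    rcases Dart.eq_or_eq_flip h with h | h
    · exact h1 h
    · exact h2 h
  have e1 := edge_ne nrd nrd'
  have e2 := edge_ne ntd ntd'
  have e3 := edge_ne ntr ntr'
  have e4 := edge_ne nbd nbd'
  have e5 := edge_ne nbr nbr'
  obtain ⟨o, h1, h2, o3, o4⟩ := h.orientEnds [(d, false), (r, false)] (z := t) (w := b) true
    (by simp [e1.symm]) (by simp [e2, e3]) (by simp [e4, e5]) nbt
  simp only [List.mem_cons, List.not_mem_nil, or_false, forall_eq_or_imp, forall_eq] at h2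
  obtain ⟨o1, o2⟩ := h2
  have o4 : turn o b = (b.1, false) := o4
  have o1' : turn o d.flip = (d.1, true) := by rw [turn_flip, o1]; rfl
  have o2' : turn o r.flip = (r.1, true) := by rw [turn_flip, o2]; rfl
  have hdt : Γ.dir t ≠ none := Γ.rules.dir_rot_ne (Γ.rules.dir_rot_ne hdir)
  have hdb : Γ.dir b ≠ none := Γ.rules.dir_rot_ne hdir'
  have hv : (Γ.reorient o).dir (t.1, true) ≠ none := by rwa [← o3, reorient_dir_turn]
  have hv' : (Γ.reorient o).dir (b.1, false) ≠ none := by rwa [← o4, reorient_dir_turn]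
  obtain ⟨Γ₂, g1, g2, g3, g4, g5⟩ := h1.turn_two hv hv' (by
    refine notMem_vertex hv (by simp) ?_ ?_
    · rw [← o3, ← o4, reorient_rot_turn, r2]
      exact fun h => nbd ((turn o).injective h)
    · rw [← o3, ← o4, reorient_rot_turn, r3]
      exact fun h => ntr' ((turn o).injective h).symm) Direction.up Direction.down
  have hrot : ∀ x, Γ₂.rot (turn o x) = turn o (Γ.rot x) := fun x => by rw [g2, reorient_rot_turn]
  rcases m with _ | m
  · exact (Γ.region d).elim0
  obtain ⟨n', e, k1, k2, k3, k4⟩ := g1.describes.spliced (a := t.1) (b := b.1) (k := d.1) (l := r.1)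
    (R := (d.1, false))
  obtain ⟨Γ', f1, f2, f3⟩ := Γ₂.exists_bubblePop (t := t.1) (l := d.1) (r := r.1) (b := b.1)
    (isInvY_of_rot g4 (by rw [← o3, hrot, r2, o1]) (by rw [← o1, hrot, ← o2])
      (by rw [← o2, hrot, ← o3]))
    (isY_of_rot g5 (by rw [← o4, hrot, r3, o2']) (by rw [← o2', hrot, r1, o1'])
      (by rw [← o1', hrot, ← o4]))
    (fun x => by
      rw [g3, ← o1, reorient_region_turn, reorient_region, hR, hfr, ← o2']
      constructor
      · rintro (h | h)
        · left; rw [← h, turn_turn]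
        · right; rw [← h, turn_turn]
      · rintro (rfl | rfl)
        · left; rw [turn_turn]
        · right; rw [turn_turn]) k2 k3
  have hD := h.describes
  refine ⟨⟨n', m, Γ'⟩, ?_, rfl⟩
  have hraw : bubbleStep s (dartNumber d) =
      popBubble s (dartNumber d) (dartNumber r) (dartNumber t) (dartNumber b) := by
    simp only [bubbleStep, flip_dartNumber, hD.rot_eq]
    rfl
  rw [hraw, popBubble, pushSplice]
  simp only [initial_dartNumber, ← dartNumber_true]
  exact .step g1 (.inr ⟨.bubblePop f1, rfl⟩) k1 (k4 Γ' f2 f3)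

end Journal

/-! ### An `F`-move shortens the boundary of a good region. -/

open Equiv.Perm

open TrivalentGraph (dartNumber directionNumber dartNumber_injective)

namespace SphereGraph

variable {n m : ℕ} {Γ : SphereGraph n m}

/-- In the walk around the region the step `(e, false)` between `(b, false)` and `(c, true)` is left
out, and the shorter walk is started at `(c, true)`. Nothing else in it changes: the other darts
that the move touches lie in different regions, because no edge has the region on both sides. -/
theorem Good.fMove {Γ' : SphereGraph n m} {k : ℕ} {e a b c d : Fin n} (h : Γ.MergeLeft e a b c d)
    (hde : d ≠ e) (hk : Γ.Good k (e, false))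
    (hrot : ∀ x, Γ'.rot x = shift (a, true) (b, true) (c, true) (e, true)
        (Γ.rot ((shift (a, true) (b, true) (c, true) (e, true)).symm x)))
    (hregion : ∀ x, Γ'.region x = if x = (e, false) then Γ.region (c, false) else
        if x = (e, true) then Γ.region (a, false) else Γ.region x) : Γ'.Good (k - 1) (c, true) := by
  obtain ⟨⟨da, db, de, rb, ra, re⟩, ⟨de', dc, dd, rc, re', rd⟩⟩ := h
  have hae : a ≠ e := by
    rintro rfl
    exact hde (congrArg Prod.fst (re'.symm.trans ra))
  have hbe : b ≠ e := by rintro rfl; exact dir_ne db de' (by decide) rfl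
  have hce : c ≠ e := by rintro rfl; exact dir_ne dc de' (by decide) rfl
  have hab : a ≠ b := by rintro rfl; exact dir_ne da db (by decide) rfl
  have hac : a ≠ c := by rintro rfl; exact dir_ne da dc (by decide) rfl
  have hbc : b ≠ c := by
    rintro rfl
    exact hae (congrArg Prod.fst (rb.symm.trans rc))
  obtain ⟨sa, sb, sc, se⟩ := shift_first (a := (a, true)) (b := (b, true)) (c := (c, true))
    (e := (e, true)) (by simpa) (by simpa) (by simpa) (by simpa) (by simpa) (by simpa)
  set σ := shift (a, true) (b, true) (c, true) (e, true) with hσ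
  set R := Γ.region (e, false) with hR
  have fe0 : Γ.face (e, false) = (c, true) := face_eq_of_rot_eq rc
  have fb0 : Γ.face (b, false) = (e, false) := face_eq_of_rot_eq re
  have fa0 : Γ.face (a, false) = (b, true) := face_eq_of_rot_eq rb
  have fe1 : Γ.face (e, true) = (a, true) := face_eq_of_rot_eq ra
  have Rc1 : Γ.region (c, true) = R := by rw [← fe0, Γ.region_face_apply]
  have Rb0 : Γ.region (b, false) = R := by rw [← Γ.region_face_apply, fb0]
  have Re1 : Γ.region (e, true) ≠ R := hk.2 _ rfl
  have Rc0 : Γ.region (c, false) ≠ R := hk.2 _ Rc1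
  have Rb1 : Γ.region (b, true) ≠ R := hk.2 _ Rb0
  have Ra0 : Γ.region (a, false) ≠ R := by rwa [← Γ.region_face_apply, fa0]
  have Ra1 : Γ.region (a, true) ≠ R := by rwa [← fe1, Γ.region_face_apply]
  have hσ_fix : ∀ {x : Dart n}, x ≠ (a, true) → x ≠ (b, true) → x ≠ (c, true) → x ≠ (e, true) →
      σ x = x := fun h1 h2 h3 h4 => shift_of_ne h1 h2 h3 h4
  have inv : ∀ {x y : Dart n}, σ x = y → σ.symm y = x := fun h => by
    rw [Equiv.symm_apply_eq, h]
  have hreg : ∀ x, Γ'.region x = R ↔ Γ.region x = R ∧ x ≠ (e, false) := fun x => by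
    rw [hregion]
    split_ifs with h1 h2
    · simp [h1, Rc0]
    · simp [h2, Ra0, Re1]
    · simp [h1]
  have face_b : Γ'.face (b, false) = (c, true) := by
    refine face_eq_of_rot_eq ?_
    rw [hrot, inv sb, rb, sa]; rfl
  have face_of : ∀ x, Γ.region x = R → x ≠ (e, false) → x ≠ (b, false) →
      Γ'.face x = Γ.face x := fun x hx h1 h2 => by
    refine face_eq_of_rot_eq ?_
    have hy : Γ.region (Γ.face x) = R := by rw [Γ.region_face_apply, hx]
    have hfix : σ (Γ.face x) = Γ.face x := by
      refine hσ_fix ?_ ?_ ?_ ?_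
      · rintro h; exact Ra1 (h ▸ hy)
      · rintro h; exact Rb1 (h ▸ hy)
      · rintro h; exact h1 (Γ.face.injective (h.trans fe0.symm))
      · rintro h; exact Re1 (h ▸ hy)
    rw [hrot, inv hfix, facePerm_apply, Equiv.apply_symm_apply]
    refine hσ_fix ?_ ?_ ?_ ?_ <;> rw [ne_eq, Dart.flip_eq_iff]
    · rintro rfl; exact Ra0 hx
    · rintro rfl; exact h2 rfl
    · rintro rfl; exact Rc0 hx
    · rintro rfl; exact h1 rfl
  have hc1 : Γ'.region (c, true) = R := (hreg _).2 ⟨Rc1, by simp⟩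
  refine ⟨fun x hx => ?_, fun x hx => ?_⟩
  · rw [hc1, hreg] at hx
    obtain ⟨hx, hxe⟩ := hx
    have hex := hk.1 x hx
    classical
    obtain ⟨hi, hix⟩ := Nat.find_spec hex
    -- For the first visit to `x` the walk cannot have returned to `(e, false)` on the way, since
    -- that would give an earlier visit. So the old walk up to there, minus its first step, is also
    -- a walk of the new graph.
    have hmin : ∀ j < Nat.find hex, (Γ.face ^ j) (e, false) ≠ x := fun j hj hjx =>
      Nat.find_min hex hj ⟨hj.trans hi, hjx⟩
    set i := Nat.find hex with hi_def
    have hpos : i ≠ 0 := by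
      intro h0
      rw [h0] at hix
      exact hxe hix.symm
    obtain ⟨i', hi'⟩ := Nat.exists_eq_succ_of_ne_zero hpos
    rw [hi'] at hix hmin hi
    have hreturn : ∀ j, j + 1 < i' + 1 → (Γ.face ^ (j + 1)) (e, false) ≠ (e, false) := by
      intro j hj h0
      refine hmin (i' + 1 - (j + 1)) (by omega) ?_
      rw [← hix]
      conv_rhs => rw [show i'.succ = (i' + 1 - (j + 1)) + (j + 1) by omega, pow_add, mul_apply, h0]
    have hregj : ∀ j, Γ.region ((Γ.face ^ j) (e, false)) = R := fun j =>
      (Γ.region_eq_of_sameCycle ⟨j, rfl⟩).symm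
    have key : ∀ j ≤ i', (Γ'.face ^ j) (c, true) = (Γ.face ^ (j + 1)) (e, false) := by
      intro j
      induction j with
      | zero => intro _; simp [fe0]
      | succ j ih =>
        intro hj
        rw [pow_succ', mul_apply, ih (by omega), pow_succ' _ (j + 1), mul_apply]
        refine face_of _ (hregj _) (hreturn j (by omega)) fun h0 => ?_
        rcases Nat.lt_or_ge (j + 1 + 1) (i' + 1) with hlt | hge
        · exact hreturn (j + 1) hlt (by rw [pow_succ', mul_apply, h0, fb0])
        · obtain rfl : i' = j + 1 := by omega
          refine hxe ?_
          rw [← hix, Nat.succ_eq_add_one, pow_succ', mul_apply, h0, fb0]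
    exact ⟨i', by omega, (key i' le_rfl).trans hix⟩
  · rw [hc1] at hx ⊢
    rw [hreg] at hx
    exact fun h0 => hk.2 x hx.1 ((hreg _).1 h0).1

end SphereGraph

namespace Journal

open Tables (initial initial_dartNumber dartNumber_mod dartNumber_inj dartNumber_true flip_dartNumber
  directionNumber_eq_zero)
open SphereGraph

variable {Γ₀ : TrivalentGraph} {s : Journal} {n m : ℕ} {Γ : SphereGraph n m}

/-- Because the region has at least three sides and no edge occurs on it twice, the edges at the
ends of `e` are distinct, except that `a` and `d` may coincide. This is what permits putting both
vertices into the position of `MergeLeft`. -/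
theorem exists_fStep (h : Records Γ₀ s ⟨n, m, Γ⟩) {k : ℕ} {e : Dart n} (hk : Γ.Good k e)
    (h1 : Γ.face e ≠ e) (h2 : Γ.face (Γ.face e) ≠ e) :
    ∃ (Γ' : SphereGraph n m) (e' : Dart n), Records Γ₀ (fStep s (dartNumber e)) ⟨n, m, Γ'⟩ ∧
      Γ'.Good (k - 1) e' := by
  have hdir : Γ.dir e ≠ none := fun h0 => h1 (Γ.face_circle h0)
  have hdir' : Γ.dir e.flip ≠ none := fun h0 => hdir (by simpa using Γ.dir_flip _ h0)
  set b := Γ.rot e with hb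
  set a := Γ.rot b with ha
  set d := Γ.rot e.flip with hd
  set c := Γ.rot d with hc
  have inj : ∀ {x y}, Γ.rot x = Γ.rot y → x = y := fun h => Γ.rot.injective h
  have ne_rot : ∀ x, Γ.rot x ≠ x := Γ.rules.rot_ne
  have ra : Γ.rot a = e := Γ.rot_rot_rot e hdir
  have rc : Γ.rot c = e.flip := Γ.rot_rot_rot _ hdir'
  have fe : Γ.face e = c := face_eq_of_rot_eq rc
  have fb : Γ.face b.flip = e := face_eq_of_rot_eq (by rw [Dart.flip_flip])
  have fa : Γ.face a.flip = b := face_eq_of_rot_eq (by rw [Dart.flip_flip])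
  have fe' : Γ.face e.flip = a := face_eq_of_rot_eq (by rw [Dart.flip_flip, ra])
  have fc : Γ.face c.flip = d := face_eq_of_rot_eq (by rw [Dart.flip_flip])
  set R := Γ.region e with hR
  have Rc : Γ.region c = R := by rw [← fe, Γ.region_face_apply]
  have Rb' : Γ.region b.flip = R := by rw [← Γ.region_face_apply, fb]
  have Re' : Γ.region e.flip ≠ R := hk.2 _ rfl
  have Rc' : Γ.region c.flip ≠ R := hk.2 _ Rc
  have Rb : Γ.region b ≠ R := by simpa using hk.2 _ Rb'
  have Ra' : Γ.region a.flip ≠ R := by rwa [← Γ.region_face_apply, fa]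
  have Ra : Γ.region a ≠ R := by rwa [← fe', Γ.region_face_apply]
  have Rd : Γ.region d ≠ R := by rwa [← fc, Γ.region_face_apply]
  have hne : ∀ {x y : Dart n}, Γ.region x ≠ R → Γ.region y = R → x ≠ y := fun hx hy h =>
    hx (h ▸ hy)
  have edge_ne : ∀ {x y : Dart n}, x ≠ y → x ≠ y.flip → x.1 ≠ y.1 := fun h1 h2 h => by
    rcases Dart.eq_or_eq_flip h with h | h
    · exact h1 h
    · exact h2 h
  have hbe : b.1 ≠ e.1 := edge_ne (ne_rot e) fun h0 => h1 (by
    rw [facePerm_apply, ← h0, hb, Equiv.symm_apply_apply])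
  have hbc : b.1 ≠ c.1 := edge_ne (hne Rb Rc) fun h0 => h2 (by
    rw [fe, ← fb, h0, Dart.flip_flip])
  have hce : c.1 ≠ e.1 := edge_ne (fun h0 => h1 (fe.trans h0))
    fun h0 => ne_rot c (rc.trans h0.symm)
  have hae : a.1 ≠ e.1 := edge_ne (hne Ra rfl) fun h0 => by
    have h3 : d = e := by rw [hd, ← h0, ra]
    have h4 : c = b := by rw [hc, h3]
    exact Rb (h4 ▸ Rc)
  have hab : a.1 ≠ b.1 := edge_ne (ne_rot b) (hne Ra Rb')
  have hac : a.1 ≠ c.1 := edge_ne (hne Ra Rc) fun h0 => Ra' (by rw [h0, Dart.flip_flip, Rc])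
  have hde : d.1 ≠ e.1 := edge_ne (hne Rd rfl) (ne_rot _)
  have hdb : d.1 ≠ b.1 := edge_ne (fun h0 => Ra (by rw [ha, ← h0]; exact Rc)) (hne Rd Rb')
  have hdc : d.1 ≠ c.1 := edge_ne (ne_rot d).symm fun h0 => by
    have h3 : Γ.face c = e.flip := face_eq_of_rot_eq (by rw [← h0])
    exact Re' (by rw [← h3, Γ.region_face_apply, Rc])
  have hda : d ≠ a := fun h0 => hce (by rw [hc, h0, ra])
  obtain ⟨o, g1, g2, o3, o4⟩ := h.orientEnds [(e, false), (b, true), (c, true)] (z := a) (w := d) true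
    (by simp [hbe.symm, hce.symm, hbc]) (by simp [hae, hab, hac]) (by simp [hde, hdb, hdc]) hda
  simp only [List.mem_cons, List.not_mem_nil, or_false, forall_eq_or_imp, forall_eq] at g2
  obtain ⟨o1, o2, o5⟩ := g2
  have o4 : turn o d = (d.1, false) := o4
  have o1' : turn o e.flip = (e.1, true) := by rw [turn_flip, o1]; rfl
  have hv : (Γ.reorient o).dir (e.1, false) ≠ none := by rwa [← o1, reorient_dir_turn]
  have hv' : (Γ.reorient o).dir (e.1, true) ≠ none := by rwa [← o1', reorient_dir_turn]
  obtain ⟨Γ₂, k1, k2, k3, k4, k5⟩ := g1.turn_two hv hv' (by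
    refine notMem_vertex hv (by simp) ?_ ?_
    · rw [← o1, ← o1', reorient_rot_turn]
      exact fun h => hbe (congrArg Prod.fst ((turn o).injective h)).symm
    · rw [← o1, ← o1', reorient_rot_turn]
      exact fun h => hde (congrArg Prod.fst ((turn o).injective h))) Direction.down Direction.upLeft
  have hrot : ∀ x, Γ₂.rot (turn o x) = turn o (Γ.rot x) := fun x => by rw [k2, reorient_rot_turn]
  have hY : Γ₂.IsY (a.1, true) (b.1, true) (e.1, false) :=
    isY_of_rot k4 (by rw [← o1, hrot, ← o2]) (by rw [← o2, hrot, ← o3]) (by rw [← o3, hrot, ra, o1])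
  have re' : Γ₂.rot (e.1, true) = (d.1, false) := by rw [← o1', hrot, ← o4]
  have hY' : Γ₂.IsY (e.1, true) (c.1, true) (d.1, false) := by
    refine isY_of_rot ?_ (by rw [← o4, hrot, ← o5]) (by rw [← o5, hrot, rc, o1']) re'
    rw [← re', Γ₂.dir_rot _ _ k5]
    decide
  obtain ⟨Γ', f1, f2, f3, f4⟩ := Γ₂.exists_fMove ⟨hY, hY'⟩ hde
  refine ⟨Γ', (c.1, true), ?_, ?_⟩
  · have hD := h.describes
    have hraw : fStep s (dartNumber e) = moveEdge s (dartNumber e) (dartNumber b) (dartNumber a)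
        (dartNumber c) (dartNumber d) := by
      simp only [fStep, flip_dartNumber, hD.rot_eq]
      rfl
    rw [hraw, moveEdge, pushFMove]
    simp only [initial_dartNumber, ← dartNumber_true]
    exact .step k1 (.inl ⟨.fMove e.1 f1, rfl⟩) le_rfl (k1.describes.fMove f2 f3 f4)
  · refine Good.fMove ⟨hY, hY'⟩ hde ?_ f2 f4
    rw [← o1]
    exact hk.congr (turn o) (turn_flip o) hrot fun x => by rw [k3, reorient_region_turn]

end Journal

open Equiv.Perm

open TrivalentGraph (dartNumber directionNumber dartNumber_injective)

/-! ## The algorithm -/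

namespace Tables

/-- Five entries suffice, as `exists_good` promises a region with at most five sides. -/
def walk (T : Tables) (d : ℕ) : List ℕ :=
  [d, face T d, face T (face T d), face T (face T (face T d)),
    face T (face T (face T (face T d)))]

/-- The darts that keep `d` from being good. -/
def obstructions (T : Tables) (k d : ℕ) : List ℕ :=
  (List.range (size T)).filter fun x => region T x = region T d ∧
    (((List.range k).filter fun i => (walk T d).getD i 0 = x).isEmpty = true ∨
      region T (flip x) = region T d)

def candidates (T : Tables) (k : ℕ) : List ℕ :=
  (List.range (size T)).filter fun d => (obstructions T k d).isEmpty = true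

/-- A good dart with the shortest walk. -/
def best (T : Tables) : ℕ :=
  (candidates T 1 ++ (candidates T 2 ++ (candidates T 3 ++ (candidates T 4 ++ candidates T 5)))).headD 0

namespace Describes

variable {n m : ℕ} {T : Tables} {Γ : SphereGraph n m}

theorem walk_getD (h : Describes T Γ) (d : Dart n) {i : ℕ} (hi : i < 5) :
    (walk T (dartNumber d)).getD i 0 = dartNumber ((Γ.face ^ i) d) := by
  simp only [walk, h.face_eq]
  interval_cases i <;> simp [pow_succ]

theorem obstructions_isEmpty (h : Describes T Γ) {k : ℕ} (hk : k ≤ 5) (d : Dart n) :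
    (obstructions T k (dartNumber d)).isEmpty = true ↔ Γ.Good k d := by
  have hflt : ∀ x : Dart n, ((List.range k).filter fun i =>
      (walk T (dartNumber d)).getD i 0 = dartNumber x).isEmpty = true ↔
      ¬ ∃ i < k, (Γ.face ^ i) d = x := fun x => by
    rw [List.isEmpty_iff, List.filter_eq_nil_iff]
    simp only [List.mem_range, decide_eq_true_eq, not_exists, not_and]
    refine forall₂_congr fun i hi => ?_
    rw [h.walk_getD d (hi.trans_le hk), dartNumber_inj]
  rw [obstructions, List.isEmpty_iff, List.filter_eq_nil_iff]
  simp only [List.mem_range, decide_eq_true_eq, h.size_eq]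
  have : (∀ a < 2 * n, ¬ (region T a = region T (dartNumber d) ∧
      (((List.range k).filter fun i => (walk T (dartNumber d)).getD i 0 = a).isEmpty = true ∨
        region T (flip a) = region T (dartNumber d)))) ↔
      ∀ x : Dart n, ¬ (Γ.region x = Γ.region d ∧
        ((¬ ∃ i < k, (Γ.face ^ i) d = x) ∨ Γ.region x.flip = Γ.region d)) := by
    constructor
    · intro H x
      have := H _ (dartNumber_lt x)
      rwa [hflt, flip_dartNumber, h.region_eq, h.region_eq, h.region_eq, Fin.val_inj,
        Fin.val_inj] at this
    · intro H a ha
      obtain ⟨x, rfl⟩ := exists_dartNumber ha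
      rw [hflt, flip_dartNumber, h.region_eq, h.region_eq, h.region_eq, Fin.val_inj,
        Fin.val_inj]
      exact H x
  rw [this, SphereGraph.Good, ← forall_and]
  refine forall_congr' fun x => ?_
  rw [not_and, not_or, not_not, ← forall_and]

theorem mem_candidates (h : Describes T Γ) {k : ℕ} (hk : k ≤ 5) (i : ℕ) :
    i ∈ candidates T k ↔ ∃ d : Dart n, dartNumber d = i ∧ Γ.Good k d := by
  simp only [candidates, List.mem_filter, List.mem_range, decide_eq_true_eq, h.size_eq]
  constructor
  · rintro ⟨hi, hg⟩
    obtain ⟨d, rfl⟩ := exists_dartNumber hi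
    exact ⟨d, rfl, (h.obstructions_isEmpty hk d).1 hg⟩
  · rintro ⟨d, rfl, hg⟩
    exact ⟨dartNumber_lt d, (h.obstructions_isEmpty hk d).2 hg⟩

/-- `exists_good` makes the search succeed for `k = 5` at the latest, and trying short walks before
long ones makes `k` minimal. Minimality matters: after an `F`-move the next round may choose a
different region, but not one with a longer walk. -/
theorem exists_best (h : Describes T Γ) (hn : 0 < n) : ∃ (k : ℕ) (d : Dart n),
    dartNumber d = best T ∧ Γ.Good k d ∧ ∀ k' d', Γ.Good k' d' → k ≤ k' := by
  obtain ⟨d₅, h₅⟩ := Γ.exists_good hn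
  have mono : ∀ {k k' d}, Γ.Good k d → k ≤ k' → Γ.Good k' d := fun hg hk =>
    ⟨fun x hx => (hg.1 x hx).imp fun i hi => ⟨hi.1.trans_le hk, hi.2⟩, hg.2⟩
  have pos : ∀ {k d}, Γ.Good k d → 1 ≤ k := fun {k d} hg => by
    obtain ⟨i, hi, -⟩ := hg.1 d rfl
    omega
  have key : ∀ k ≤ 5, ∀ l, best T = (candidates T k ++ l).headD 0 →
      (∀ k' d', Γ.Good k' d' → k ≤ k') → best T = l.headD 0 ∧ (∀ k' d', Γ.Good k' d' → k + 1 ≤ k') ∨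
      ∃ (k : ℕ) (d : Dart n), dartNumber d = best T ∧ Γ.Good k d ∧
        ∀ k' d', Γ.Good k' d' → k ≤ k' := fun k hk l hl hmin => by
    rcases hc : candidates T k with _ | ⟨i, l'⟩
    · left
      rw [hc, List.nil_append] at hl
      refine ⟨hl, fun k' d' hg => ?_⟩
      by_contra hlt
      have : dartNumber d' ∈ candidates T k := (h.mem_candidates hk _).2
        ⟨d', rfl, mono hg (by omega)⟩
      rw [hc] at this
      simp at this
    · right
      have hi : i ∈ candidates T k := by rw [hc]; simp
      obtain ⟨d, hd, hg⟩ := (h.mem_candidates hk _).1 hi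
      refine ⟨k, d, ?_, hg, hmin⟩
      rw [hl, hc, hd]
      rfl
  rcases key 1 (by omega) _ rfl fun k' d' hg => pos hg with ⟨h1, g1⟩ | h1
  · rcases key 2 (by omega) _ h1 g1 with ⟨h2, g2⟩ | h2
    · rcases key 3 (by omega) _ h2 g2 with ⟨h3, g3⟩ | h3
      · rcases key 4 (by omega) _ h3 g3 with ⟨h4, g4⟩ | h4
        · rcases key 5 (by omega) [] (by rw [List.append_nil]; exact h4) g4 with ⟨h5, g5⟩ | h5
          · have := g5 _ _ h₅
            omega
          · exact h5
        · exact h4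
      · exact h3
    · exact h2
  · exact h1

end Describes

def printNumber (k : ℕ) : List TrivalentGraph.Letter :=
  ((List.range k).map fun _ => TrivalentGraph.Letter.tick) ++ [TrivalentGraph.Letter.comma]

def print (T : Tables) : List TrivalentGraph.Letter :=
  ((List.range (size T)).flatMap fun i =>
    printNumber (rot T i) ++ printNumber (dir T i) ++ printNumber (region T i)) ++
      [TrivalentGraph.Letter.semicolon]

theorem range_two_mul (n : ℕ) : List.range (2 * n) =
    (List.finRange n).flatMap fun e => [dartNumber (e, false), dartNumber (e, true)] := by
  have h : ∀ n, List.range (2 * n) = (List.range n).flatMap fun i => [2 * i, 2 * i + 1] := by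
    intro n
    induction n with
    | zero => rfl
    | succ n ih =>
      rw [show 2 * (n + 1) = 2 * n + 1 + 1 by ring, List.range_succ, List.range_succ, ih,
        List.range_succ]
      simp
  rw [h, ← List.map_coe_finRange_eq_range, List.flatMap_map]
  simp [dartNumber]

theorem Describes.print_eq {Δ : TrivalentGraph} {T : Tables} (h : T.Describes Δ.graph) :
    print T = TrivalentGraph.encode Δ ++ [TrivalentGraph.Letter.semicolon] := by
  have hnum : ∀ k, printNumber k = TrivalentGraph.encodeNat k := fun k => by
    simp [printNumber, TrivalentGraph.encodeNat]
  rw [print, TrivalentGraph.encode, h.size_eq, range_two_mul, List.flatMap_assoc]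
  simp only [List.flatMap_cons, List.flatMap_nil, List.append_nil, hnum, h.rot_eq, h.dir_eq,
    h.region_eq]
  rfl

/-- Read one letter. The three lists take turns. -/
def read (s : ℕ × Tables) : TrivalentGraph.Letter → ℕ × Tables
  | .tick => (s.1 + 1, s.2)
  | .comma => (0, (s.2.2.1, s.2.2.2, s.1 :: s.2.1))
  | .semicolon => s

def parse (l : List TrivalentGraph.Letter) : Tables :=
  let s := l.foldl read (0, ([], [], []))
  (s.2.1.reverse, s.2.2.1.reverse, s.2.2.2.reverse)

theorem foldl_read_encodeNat (k j : ℕ) (A B C : List ℕ) :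
    (TrivalentGraph.encodeNat k).foldl read (j, (A, B, C)) = (0, (B, C, (j + k) :: A)) := by
  induction k generalizing j with
  | zero => rfl
  | succ k ih =>
    have := ih (j + 1)
    rw [TrivalentGraph.encodeNat, List.replicate_succ, List.cons_append, List.foldl_cons]
    rw [TrivalentGraph.encodeNat] at this
    refine this.trans ?_
    rw [show j + 1 + k = j + (k + 1) by ring]

theorem describes_parse (Δ : TrivalentGraph) :
    (parse (TrivalentGraph.encode Δ)).Describes Δ.graph := by
  have key : ∀ (l : List (Fin Δ.edges)) (A B C : List ℕ),
      (l.flatMap fun e => TrivalentGraph.encodeDart Δ.graph (e, false) ++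
        TrivalentGraph.encodeDart Δ.graph (e, true)).foldl read (0, (A, B, C)) =
      (0, ((l.flatMap fun e => [dartNumber (Δ.graph.rot (e, false)),
          dartNumber (Δ.graph.rot (e, true))]).reverse ++ A,
        (l.flatMap fun e => [directionNumber (Δ.graph.dir (e, false)),
          directionNumber (Δ.graph.dir (e, true))]).reverse ++ B,
        (l.flatMap fun e => [(Δ.graph.region (e, false)).val,
          (Δ.graph.region (e, true)).val]).reverse ++ C)) := by
    intro l
    induction l with
    | nil => intro A B C; rfl
    | cons e l ih =>
      intro A B C
      rw [List.flatMap_cons, List.foldl_append]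
      simp only [TrivalentGraph.encodeDart, List.foldl_append, foldl_read_encodeNat]
      simp only [TrivalentGraph.encodeDart] at ih
      rw [ih]
      simp
  have hp : parse (TrivalentGraph.encode Δ) =
      ((List.finRange Δ.edges).flatMap fun e => [dartNumber (Δ.graph.rot (e, false)),
          dartNumber (Δ.graph.rot (e, true))],
        (List.finRange Δ.edges).flatMap fun e => [directionNumber (Δ.graph.dir (e, false)),
          directionNumber (Δ.graph.dir (e, true))],
        (List.finRange Δ.edges).flatMap fun e => [(Δ.graph.region (e, false)).val,
          (Δ.graph.region (e, true)).val]) := by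
    rw [parse, TrivalentGraph.encode, key]
    simp
  have hget : ∀ (f : Fin Δ.edges → Bool → ℕ) (x : Dart Δ.edges),
      ((List.finRange Δ.edges).flatMap fun e => [f e false, f e true]).getD (dartNumber x) 0 =
      f x.1 x.2 := fun f x => by
    have := getD_flatMap_pair (List.finRange Δ.edges) f (x.1.cast (by simp)) x.2
    rw [dartNumber]
    simpa using this
  have hlen : ∀ f : Fin Δ.edges → Bool → ℕ,
      ((List.finRange Δ.edges).flatMap fun e => [f e false, f e true]).length = 2 * Δ.edges :=
    fun f => by rw [length_flatMap_pair, List.length_finRange]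
  rw [hp]
  exact ⟨hlen fun e b => dartNumber (Δ.graph.rot (e, b)),
    hlen fun e b => directionNumber (Δ.graph.dir (e, b)),
    hlen fun e b => (Δ.graph.region (e, b)).val,
    hget fun e b => dartNumber (Δ.graph.rot (e, b)),
    hget fun e b => directionNumber (Δ.graph.dir (e, b)),
    hget fun e b => (Δ.graph.region (e, b)).val⟩

end Tables

/-! ### Rounds of the algorithm and the potential that decreases. -/

namespace Journal

open Tables (dartNumber_inj directionNumber_eq_zero)
open SphereGraph

/-- Remove a region, or make a region smaller. -/
def advance (s : Journal) (d : ℕ) : Journal :=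
  if Tables.face s.1 d = d then
    if Tables.dir s.1 d = 0 then circleStep s d else tadpoleStep s d
  else if Tables.face s.1 (Tables.face s.1 d) = d then bubbleStep s d else fStep s d

def next (s : Journal) : Journal :=
  if Tables.size s.1 = 0 then s else advance s (Tables.best s.1)

def print (s : Journal) : List TrivalentGraph.Letter :=
  (s.2.reverse ++ [s.1]).flatMap Tables.print

variable {Γ₀ Δ : TrivalentGraph} {s : Journal}

/-- The potential is `6 * regions + k`. An `F`-move lowers `k` by one. A removal lowers the first
term by 6, and `exists_good` supplies a new region with `k = 5`, so with `k ≥ 1` before, the total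
drops as well. Once the graph is empty, a round does nothing. -/
theorem exists_next (h : Records Γ₀ s Δ) {j : ℕ}
    (hj : Δ.edges = 0 ∨ ∃ k d, Δ.graph.Good k d ∧ 6 * Δ.regions + k ≤ j + 1) :
    ∃ Δ', Records Γ₀ (next s) Δ' ∧
      (Δ'.edges = 0 ∨ ∃ k d, Δ'.graph.Good k d ∧ 6 * Δ'.regions + k ≤ j) := by
  obtain ⟨n, m, Γ⟩ := Δ
  dsimp only at hj
  have hD : s.1.Describes Γ := h.describes
  by_cases hn : n = 0
  · refine ⟨⟨n, m, Γ⟩, ?_, .inl hn⟩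
    rwa [next, if_pos (by rw [hD.size_eq, hn])]
  obtain ⟨k₁, d₁, hk₁, hj⟩ := hj.resolve_left hn
  obtain ⟨k, d, hd, hk, hmin⟩ := hD.exists_best (Nat.pos_of_ne_zero hn)
  have hkk := hmin _ _ hk₁
  have hpos : 0 < k := by
    obtain ⟨i, hi, -⟩ := hk.1 d rfl
    omega
  rw [next, if_neg (by rw [hD.size_eq]; omega), ← hd]
  have removal : (∃ Δ', Records Γ₀ (advance s (dartNumber d)) Δ' ∧ Δ'.regions + 1 = m) →
      ∃ Δ', Records Γ₀ (advance s (dartNumber d)) Δ' ∧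
        (Δ'.edges = 0 ∨ ∃ k d, Δ'.graph.Good k d ∧ 6 * Δ'.regions + k ≤ j) := by
    rintro ⟨Δ', h1, h2⟩
    refine ⟨Δ', h1, ?_⟩
    by_cases h0 : Δ'.edges = 0
    · exact .inl h0
    · obtain ⟨d', hd'⟩ := Δ'.graph.exists_good (Nat.pos_of_ne_zero h0)
      exact .inr ⟨5, d', hd', by omega⟩
  by_cases h1 : Γ.face d = d
  · have hR : ∀ x, Γ.region x = Γ.region d ↔ x = d := fun x => by
      refine ⟨fun hx => ?_, fun hx => by rw [hx]⟩
      obtain ⟨i, -, rfl⟩ := hk.1 x hx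
      clear hx
      induction i with
      | zero => rfl
      | succ i ih => rw [pow_succ, mul_apply, h1, ih]
    apply removal
    rw [advance, if_pos (by rw [hD.face_eq, h1])]
    split_ifs with h0
    · rw [hD.dir_eq, directionNumber_eq_zero] at h0
      exact exists_circleStep h h0 hR
    · rw [hD.dir_eq, directionNumber_eq_zero] at h0
      exact exists_tadpoleStep h h0 h1 hR
  · by_cases h2 : Γ.face (Γ.face d) = d
    · have hR : ∀ x, Γ.region x = Γ.region d ↔ x = d ∨ x = Γ.face d := fun x => by
        constructor
        · intro hx
          obtain ⟨i, -, rfl⟩ := hk.1 x hx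
          clear hx
          induction i with
          | zero => exact .inl rfl
          | succ i ih =>
            rw [pow_succ', mul_apply]
            rcases ih with h | h
            · rw [h]; exact .inr rfl
            · rw [h]; exact .inl h2
        · rintro (rfl | rfl)
          · rfl
          · exact Γ.region_face_apply d
      apply removal
      rw [advance, if_neg (by rw [hD.face_eq, dartNumber_inj]; exact h1),
        if_pos (by rw [hD.face_eq, hD.face_eq, h2])]
      exact exists_bubbleStep h h1 h2 hR
    · rw [advance, if_neg (by rw [hD.face_eq, dartNumber_inj]; exact h1),
        if_neg (by rw [hD.face_eq, hD.face_eq, dartNumber_inj]; exact h2)]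
      obtain ⟨Γ', d', g1, g2⟩ := exists_fStep h hk h1 h2
      exact ⟨_, g1, .inr ⟨k - 1, d', g2, by dsimp only; omega⟩⟩

theorem exists_iterate_next (h : Records Γ₀ s Δ) (i j : ℕ)
    (hj : Δ.edges = 0 ∨ ∃ k d, Δ.graph.Good k d ∧ 6 * Δ.regions + k ≤ j + i) :
    ∃ Δ', Records Γ₀ (next^[i] s) Δ' ∧
      (Δ'.edges = 0 ∨ ∃ k d, Δ'.graph.Good k d ∧ 6 * Δ'.regions + k ≤ j) := by
  induction i generalizing s Δ with
  | zero => exact ⟨Δ, h, hj⟩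
  | succ i ih =>
    obtain ⟨Δ', h1, h2⟩ := exists_next h hj
    exact ih h1 h2

theorem regions_le (hn : 0 < Δ.edges) : Δ.regions ≤ 2 * Δ.edges := by
  have := Fintype.card_le_of_surjective _ (Δ.graph.region_surjective hn)
  simpa [mul_comm] using this

/-- At the start the potential is at most `12 * edges + 5`, since each region has a dart on its
boundary. With `j = 0` this gives termination. With `j` at that initial value it merely says that
the journal is valid after any number of rounds, which is what the size bounds need. -/
theorem exists_records {T : Tables} (hT : T.Describes Γ₀.graph) (i j : ℕ)
    (hj : 12 * Γ₀.edges + 5 ≤ j + i) : ∃ Δ', Records Γ₀ (next^[i] (T, [])) Δ' ∧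
      (Δ'.edges = 0 ∨ ∃ k d, Δ'.graph.Good k d ∧ 6 * Δ'.regions + k ≤ j) := by
  refine exists_iterate_next (.start hT) i j ?_
  by_cases hn : Γ₀.edges = 0
  · exact .inl hn
  · have := regions_le (Nat.pos_of_ne_zero hn)
    obtain ⟨d, hd⟩ := Γ₀.graph.exists_good (Nat.pos_of_ne_zero hn)
    exact .inr ⟨5, d, hd, by omega⟩

theorem exists_records_empty {T : Tables} (hT : T.Describes Γ₀.graph) {i : ℕ}
    (hi : 12 * Γ₀.edges + 5 ≤ i) : ∃ Δ', Records Γ₀ (next^[i] (T, [])) Δ' ∧ Δ'.edges = 0 := by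
  obtain ⟨Δ', h1, h2⟩ := exists_records hT i 0 (by omega)
  refine ⟨Δ', h1, h2.resolve_right ?_⟩
  rintro ⟨k, d, hg, hk⟩
  obtain ⟨i, hi, -⟩ := hg.1 d rfl
  omega

theorem Records.exists_sequence (h : Records Γ₀ s Δ) : ∃ L : List TrivalentGraph,
    L.head? = some Γ₀ ∧ L.getLast? = some Δ ∧ L.IsChain TrivalentGraph.Move ∧
      print s = TrivalentGraph.encodeSequence L := by
  induction h with
  | start hT =>
    exact ⟨[Γ₀], rfl, rfl, by simp, by
      simp [print, TrivalentGraph.encodeSequence, hT.print_eq]⟩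
  | @step s Δ Δ' T h hmove _ hT ih =>
    obtain ⟨L, h1, h2, h3, h4⟩ := ih
    refine ⟨L ++ [Δ'], ?_, by simp, ?_, ?_⟩
    · rw [List.head?_append, h1]; rfl
    · rw [List.isChain_append]
      refine ⟨h3, by simp, fun x hx y hy => ?_⟩
      rw [h2] at hx
      obtain rfl := Option.some.inj hx
      simp only [List.head?_cons, Option.mem_def, Option.some.injEq] at hy
      exact hy ▸ hmove
    · rw [TrivalentGraph.encodeSequence, List.flatMap_append]
      rw [TrivalentGraph.encodeSequence] at h4
      rw [← h4]
      simp [print, push, hT.print_eq]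

end Journal

/-! ## The algorithm runs in polynomial time -/

namespace Tables

variable {α : Type} [Enc α] {T : α → Tables} {f g h i j k l : α → ℕ}

open PolyTime

@[fun_prop]
theorem polyTime_rot (hT : PolyTime T) (hf : PolyTime f) : PolyTime fun a => rot (T a) (f a) := by
  unfold rot; fun_prop

@[fun_prop]
theorem polyTime_dir (hT : PolyTime T) (hf : PolyTime f) : PolyTime fun a => dir (T a) (f a) := by
  unfold dir; fun_prop

@[fun_prop]
theorem polyTime_region (hT : PolyTime T) (hf : PolyTime f) :
    PolyTime fun a => region (T a) (f a) := by
  unfold region; fun_prop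

@[fun_prop]
theorem polyTime_size (hT : PolyTime T) : PolyTime fun a => size (T a) := by
  unfold size; fun_prop

theorem polyTime_build {F G H : α → ℕ → ℕ} (hf : PolyTime f)
    (hF : PolyTime fun x : α × ℕ => F x.1 x.2) (hG : PolyTime fun x : α × ℕ => G x.1 x.2)
    (hH : PolyTime fun x : α × ℕ => H x.1 x.2) :
    PolyTime fun a => build (f a) (F a) (G a) (H a) :=
  (map hF hf.range).pair ((map hG hf.range).pair (map hH hf.range))

@[fun_prop]
theorem polyTime_initial (hf : PolyTime f) : PolyTime fun a => initial (f a) := by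
  unfold initial; fun_prop

@[fun_prop]
theorem polyTime_flip (hf : PolyTime f) : PolyTime fun a => flip (f a) := by
  unfold flip; fun_prop

@[fun_prop]
theorem polyTime_swap (hf : PolyTime f) (hg : PolyTime g) (hh : PolyTime h) :
    PolyTime fun a => swap (f a) (g a) (h a) := by
  unfold swap; fun_prop

@[fun_prop]
theorem polyTime_face (hT : PolyTime T) (hf : PolyTime f) :
    PolyTime fun a => face (T a) (f a) := by
  unfold face; fun_prop

@[fun_prop]
theorem polyTime_reverse (hT : PolyTime T) (hf : PolyTime f) :
    PolyTime fun a => reverse (T a) (f a) := by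
  unfold reverse
  exact polyTime_build (by fun_prop) (by fun_prop) (by fun_prop) (by fun_prop)

@[fun_prop]
theorem polyTime_nextDirection (hf : PolyTime f) : PolyTime fun a => nextDirection (f a) := by
  unfold nextDirection; fun_prop

@[fun_prop]
theorem polyTime_spiral (hT : PolyTime T) (hf : PolyTime f) :
    PolyTime fun a => spiral (T a) (f a) := by
  unfold spiral
  exact polyTime_build (by fun_prop) (by fun_prop) (by fun_prop) (by fun_prop)

@[fun_prop]
theorem polyTime_shift (hf : PolyTime f) (hg : PolyTime g) (hh : PolyTime h) (hi : PolyTime i)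
    (hj : PolyTime j) : PolyTime fun a => shift (f a) (g a) (h a) (i a) (j a) := by
  unfold shift; fun_prop

@[fun_prop]
theorem polyTime_shiftBack (hf : PolyTime f) (hg : PolyTime g) (hh : PolyTime h) (hi : PolyTime i)
    (hj : PolyTime j) : PolyTime fun a => shiftBack (f a) (g a) (h a) (i a) (j a) := by
  unfold shiftBack; fun_prop

@[fun_prop]
theorem polyTime_fMove (hT : PolyTime T) (hf : PolyTime f) (hg : PolyTime g) (hh : PolyTime h)
    (hi : PolyTime i) : PolyTime fun a => fMove (T a) (f a) (g a) (h a) (i a) := by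
  unfold fMove
  exact polyTime_build (by fun_prop) (by fun_prop) (by fun_prop) (by fun_prop)

@[fun_prop]
theorem polyTime_keep (hT : PolyTime T) (hf : PolyTime f) (hg : PolyTime g) (hh : PolyTime h) :
    PolyTime fun a => keep (T a) (f a) (g a) (h a) := by
  unfold keep
  refine flatMap (f := fun _ i => [i, i + 1]) (by fun_prop) ?_
  exact filter (p := fun a i => i % 2 = 0 ∧ i ≠ f a ∧ i ≠ g a ∧ i ≠ h a) (by fun_prop) (by fun_prop)

@[fun_prop]
theorem polyTime_position {K : α → List ℕ} (hK : PolyTime K) (hf : PolyTime f) :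
    PolyTime fun a => position (K a) (f a) := by
  unfold position
  exact headD (filter (p := fun a i => (K a).getD i 0 = f a) (by fun_prop) (by fun_prop))

@[fun_prop]
theorem polyTime_restrict {K : α → List ℕ} (hT : PolyTime T) (hK : PolyTime K) (hf : PolyTime f)
    (hg : PolyTime g) (hh : PolyTime h) (hi : PolyTime i) :
    PolyTime fun a => restrict (T a) (K a) (f a) (g a) (h a) (i a) := by
  unfold restrict
  exact polyTime_build (by fun_prop) (by fun_prop) (by fun_prop) (by fun_prop)

@[fun_prop]
theorem polyTime_removeCircle (hT : PolyTime T) (hf : PolyTime f) :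
    PolyTime fun a => removeCircle (T a) (f a) := by
  unfold removeCircle; fun_prop

@[fun_prop]
theorem polyTime_splice (hT : PolyTime T) (hf : PolyTime f) (hg : PolyTime g) (hh : PolyTime h)
    (hi : PolyTime i) (hj : PolyTime j) :
    PolyTime fun a => splice (T a) (f a) (g a) (h a) (i a) (j a) := by
  unfold splice; fun_prop

@[fun_prop]
theorem polyTime_walk (hT : PolyTime T) (hf : PolyTime f) :
    PolyTime fun a => walk (T a) (f a) := by
  unfold walk; fun_prop

@[fun_prop]
theorem polyTime_obstructions (hT : PolyTime T) (hf : PolyTime f) (hg : PolyTime g) :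
    PolyTime fun a => obstructions (T a) (f a) (g a) := by
  unfold obstructions
  refine filter (p := fun a x => region (T a) x = region (T a) (g a) ∧
    (((List.range (f a)).filter fun i => (walk (T a) (g a)).getD i 0 = x).isEmpty = true ∨
      region (T a) (flip x) = region (T a) (g a))) ?_ (by fun_prop)
  refine decide_and (by fun_prop) (decide_or (decide_true (isEmpty ?_)) (by fun_prop))
  exact filter (p := fun (x : α × ℕ) i => (walk (T x.1) (g x.1)).getD i 0 = x.2) (by fun_prop)
    (by fun_prop)

@[fun_prop]
theorem polyTime_candidates (hT : PolyTime T) (hf : PolyTime f) :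
    PolyTime fun a => candidates (T a) (f a) := by
  unfold candidates
  exact filter (p := fun a d => (obstructions (T a) (f a) d).isEmpty = true) (by fun_prop)
    (by fun_prop)

@[fun_prop]
theorem polyTime_best (hT : PolyTime T) : PolyTime fun a => best (T a) := by
  unfold best; fun_prop

@[fun_prop]
theorem polyTime_printNumber (hf : PolyTime f) : PolyTime fun a => printNumber (f a) := by
  unfold printNumber
  exact append (map (f := fun _ _ => TrivalentGraph.Letter.tick) (const _) (by fun_prop)) (const _)

@[fun_prop]
theorem polyTime_print (hT : PolyTime T) : PolyTime fun a => print (T a) := by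
  unfold print
  exact append (flatMap (f := fun a i => printNumber (rot (T a) i) ++ printNumber (dir (T a) i) ++
    printNumber (region (T a) i)) (by fun_prop) (by fun_prop)) (const _)

def letterNumber : Letter → ℕ
  | .tick => 0
  | .comma => 1
  | .semicolon => 2

/-- Letters are represented by the same trees as the numbers `0`, `1`, `2`, so this conversion is
free, and telling letters apart becomes a test of numbers. -/
theorem polyTime_letterNumber : PolyTime letterNumber :=
  of_str_eq fun a => by cases a <;> rfl

theorem polyTime_read : PolyTime fun x : (ℕ × Tables) × Letter => read x.1 x.2 := by
  have h : PolyTime fun x : (ℕ × Tables) × Letter => letterNumber x.2 :=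
    comp (g := letterNumber) polyTime_letterNumber (by fun_prop)
  refine congr_str (f := fun x : (ℕ × Tables) × Letter => if letterNumber x.2 = 0
    then (x.1.1 + 1, x.1.2) else if letterNumber x.2 = 1
      then (0, (x.1.2.2.1, x.1.2.2.2, x.1.1 :: x.1.2.1)) else x.1) ?_ ?_
  · fun_prop
  · rintro ⟨s, _ | _ | _⟩ <;> rfl

theorem size_foldl_read (l : List Letter) (s : ℕ × Tables) :
    _root_.size (l.foldl read s) ≤ _root_.size s + 2 * l.length := by
  induction l generalizing s with
  | nil => simp
  | cons a l ih =>
    rw [List.foldl_cons, List.length_cons]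
    refine (ih _).trans ?_
    have : _root_.size (read s a) ≤ _root_.size s + 2 := by
      obtain ⟨k, A, B, C⟩ := s
      cases a <;> simp [read] <;> omega
    omega

@[fun_prop]
theorem polyTime_parse {l : α → List Letter} (hl : PolyTime l) : PolyTime fun a => parse (l a) := by
  have h : PolyTime fun a => (l a).foldl read (0, ([], [], [])) := by
    refine foldl (f := fun _ => read) (B := fun a => _root_.size (l a) + _root_.size (l a) + 9)
      (comp (g := fun x : (ℕ × Tables) × Letter => read x.1 x.2)
        (f := fun x : α × (ℕ × Tables) × Letter => x.2) polyTime_read (by fun_prop))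
      hl (const _) ((hl.size_le.add hl.size_le).add (.const 9)) fun a l₁ l₂ h => ?_
    refine (size_foldl_read _ _).trans ?_
    have h1 := length_le_size (l a)
    rw [h, List.length_append] at h1
    have h2 : _root_.size ((0, ([], [], [])) : ℕ × Tables) ≤ 9 := by simp
    rw [h]
    omega
  unfold parse
  fun_prop

end Tables

namespace Journal

variable {α : Type} [Enc α] {s : α → Journal} {T : α → Tables} {f g h i j k : α → ℕ}

open PolyTime Tables

@[fun_prop]
theorem polyTime_push (hs : PolyTime s) (hT : PolyTime T) : PolyTime fun a => push (s a) (T a) := by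
  unfold push; fun_prop

@[fun_prop]
theorem polyTime_orient (hs : PolyTime s) (hf : PolyTime f) (hg : PolyTime g) :
    PolyTime fun a => orient (s a) (f a) (g a) := by
  unfold orient; fun_prop

@[fun_prop]
theorem polyTime_turnStep (hs : PolyTime s) (hf : PolyTime f) (hg : PolyTime g) :
    PolyTime fun a => turnStep (f a) (g a) (s a) := by
  unfold turnStep; fun_prop

@[fun_prop]
theorem polyTime_turnTo (hs : PolyTime s) (hf : PolyTime f) (hg : PolyTime g) :
    PolyTime fun a => turnTo (s a) (f a) (g a) := by
  unfold turnTo; fun_prop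

@[fun_prop]
theorem polyTime_circleStep (hs : PolyTime s) (hf : PolyTime f) :
    PolyTime fun a => circleStep (s a) (f a) := by
  unfold circleStep; fun_prop

@[fun_prop]
theorem polyTime_orientEnds (hs : PolyTime s) (hf : PolyTime f) (hg : PolyTime g) (hh : PolyTime h)
    (hi : PolyTime i) : PolyTime fun a => orientEnds (s a) (f a) (g a) (h a) (i a) := by
  unfold orientEnds; fun_prop

@[fun_prop]
theorem polyTime_pushSplice (hs : PolyTime s) (hf : PolyTime f) (hg : PolyTime g) (hh : PolyTime h)
    (hi : PolyTime i) (hj : PolyTime j) :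
    PolyTime fun a => pushSplice (s a) (f a) (g a) (h a) (i a) (j a) := by
  unfold pushSplice; fun_prop

@[fun_prop]
theorem polyTime_trimTadpole (hs : PolyTime s) (hf : PolyTime f) (hg : PolyTime g) (hh : PolyTime h)
    (hi : PolyTime i) : PolyTime fun a => trimTadpole (s a) (f a) (g a) (h a) (i a) := by
  unfold trimTadpole; fun_prop

@[fun_prop]
theorem polyTime_tadpoleStep (hs : PolyTime s) (hf : PolyTime f) :
    PolyTime fun a => tadpoleStep (s a) (f a) := by
  unfold tadpoleStep; fun_prop

@[fun_prop]
theorem polyTime_popBubble (hs : PolyTime s) (hf : PolyTime f) (hg : PolyTime g) (hh : PolyTime h)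
    (hi : PolyTime i) : PolyTime fun a => popBubble (s a) (f a) (g a) (h a) (i a) := by
  unfold popBubble; fun_prop

@[fun_prop]
theorem polyTime_bubbleStep (hs : PolyTime s) (hf : PolyTime f) :
    PolyTime fun a => bubbleStep (s a) (f a) := by
  unfold bubbleStep; fun_prop

@[fun_prop]
theorem polyTime_pushFMove (hs : PolyTime s) (hf : PolyTime f) (hg : PolyTime g) (hh : PolyTime h)
    (hi : PolyTime i) : PolyTime fun a => pushFMove (s a) (f a) (g a) (h a) (i a) := by
  unfold pushFMove; fun_prop

@[fun_prop]
theorem polyTime_moveEdge (hs : PolyTime s) (hf : PolyTime f) (hg : PolyTime g) (hh : PolyTime h)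
    (hi : PolyTime i) (hj : PolyTime j) :
    PolyTime fun a => moveEdge (s a) (f a) (g a) (h a) (i a) (j a) := by
  unfold moveEdge; fun_prop

@[fun_prop]
theorem polyTime_fStep (hs : PolyTime s) (hf : PolyTime f) :
    PolyTime fun a => fStep (s a) (f a) := by
  unfold fStep; fun_prop

@[fun_prop]
theorem polyTime_advance (hs : PolyTime s) (hf : PolyTime f) :
    PolyTime fun a => advance (s a) (f a) := by
  unfold advance; fun_prop

@[fun_prop]
theorem polyTime_next (hs : PolyTime s) : PolyTime fun a => next (s a) := by
  unfold next; fun_prop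

@[fun_prop]
theorem polyTime_print (hs : PolyTime s) : PolyTime fun a => print (s a) := by
  unfold print
  exact flatMap (f := fun _ T => Tables.print T) (by fun_prop) (by fun_prop)

section length

variable (s : Journal) (x y z w v t d a b c e : ℕ)

theorem length_orient : (orient s x y).2.length ≤ s.2.length + 1 := by
  unfold orient
  split_ifs <;> simp [push]

theorem length_turnStep : (turnStep v t s).2.length ≤ s.2.length + 1 := by
  unfold turnStep
  split_ifs <;> simp [push]

theorem length_turnTo : (turnTo s v t).2.length ≤ s.2.length + 5 := by
  have h1 := length_turnStep s v t
  have h2 := length_turnStep (turnStep v t s) v t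
  have h3 := length_turnStep (turnStep v t (turnStep v t s)) v t
  have h4 := length_turnStep (turnStep v t (turnStep v t (turnStep v t s))) v t
  have h5 := length_turnStep (turnStep v t (turnStep v t (turnStep v t (turnStep v t s)))) v t
  unfold turnTo
  omega

theorem length_orientEnds : (orientEnds s x y z w).2.length ≤ s.2.length + 2 := by
  have h1 := length_orient s x z
  have h2 := length_orient (orient s x z) y w
  unfold orientEnds
  split_ifs <;> omega

theorem length_push (T : Tables) : (push s T).2.length = s.2.length + 1 := rfl

theorem length_circleStep : (circleStep s d).2.length ≤ s.2.length + 2 := by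
  have := length_orient s d 0
  rw [circleStep, length_push]
  omega

theorem length_trimTadpole : (trimTadpole s x y z w).2.length ≤ s.2.length + 15 := by
  rw [trimTadpole, pushSplice, length_push]
  have h1 := length_orient s x 1
  have h2 := length_orient (orient s x 1) y 0
  have h3 := length_orientEnds (orient (orient s x 1) y 0) z w 1 0
  have h4 := length_turnTo (orientEnds (orient (orient s x 1) y 0) z w 1 0) (initial y) 5
  have h5 := length_turnTo (turnTo (orientEnds (orient (orient s x 1) y 0) z w 1 0) (initial y) 5)
    (initial y + 1) 2
  omega

theorem length_popBubble : (popBubble s x y z w).2.length ≤ s.2.length + 15 := by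
  rw [popBubble, pushSplice, length_push]
  have h1 := length_orient s x 0
  have h2 := length_orient (orient s x 0) y 0
  have h3 := length_orientEnds (orient (orient s x 0) y 0) z w 1 0
  have h4 := length_turnTo (orientEnds (orient (orient s x 0) y 0) z w 1 0) (initial z + 1) 2
  have h5 := length_turnTo (turnTo (orientEnds (orient (orient s x 0) y 0) z w 1 0)
    (initial z + 1) 2) (initial w) 5
  omega

theorem length_moveEdge : (moveEdge s e b a c d).2.length ≤ s.2.length + 16 := by
  rw [moveEdge, pushFMove, length_push]
  have h1 := length_orient s e 0
  have h2 := length_orient (orient s e 0) b 1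
  have h2' := length_orient (orient (orient s e 0) b 1) c 1
  have h3 := length_orientEnds (orient (orient (orient s e 0) b 1) c 1) a d 1 0
  have h4 := length_turnTo (orientEnds (orient (orient (orient s e 0) b 1) c 1) a d 1 0)
    (initial e) 5
  have h5 := length_turnTo (turnTo (orientEnds (orient (orient (orient s e 0) b 1) c 1) a d 1 0)
    (initial e) 5) (initial e + 1) 3
  omega

/-- An `F`-step is the longest: three orientations, two more for the outer ends, five notches at
each of two vertices, and the move itself. -/
theorem length_next : (next s).2.length ≤ s.2.length + 16 := by
  have h1 := length_circleStep s
  have h2 := length_trimTadpole s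
  have h3 := length_popBubble s
  have h4 := length_moveEdge s
  rw [next]
  split_ifs
  · omega
  rw [advance]
  split_ifs
  · exact (h1 _).trans (by omega)
  · exact (h2 _ _ _ _).trans (by omega)
  · exact (h3 _ _ _ _).trans (by omega)
  · exact h4 _ _ _ _ _

theorem length_iterate_next : (next^[t] s).2.length ≤ s.2.length + 16 * t := by
  induction t generalizing s with
  | zero => simp
  | succ t ih =>
    rw [Function.iterate_succ_apply]
    have := ih (next s)
    have := length_next s
    omega

end length

/-! ### Size of the journal. -/

section size

variable {Γ₀ Δ : TrivalentGraph}

theorem size_list_nat_le {l : List ℕ} {N M : ℕ} (hl : l.length = N)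
    (h : ∀ i < N, l.getD i 0 ≤ M) : _root_.size l ≤ N * (2 * M + 2) + 1 := by
  rw [← hl]
  refine size_list_le (M := 2 * M + 1) fun a ha => ?_
  obtain ⟨i, hi, rfl⟩ := List.mem_iff_getElem.1 ha
  have := h i (hl ▸ hi)
  rw [List.getD_eq_getElem _ _ hi] at this
  rw [size_nat]
  omega

theorem size_tables_le {T : Tables} (h : T.Describes Δ.graph) :
    _root_.size T ≤ 3 * (2 * Δ.edges * (2 * (2 * Δ.edges + 6) + 2)) + 5 := by
  have h1 := size_list_nat_le (M := 2 * Δ.edges + 6) h.length_rot fun i hi => by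
    obtain ⟨x, rfl⟩ := exists_dartNumber hi
    have := h.rot_eq x
    have := dartNumber_lt (Δ.graph.rot x)
    simp only [Tables.rot] at *
    omega
  have h2 := size_list_nat_le (M := 2 * Δ.edges + 6) h.length_dir fun i hi => by
    obtain ⟨x, rfl⟩ := exists_dartNumber hi
    have := h.dir_eq x
    have : TrivalentGraph.directionNumber (Δ.graph.dir x) ≤ 6 := by
      rcases Δ.graph.dir x with _ | y
      · simp [TrivalentGraph.directionNumber]
      · exact ZMod.val_lt y
    simp only [Tables.dir] at *
    omega
  have h3 := size_list_nat_le (M := 2 * Δ.edges + 6) h.length_region fun i hi => by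
    obtain ⟨x, rfl⟩ := exists_dartNumber hi
    have h4 := h.region_eq x
    have h5 := (Δ.graph.region x).isLt
    have h6 := regions_le x.1.pos
    simp only [Tables.region] at *
    omega
  obtain ⟨A, B, C⟩ := T
  simp only [size_pair] at *
  omega

/-- No move increases the number of edges, so every table recorded obeys the bound for the initial
graph. -/
theorem Records.size_le {s : Journal} (h : Records Γ₀ s Δ) : Δ.edges ≤ Γ₀.edges ∧
    ∀ T ∈ s.1 :: s.2, _root_.size T ≤ 3 * (2 * Γ₀.edges * (2 * (2 * Γ₀.edges + 6) + 2)) + 5 := by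
  have mono : ∀ {a b : ℕ}, a ≤ b → 3 * (2 * a * (2 * (2 * a + 6) + 2)) + 5 ≤
      3 * (2 * b * (2 * (2 * b + 6) + 2)) + 5 := fun h => by gcongr
  induction h with
  | start hT => exact ⟨le_rfl, by simpa using size_tables_le hT⟩
  | step h _ he hT ih =>
    refine ⟨he.trans ih.1, fun T hT' => ?_⟩
    rcases List.mem_cons.1 hT' with rfl | hT'
    · exact (size_tables_le hT).trans (mono (he.trans ih.1))
    · exact ih.2 T hT'

theorem edges_le_length_encode (Δ : TrivalentGraph) :
    6 * Δ.edges ≤ (TrivalentGraph.encode Δ).length := by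
  have h := TrivalentGraph.count_comma_encodeEdges Δ.graph (List.finRange Δ.edges)
  rw [List.length_finRange] at h
  rw [← h]
  exact List.count_le_length

end size

/-- The strings that are codes of graphs. -/
abbrev Code : Type := {l : List Letter // ∃ Δ, TrivalentGraph.encode Δ = l}

/-- A number of rounds that suffices for the graph with a given code. -/
def rounds (l : Code) : ℕ := l.1.length + l.1.length + 5

theorem polyTime_rounds : PolyTime rounds := by
  unfold rounds
  fun_prop

/-- `iterate` applies because after at most `2 * size l + 5` rounds the journal holds at most 16
times as many earlier tables, each of quadratic size. The bound relies on the tables describing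
graphs, which is why the input is restricted to codes. -/
theorem polyTime_run : PolyTime fun l : Code => next^[rounds l] (parse l.1, []) := by
  have hz : PolyBounded fun l : Code => _root_.size l := .size
  refine iterate (f := fun _ => next) (c := fun l : Code => (parse l.1, []))
    (n := rounds) (by fun_prop) polyTime_rounds (by fun_prop)
    (B := fun l => (3 * (2 * _root_.size l * (2 * (2 * _root_.size l + 6) + 2)) + 5 + 1) *
      (16 * (2 * _root_.size l + 5) + 2)) ?_ ?_
  · refine PolyBounded.mul (PolyBounded.add (PolyBounded.add (PolyBounded.mul (.const 3)
      (PolyBounded.mul (PolyBounded.mul (.const 2) hz) (PolyBounded.add (PolyBounded.mul (.const 2)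
        (PolyBounded.add (PolyBounded.mul (.const 2) hz) (.const 6))) (.const 2)))) (.const 5))
          (.const 1)) ?_
    exact PolyBounded.add (PolyBounded.mul (.const 16) (PolyBounded.add (PolyBounded.mul (.const 2)
      hz) (.const 5))) (.const 2)
  · rintro ⟨l, Δ, rfl⟩ i hi
    have hd := describes_parse Δ
    -- Only the validity of the journal after `i` rounds is used, so `j` is taken so large that the
    -- bound on the potential is void.
    obtain ⟨Δ', h1, -⟩ := exists_records hd i (12 * Δ.edges + 5) (by omega)
    obtain ⟨-, h2⟩ := h1.size_le
    have h3 := length_iterate_next (parse (TrivalentGraph.encode Δ), []) i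
    have h4 := edges_le_length_encode Δ
    have h5 := length_le_size (TrivalentGraph.encode Δ)
    set s := next^[i] (parse (TrivalentGraph.encode Δ), []) with hs
    have h6 := size_list_le (l := s.2) fun T hT => h2 T (List.mem_cons_of_mem _ hT)
    have h7 := h2 s.1 List.mem_cons_self
    have hz : _root_.size (⟨TrivalentGraph.encode Δ, Δ, rfl⟩ : Code) =
        _root_.size (TrivalentGraph.encode Δ) := rfl
    set z := _root_.size (TrivalentGraph.encode Δ) with hzdef
    have hE : Δ.edges ≤ z := by omega
    have hb : 3 * (2 * Δ.edges * (2 * (2 * Δ.edges + 6) + 2)) + 5 ≤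
        3 * (2 * z * (2 * (2 * z + 6) + 2)) + 5 := by gcongr
    have hlen : s.2.length ≤ 16 * (2 * z + 5) := by
      have h8 : s.2.length ≤ 16 * i := by simpa using h3
      have h9 : i ≤ 2 * z + 5 := by
        have h10 : i ≤ (TrivalentGraph.encode Δ).length + (TrivalentGraph.encode Δ).length + 5 := hi
        omega
      omega
    change _root_.size s ≤ _
    simp only [hz]
    rw [size_prod]
    have h8 : s.2.length * (3 * (2 * Δ.edges * (2 * (2 * Δ.edges + 6) + 2)) + 5 + 1) ≤
        16 * (2 * z + 5) * (3 * (2 * z * (2 * (2 * z + 6) + 2)) + 5 + 1) := by gcongr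
    rw [mul_add (3 * (2 * z * (2 * (2 * z + 6) + 2)) + 5 + 1),
      mul_comm _ (16 * (2 * z + 5))]
    omega

end Journal

theorem mainTheorem2 :
    ∃ f : TrivalentGraph → List TrivalentGraph,
      Nonempty (Turing.TM2ComputableInPolyTime
        TrivalentGraph.encode TrivalentGraph.encodeSequence f) ∧
      ∀ Γ : TrivalentGraph,
        (f Γ).head? = some Γ ∧
        (∃ Δ : TrivalentGraph, (f Γ).getLast? = some Δ ∧ Δ.IsEmpty) ∧
        (f Γ).IsChain fun Δ Δ' =>
          (TrivalentGraph.Rearrangement Δ Δ' ∧ Δ'.regions = Δ.regions) ∨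
          (TrivalentGraph.Removal Δ Δ' ∧ Δ'.regions + 1 = Δ.regions) := by
  have key : ∀ Γ : TrivalentGraph, ∃ L : List TrivalentGraph, L.head? = some Γ ∧
      (∃ Δ : TrivalentGraph, L.getLast? = some Δ ∧ Δ.IsEmpty) ∧
      L.IsChain TrivalentGraph.Move ∧
      (Journal.next^[Journal.rounds ⟨TrivalentGraph.encode Γ, Γ, rfl⟩]
        (Tables.parse (TrivalentGraph.encode Γ), [])).print = TrivalentGraph.encodeSequence L := by
    intro Γ
    have := Journal.edges_le_length_encode Γ
    obtain ⟨Δ, h1, h2⟩ := Journal.exists_records_empty (Tables.describes_parse Γ)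
      (i := Journal.rounds ⟨TrivalentGraph.encode Γ, Γ, rfl⟩) (by unfold Journal.rounds; dsimp only; omega)
    obtain ⟨L, g1, g2, g3, g4⟩ := h1.exists_sequence
    exact ⟨L, g1, ⟨Δ, g2, h2⟩, g3, g4⟩
  -- The sequence may be chosen nonconstructively: the machine computes the printed journal, and
  -- `h4` says that this is the code of the chosen sequence.
  choose f h1 h2 h3 h4 using key
  refine ⟨f, ?_, fun Γ => ⟨h1 Γ, h2 Γ, h3 Γ⟩⟩
  exact PolyTime.turing (p := fun l => ∃ Δ, TrivalentGraph.encode Δ = l) (fun Γ => ⟨Γ, rfl⟩)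
    (Journal.polyTime_print Journal.polyTime_run) h4
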